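/- Let $-\infty<a<b<\infty$, $n,N\in\mathbb N_0$, $\mathcal X=L^2(a,b;\mathbb C^n)$, and let $J_0,\dots,J_N\in\mathbb C^{n\times n}$ satisfy $J_k=(-1)^{k+1}J_k^H$. Let $\mathcal J_0$ be the operator in $\mathcal X$ with domain $C_c^\infty(a,b;\mathbb C^n)$ and $\mathcal J_0x=\sum_{k=0}^N(-1)^kJ_k^H x^{(k)}$, and let $\mathcal J_0^*$ be its Hilbert space adjoint, with domain $H(\mathcal J_0^*;a,b)$ equipped with the graph norm $(\|x\|^2+\|\mathcal J_0^*x\|^2)^{1/2}$. Let $Q=(Q_{ij})_{i,j=1}^N\in\mathbb C^{Nn\times Nn}$ be the Hermitian block matrix with $Q_{ij}=(-1)^{i-1}J_{i+j-1}$ if $i+j-1\le N$ and $Q_{ij}=0$ otherwise. Put $r=\operatorname{rk}Q$ and let $Q=S_{\mathrm r}K_{\mathrm r}S_{\mathrm r}^H$ be a reduced spectral factorization, i.e. $S_{\mathrm r}\in\mathbb C^{Nn\times r}$ has orthonormal columns and $K_{\mathrm r}\in\mathbb R^{r\times r}$ is diagonal with nonzero diagonal entries (the nonzero eigenvalues of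 $Q$). For $x\in H^N(a,b;\mathbb C^n)$ and $\xi\in\{a,b\}$ let $\gamma_\xi x=(x(\xi),x'(\xi),\dots,x^{(N-1)}(\xi))\in\mathbb C^{Nn}$ and define $\Gamma=(\Gamma_0,\Gamma_1):H^N(a,b;\mathbb C^n)\to\mathbb C^r\times\mathbb C^r$ by $$\Gamma_0x=\tfrac1{\sqrt2}K_{\mathrm r}S_{\mathrm r}^H(\gamma_bx-\gamma_ax),\qquad \Gamma_1x=\tfrac1{\sqrt2}S_{\mathrm r}^H(\gamma_bx+\gamma_ax).$$ Then $\Gamma$ has a unique linear extension $\widehat\Gamma=(\widehat\Gamma_0,\widehat\Gamma_1):H(\mathcal J_0^*;a,b)\to\mathbb C^r\times\mathbb C^r$ that is bounded for the graph norm, and $(\mathbb C^r,\widehat\Gamma_0,\widehat\Gamma_1)$ is a boundary triplet for $\mathcal J_0^*$: $\mathcal J_0$ is densely defined and skew-symmetric, $\widehat\Gamma$ is surjective, and $\langle\mathcal J_0^*x,y\rangle+\langle x,\mathcal J_0^*y\rangle=\langle\widehat\Gamma_1x,\widehat\Gamma_0y\rangle+\langle\widehat\Gamma_0x,\widehat\Gamma_1y\rangle$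 for all $x,y\in H(\mathcal J_0^*;a,b)$. Moreover, for all $F,E\in\mathbb C^{r\times r}$, the restriction $\mathcal J$ of $\mathcal J_0^*$ to $\operatorname{dom}\mathcal J=\{x\in H(\mathcal J_0^*;a,b): F\widehat\Gamma_0x+E\widehat\Gamma_1x=0\}$ has the following properties: (i) $\mathcal J$ is closed; (ii) $-\mathcal J^*$ is the restriction of $\mathcal J_0^*$ to $\operatorname{dom}\mathcal J^*=\{x\in H(\mathcal J_0^*;a,b):\widehat\Gamma x\in\operatorname{ran}\begin{bmatrix}E^H\\F^H\end{bmatrix}\}$; (iii) $\mathcal J$ is maximally dissipative (its graph $H$ satisfies $\operatorname{Re}\langle g,f\rangle\le0$ for all $(f,g)\in H$, and is not properly contained in another linear relation in $\mathcal X$ with this property) if and only if $FE^H+EF^H\ge0$ and $\operatorname{rk}\begin{bmatrix}F&E\end{bmatrix}=\operatorname{rk}Q$; and $\mathcal J$ is skew-adjoint ($\mathcal J=-\mathcal J^*$) if and only if $FE^H+EF^H=0$ and $\operatorname{rk}\begin{bmatrix}F&E\end{bmatrix}=\operatorname{rk}Q$. -/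

import Mathlib

open MeasureTheory Set
open scoped ContDiff Matrix InnerProductSpace ComplexOrder

noncomputable section

/-! ## The Hilbert space `L²(a,b; ℂⁿ)` and test functions -/

/-- The Hilbert space `L²(a,b; ℂⁿ)`. -/
abbrev L2Space (a b : ℝ) (n : ℕ) : Type :=
  Lp (EuclideanSpace ℂ (Fin n)) 2 (volume.restrict (Ioo a b))

/-- The test functions `C_c^∞(a,b; V)`, as functions on `ℝ` whose support is a compact subset of
the open interval `(a,b)`. -/
def testFunctions (a b : ℝ) (V : Type*) [NormedAddCommGroup V] [NormedSpace ℝ V]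
    (𝕜 : Type*) [NormedField 𝕜] [NormedSpace 𝕜 V] [SMulCommClass ℝ 𝕜 V] :
    Submodule 𝕜 (ℝ → V) where
  carrier := {φ | ContDiff ℝ ∞ φ ∧ HasCompactSupport φ ∧ tsupport φ ⊆ Ioo a b}
  zero_mem' := ⟨contDiff_const, HasCompactSupport.zero, by
    rw [tsupport_eq_empty_iff.2 rfl]; exact empty_subset _⟩
  add_mem' := by
    rintro φ ψ ⟨h1, h2, h3⟩ ⟨k1, k2, k3⟩
    exact ⟨h1.add k1, h2.add k2, (tsupport_add φ ψ).trans (union_subset h3 k3)⟩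
  smul_mem' := by
    rintro c φ ⟨h1, h2, h3⟩
    have hs : tsupport (c • φ) ⊆ tsupport φ :=
      closure_mono (Function.support_const_smul_subset c φ)
    exact ⟨h1.const_smul c, h2.of_isClosed_subset (isClosed_tsupport _) hs, hs.trans h3⟩

/-- `C_c^∞(a,b; ℂⁿ)` as a complex vector space. -/
abbrev TestFun (a b : ℝ) (n : ℕ) : Submodule ℂ (ℝ → EuclideanSpace ℂ (Fin n)) :=
  testFunctions a b (EuclideanSpace ℂ (Fin n)) ℂ

theorem testFun_memLp {a b : ℝ} {n : ℕ} (φ : TestFun a b n) :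
    MemLp (φ : ℝ → EuclideanSpace ℂ (Fin n)) 2 (volume.restrict (Ioo a b)) :=
  φ.2.1.continuous.memLp_of_hasCompactSupport φ.2.2.1

/-- The embedding `C_c^∞(a,b; ℂⁿ) → L²(a,b; ℂⁿ)`. -/
def testToL2 (a b : ℝ) (n : ℕ) : TestFun a b n →ₗ[ℂ] L2Space a b n where
  toFun φ := (testFun_memLp φ).toLp _
  map_add' φ ψ := MemLp.toLp_add (testFun_memLp φ) (testFun_memLp ψ)
  map_smul' c φ := MemLp.toLp_const_smul c (testFun_memLp φ)

theorem testToL2_injective (a b : ℝ) (n : ℕ) : Function.Injective (testToL2 a b n) := by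
  intro φ ψ h
  have h1 : (φ : ℝ → EuclideanSpace ℂ (Fin n)) =ᵐ[volume.restrict (Ioo a b)] ψ :=
    (MemLp.toLp_eq_toLp_iff (testFun_memLp φ) (testFun_memLp ψ)).1 h
  have h2 : EqOn (φ : ℝ → EuclideanSpace ℂ (Fin n)) ψ (Ioo a b) :=
    Measure.eqOn_open_of_ae_eq h1 isOpen_Ioo φ.2.1.continuous.continuousOn
      ψ.2.1.continuous.continuousOn
  apply Subtype.ext
  funext x
  by_cases hx : x ∈ Ioo a b
  · exact h2 hx
  · rw [image_eq_zero_of_notMem_tsupport (fun h => hx (φ.2.2.2 h)),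
      image_eq_zero_of_notMem_tsupport (fun h => hx (ψ.2.2.2 h))]

/-! ## The minimal operator -/

/-- The action of a complex matrix on Euclidean vectors. -/
abbrev matAct {ι κ : Type*} [Fintype ι] [Fintype κ] [DecidableEq κ] (A : Matrix ι κ ℂ) :
    EuclideanSpace ℂ κ →ₗ[ℂ] EuclideanSpace ℂ ι :=
  Matrix.toEuclideanLin A

theorem iteratedDeriv_mem_testFun {a b : ℝ} {n : ℕ} (k : ℕ) (φ : TestFun a b n) :
    iteratedDeriv k (φ : ℝ → EuclideanSpace ℂ (Fin n)) ∈ TestFun a b n := by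
  have hs : tsupport (iteratedDeriv k (φ : ℝ → EuclideanSpace ℂ (Fin n))) ⊆
      tsupport (φ : ℝ → EuclideanSpace ℂ (Fin n)) := by
    apply closure_minimal _ (isClosed_tsupport _)
    intro x hx
    have : iteratedFDeriv ℝ k (φ : ℝ → EuclideanSpace ℂ (Fin n)) x ≠ 0 := by
      intro h0
      apply hx
      simp [iteratedDeriv_eq_iteratedFDeriv, h0]
    exact support_iteratedFDeriv_subset k this
  refine ⟨?_, φ.2.2.1.of_isClosed_subset (isClosed_tsupport _) hs, hs.trans φ.2.2.2⟩
  rw [iteratedDeriv_eq_iterate]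
  exact ContDiff.iterate_deriv k φ.2.1

theorem matAct_mem_testFun {a b : ℝ} {n : ℕ} (A : Matrix (Fin n) (Fin n) ℂ)
    (φ : TestFun a b n) :
    (fun x => matAct A ((φ : ℝ → EuclideanSpace ℂ (Fin n)) x)) ∈ TestFun a b n := by
  have hs : tsupport (fun x => matAct A ((φ : ℝ → EuclideanSpace ℂ (Fin n)) x)) ⊆
      tsupport (φ : ℝ → EuclideanSpace ℂ (Fin n)) := by
    apply closure_mono
    intro x hx h0
    exact hx (by simp [h0])
  refine ⟨?_, φ.2.2.1.of_isClosed_subset (isClosed_tsupport _) hs, hs.trans φ.2.2.2⟩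
  exact ((LinearMap.toContinuousLinearMap (matAct A)).restrictScalars ℝ).contDiff.comp φ.2.1

/-- The operator `φ ↦ A φ⁽ᵏ⁾` on test functions. -/
def testDiff (a b : ℝ) {n : ℕ} (k : ℕ) (A : Matrix (Fin n) (Fin n) ℂ) :
    TestFun a b n →ₗ[ℂ] TestFun a b n where
  toFun φ := ⟨fun x => matAct A (iteratedDeriv k (φ : ℝ → EuclideanSpace ℂ (Fin n)) x),
    matAct_mem_testFun A ⟨_, iteratedDeriv_mem_testFun k φ⟩⟩
  map_add' φ ψ := by
    apply Subtype.ext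
    funext x
    have h1 : ContDiffAt ℝ k (φ : ℝ → EuclideanSpace ℂ (Fin n)) x :=
      (φ.2.1.of_le (by exact_mod_cast le_top)).contDiffAt
    have h2 : ContDiffAt ℝ k (ψ : ℝ → EuclideanSpace ℂ (Fin n)) x :=
      (ψ.2.1.of_le (by exact_mod_cast le_top)).contDiffAt
    simp [iteratedDeriv_add h1 h2]
  map_smul' c φ := by
    apply Subtype.ext
    funext x
    simp [iteratedDeriv_const_smul_field]

/-- The minimal operator `𝓙₀ φ = ∑_{k ≤ N} (-1)ᵏ J_kᴴ φ⁽ᵏ⁾` in `L²(a,b; ℂⁿ)` with domain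
`C_c^∞(a,b; ℂⁿ)`. -/
def minimalOp (a b : ℝ) {n : ℕ} (N : ℕ) (J : ℕ → Matrix (Fin n) (Fin n) ℂ) :
    L2Space a b n →ₗ.[ℂ] L2Space a b n where
  domain := LinearMap.range (testToL2 a b n)
  toFun := (testToL2 a b n) ∘ₗ
    (∑ k ∈ Finset.range (N + 1), (-1 : ℂ) ^ k • testDiff a b k (J k)ᴴ) ∘ₗ
    (LinearEquiv.ofInjective (testToL2 a b n) (testToL2_injective a b n)).symm.toLinearMap

/-- The adjoint `𝓙₀*`; its domain is the space `H(𝓙₀*; a, b)`. -/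
abbrev maximalOp (a b : ℝ) {n : ℕ} (N : ℕ) (J : ℕ → Matrix (Fin n) (Fin n) ℂ) :
    L2Space a b n →ₗ.[ℂ] L2Space a b n :=
  (minimalOp a b N J).adjoint

/-! ## Sobolev spaces and the trace operator -/

/-- `g` is the `k`-th weak derivative of `f` on `(a,b)`. -/
def HasWeakDeriv (a b : ℝ) {n : ℕ} (k : ℕ) (f g : L2Space a b n) : Prop :=
  ∀ φ ∈ testFunctions a b ℝ ℝ,
    ∫ x in Ioo a b, iteratedDeriv k φ x • f x = (-1 : ℝ) ^ k • ∫ x in Ioo a b, φ x • g x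

/-- `f ∈ H^N(a,b; ℂⁿ)`: all weak derivatives up to order `N` exist in `L²`. -/
def MemSobolev (a b : ℝ) {n : ℕ} (N : ℕ) (f : L2Space a b n) : Prop :=
  ∀ k ≤ N, ∃ g, HasWeakDeriv a b k f g

open Classical in
/-- The `k`-th weak derivative of `f` (zero if there is none in `L²`). -/
def weakDeriv (a b : ℝ) {n : ℕ} (k : ℕ) (f : L2Space a b n) : L2Space a b n :=
  if h : ∃ g, HasWeakDeriv a b k f g then h.choose else 0

open Classical in
/-- The representative of `f` that is continuous on `[a,b]` (zero if there is none). -/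
def contRep (a b : ℝ) {n : ℕ} (f : L2Space a b n) : ℝ → EuclideanSpace ℂ (Fin n) :=
  if h : ∃ u : ℝ → EuclideanSpace ℂ (Fin n),
      ContinuousOn u (Icc a b) ∧ u =ᵐ[volume.restrict (Ioo a b)] f
  then h.choose else 0

/-- The vector `(x(ξ), x'(ξ), …, x⁽ᴺ⁻¹⁾(ξ)) ∈ ℂ^{Nn}` for `ξ ∈ [a,b]` and `x ∈ H^N(a,b; ℂⁿ)`.
The trace operator is `γ x = (pointTrace b x, pointTrace a x)`. -/
def pointTrace (a b : ℝ) {n : ℕ} (N : ℕ) (ξ : ℝ) (x : L2Space a b n) :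
    EuclideanSpace ℂ (Fin N × Fin n) :=
  WithLp.toLp 2 fun p => contRep a b (weakDeriv a b p.1 x) ξ p.2

/-! ## The boundary maps -/

/-- The Hermitian block matrix `Q ∈ ℂ^{Nn × Nn}`: with block indices `i, j = 1, …, N`,
`Q_{ij} = (-1)^{i-1} J_{i+j-1}` if `i + j - 1 ≤ N`, and `Q_{ij} = 0` otherwise.
(In the code the block indices start at `0`.) -/
def boundaryMatrix {n : ℕ} (N : ℕ) (J : ℕ → Matrix (Fin n) (Fin n) ℂ) :
    Matrix (Fin N × Fin n) (Fin N × Fin n) ℂ :=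
  Matrix.of fun p q =>
    if (p.1 : ℕ) + q.1 + 1 ≤ N then (-1) ^ (p.1 : ℕ) * J (p.1 + q.1 + 1) p.2 q.2 else 0

/-- A reduced spectral factorization `Q = S K Sᴴ`: the `rk Q` columns of `S` are orthonormal
eigenvectors for the nonzero eigenvalues of `Q`, which form the diagonal matrix `K`. -/
structure ReducedFactorization {ι : Type*} [Fintype ι] [DecidableEq ι] (Q : Matrix ι ι ℂ) where
  S : Matrix ι (Fin Q.rank) ℂ
  eig : Fin Q.rank → ℝ
  eig_ne_zero : ∀ i, eig i ≠ 0
  orthonormal : Sᴴ * S = 1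
  factorization : Q = S * Matrix.diagonal (fun i => (eig i : ℂ)) * Sᴴ

/-- The diagonal matrix `K` of nonzero eigenvalues. -/
def ReducedFactorization.K {ι : Type*} [Fintype ι] [DecidableEq ι] {Q : Matrix ι ι ℂ}
    (R : ReducedFactorization Q) : Matrix (Fin Q.rank) (Fin Q.rank) ℂ :=
  Matrix.diagonal fun i => (R.eig i : ℂ)

/-- The space `ℂʳ × ℂʳ`, where `ℂʳ` is the boundary space. -/
abbrev BdPair (r : ℕ) : Type := EuclideanSpace ℂ (Fin r) × EuclideanSpace ℂ (Fin r)

/-- The boundary map `Γ = (Γ₀, Γ₁)` on `H^N(a,b; ℂⁿ)`,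
`Γ₀ x = 2^{-1/2} K Sᴴ (γ_b x - γ_a x)` and `Γ₁ x = 2^{-1/2} Sᴴ (γ_b x + γ_a x)`. -/
def sobolevBoundaryMap (a b : ℝ) {n : ℕ} (N : ℕ) (J : ℕ → Matrix (Fin n) (Fin n) ℂ)
    (R : ReducedFactorization (boundaryMatrix N J)) (x : L2Space a b n) :
    BdPair (boundaryMatrix N J).rank :=
  ((1 / (Real.sqrt 2 : ℂ)) • matAct (R.K * R.Sᴴ) (pointTrace a b N b x - pointTrace a b N a x),
   (1 / (Real.sqrt 2 : ℂ)) • matAct R.Sᴴ (pointTrace a b N b x + pointTrace a b N a x))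

/-- `Γ` is a linear extension of the boundary map from `H^N(a,b; ℂⁿ)` to `H(𝓙₀*; a, b)` that is
bounded for the graph norm `(‖x‖² + ‖𝓙₀* x‖²)^{1/2}`. -/
structure IsBoundaryExtension (a b : ℝ) {n : ℕ} (N : ℕ) (J : ℕ → Matrix (Fin n) (Fin n) ℂ)
    (R : ReducedFactorization (boundaryMatrix N J))
    (Γ : (maximalOp a b N J).domain →ₗ[ℂ] BdPair (boundaryMatrix N J).rank) : Prop where
  bounded : ∃ C : ℝ, ∀ x : (maximalOp a b N J).domain,
    ‖Γ x‖ ≤ C * Real.sqrt (‖(x : L2Space a b n)‖ ^ 2 + ‖maximalOp a b N J x‖ ^ 2)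
  extends_sobolev : ∀ x : (maximalOp a b N J).domain, MemSobolev a b N (x : L2Space a b n) →
    Γ x = sobolevBoundaryMap a b N J R x

/-! ## Boundary triplets, restrictions, dissipativity -/

/-- `(𝒢, Γ₀, Γ₁)` is a boundary triplet for `T₀*`, where `T₀` is densely defined and
skew-symmetric. -/
structure IsBoundaryTriplet {X G : Type*} [NormedAddCommGroup X] [InnerProductSpace ℂ X]
    [CompleteSpace X] [NormedAddCommGroup G] [InnerProductSpace ℂ G]
    (T₀ : X →ₗ.[ℂ] X) (Γ : T₀.adjoint.domain →ₗ[ℂ] G × G) : Prop where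
  dense_domain : Dense (T₀.domain : Set X)
  skew_symmetric : ∀ x y : T₀.domain, ⟪T₀ x, (y : X)⟫_ℂ + ⟪(x : X), T₀ y⟫_ℂ = 0
  complete : CompleteSpace G
  surjective : Function.Surjective Γ
  green : ∀ x y : T₀.adjoint.domain,
    ⟪T₀.adjoint x, (y : X)⟫_ℂ + ⟪(x : X), T₀.adjoint y⟫_ℂ =
      ⟪(Γ x).2, (Γ y).1⟫_ℂ + ⟪(Γ x).1, (Γ y).2⟫_ℂ

/-- The restriction of `T` to `{x ∈ dom T | Γ x ∈ Θ}`. -/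
def boundaryRestrict {X G : Type*} [NormedAddCommGroup X] [InnerProductSpace ℂ X]
    [NormedAddCommGroup G] [InnerProductSpace ℂ G]
    (T : X →ₗ.[ℂ] X) (Γ : T.domain →ₗ[ℂ] G × G) (Θ : Submodule ℂ (G × G)) : X →ₗ.[ℂ] X :=
  T.domRestrict ((Θ.comap Γ).map T.domain.subtype)

/-- `ker [F E] = {(u, v) | F u + E v = 0}`. -/
def kerPair {r : ℕ} (F E : Matrix (Fin r) (Fin r) ℂ) : Submodule ℂ (BdPair r) :=
  LinearMap.ker ((matAct F).coprod (matAct E))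

/-- `ran [A; B] = {(A w, B w) | w ∈ ℂʳ}`. -/
def ranPair {r : ℕ} (A B : Matrix (Fin r) (Fin r) ℂ) : Submodule ℂ (BdPair r) :=
  LinearMap.range ((matAct A).prod (matAct B))

/-- A linear relation `H` is dissipative if `Re ⟨g, f⟩ ≤ 0` for all `(f, g) ∈ H`. -/
def IsDissipative {X : Type*} [NormedAddCommGroup X] [InnerProductSpace ℂ X]
    (H : Submodule ℂ (X × X)) : Prop :=
  ∀ p ∈ H, (⟪p.2, p.1⟫_ℂ).re ≤ 0

/-- A dissipative relation with no proper dissipative extension. -/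
def IsMaximallyDissipative {X : Type*} [NormedAddCommGroup X] [InnerProductSpace ℂ X]
    (H : Submodule ℂ (X × X)) : Prop :=
  IsDissipative H ∧ ∀ K : Submodule ℂ (X × X), IsDissipative K → H ≤ K → H = K

end

/-! On its domain `𝓙₀*` is ∑ J_k x⁽ᵏ⁾ read weakly. If J_N is singular, x need not lie in H^N and its
traces γ_ξ x need not exist; what survives is Qγ_ξ x. Integrating ∑ (J_k x)⁽ᵏ⁾ = z one order at a
time, in the manner of du Bois-Reymond (`exists_isPrimitiveChain`), gives w_0 = z, w_{i+1}' = w_i -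
J_i x, w_N = J_N x, where formally w_i = ∑_j J_{i+j} x⁽ʲ⁾. The vector q = ((-1)ⁱ w_{i+1}) is
absolutely continuous and formally equals Qγx. Its integral against any test function lies in ran Q,
hence so does q(t) for every t (`IsJetChain.proj_quasiJet`), and η = Q⁺q can replace the missing
jet. The error of this replacement is invisible to the boundary form (`concomitant_product_rule`),
so ⟨Q⁺q_x, q_y⟩ has derivative ⟨𝓙₀*x, y⟩ + ⟨x, 𝓙₀*y⟩. Integration gives `IsJetChain.green`, and the
factorization of Q turns the endpoint terms into ⟨Γ₁x, Γ₀y⟩ + ⟨Γ₀x, Γ₁y⟩.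

The extension of Γ then comes from Green's identity alone (`existsUnique_boundary_extension`):
pairing x with finitely many functions of prescribed boundary values reads off the coordinates of
its boundary value, which makes the map linear and graph-bounded. Uniqueness is graph-density of
H^N, and that again follows from Green's identity and surjectivity.

For the restrictions, `boundaryForm` carries everything to ℂʳ × ℂʳ. Taking -𝓙* replaces the boundary
space Θ by its companion `formOrth`, and ker [F E] and ran [Eᴴ; Fᴴ] are companions of each other. A
dissipative extension of a restriction cannot leave the graph of `𝓙₀*`
(`IsBoundaryTriplet.exists_of_dissipative`), so maximal dissipativity means that Θ is maximal
nonpositive. As semidefinite subspaces have dimension at most r, this is decided by the sign on the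
companion and a dimension count (`kerPair_maximal_iff`). -/

noncomputable section

/-! ## The boundary form -/

section BoundaryForm

variable {G : Type*} [NormedAddCommGroup G] [InnerProductSpace ℂ G]

/-- The form `⟨g₁, h₀⟩ + ⟨g₀, h₁⟩` on `G × G`. -/
def boundaryForm (g h : G × G) : ℂ := ⟪g.2, h.1⟫_ℂ + ⟪g.1, h.2⟫_ℂ

theorem boundaryForm_add_right (g h k : G × G) :
    boundaryForm g (h + k) = boundaryForm g h + boundaryForm g k := by
  simp [boundaryForm]; ring

theorem boundaryForm_smul_right (c : ℂ) (g h : G × G) :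
    boundaryForm g (c • h) = c * boundaryForm g h := by
  simp [boundaryForm]; ring

theorem boundaryForm_conj (g h : G × G) :
    (starRingEnd ℂ) (boundaryForm g h) = boundaryForm h g := by
  simp [boundaryForm, add_comm]

theorem boundaryForm_zero_right (g : G × G) : boundaryForm g 0 = 0 := by simp [boundaryForm]

theorem boundaryForm_add_left (g h k : G × G) :
    boundaryForm (g + h) k = boundaryForm g k + boundaryForm h k := by
  simp [boundaryForm]; ring

theorem boundaryForm_smul_left (c : ℂ) (g h : G × G) :
    boundaryForm (c • g) h = (starRingEnd ℂ) c * boundaryForm g h := by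
  simp [boundaryForm]; ring

theorem eq_zero_of_boundaryForm {h : G × G} (hh : ∀ g : G × G, boundaryForm g h = 0) : h = 0 := by
  refine Prod.ext ?_ ?_
  · exact (inner_self_eq_zero (𝕜 := ℂ)).1 (by
      simpa only [boundaryForm, inner_zero_left, add_zero] using hh (0, h.1))
  · exact (inner_self_eq_zero (𝕜 := ℂ)).1 (by
      simpa only [boundaryForm, inner_zero_left, zero_add] using hh (h.2, 0))

theorem boundaryForm_self_re (g : G × G) : (boundaryForm g g).re = 2 * (⟪g.2, g.1⟫_ℂ).re := by
  have : (⟪g.1, g.2⟫_ℂ).re = (⟪g.2, g.1⟫_ℂ).re := inner_re_symm (𝕜 := ℂ) g.1 g.2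
  simp [boundaryForm, this]; ring

/-- The orthogonal companion of `Θ` with respect to the boundary form. -/
def formOrth (Θ : Submodule ℂ (G × G)) : Submodule ℂ (G × G) where
  carrier := {h | ∀ g ∈ Θ, boundaryForm g h = 0}
  zero_mem' := fun g _ => boundaryForm_zero_right g
  add_mem' := fun {h k} hh hk g hg => by
    rw [boundaryForm_add_right, hh g hg, hk g hg, add_zero]
  smul_mem' := fun c h hh g hg => by
    rw [boundaryForm_smul_right, hh g hg, mul_zero]

theorem mem_formOrth {Θ : Submodule ℂ (G × G)} {h : G × G} :
    h ∈ formOrth Θ ↔ ∀ g ∈ Θ, boundaryForm g h = 0 := Iff.rfl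

/-- `Re ⟨g₁, g₀⟩ ≤ 0` on `Θ`. -/
def FormNonpos (Θ : Submodule ℂ (G × G)) : Prop := ∀ g ∈ Θ, (⟪g.2, g.1⟫_ℂ).re ≤ 0

/-- `Re ⟨g₁, g₀⟩ ≥ 0` on `Θ`. -/
def FormNonneg (Θ : Submodule ℂ (G × G)) : Prop := ∀ g ∈ Θ, 0 ≤ (⟪g.2, g.1⟫_ℂ).re

/-- On the diagonal {(u, u)} the form is positive definite, so a nonpositive subspace meets it only
in 0 and (u, v) ↦ u - v is injective there. The nonnegative case uses the antidiagonal and u + v. -/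
theorem FormNonpos.finrank_le [FiniteDimensional ℂ G] {Θ : Submodule ℂ (G × G)}
    (h : FormNonpos Θ) : Module.finrank ℂ Θ ≤ Module.finrank ℂ G := by
  let L : Θ →ₗ[ℂ] G := (LinearMap.fst ℂ G G - LinearMap.snd ℂ G G) ∘ₗ Θ.subtype
  refine LinearMap.finrank_le_finrank_of_injective (f := L) ?_
  rw [← LinearMap.ker_eq_bot, LinearMap.ker_eq_bot']
  rintro ⟨⟨u, v⟩, hg⟩ h0
  have huv : u = v := by simpa [L, sub_eq_zero] using h0
  subst huv
  have h1 := h _ hg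
  have h2 : (⟪u, u⟫_ℂ).re = ‖u‖ ^ 2 := inner_self_eq_norm_sq (𝕜 := ℂ) u
  simp only at h1
  rw [h2] at h1
  have : u = 0 := by
    have : ‖u‖ ^ 2 = 0 := le_antisymm h1 (sq_nonneg _)
    simpa using this
  simp [this]

theorem FormNonneg.finrank_le [FiniteDimensional ℂ G] {Θ : Submodule ℂ (G × G)}
    (h : FormNonneg Θ) : Module.finrank ℂ Θ ≤ Module.finrank ℂ G := by
  let L : Θ →ₗ[ℂ] G := (LinearMap.fst ℂ G G + LinearMap.snd ℂ G G) ∘ₗ Θ.subtype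
  refine LinearMap.finrank_le_finrank_of_injective (f := L) ?_
  rw [← LinearMap.ker_eq_bot, LinearMap.ker_eq_bot']
  rintro ⟨⟨u, v⟩, hg⟩ h0
  have huv : v = -u := by
    have : u + v = 0 := by simpa [L] using h0
    exact (neg_eq_of_add_eq_zero_right this).symm
  subst huv
  have h1 := h _ hg
  have h2 : (⟪u, u⟫_ℂ).re = ‖u‖ ^ 2 := inner_self_eq_norm_sq (𝕜 := ℂ) u
  simp only [inner_neg_left, Complex.neg_re, h2] at h1
  have : u = 0 := by
    have : ‖u‖ ^ 2 = 0 := le_antisymm (by linarith) (sq_nonneg _)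
    simpa using this
  simp [this]

/-- Adding a vector of the orthogonal companion on which the form has the right sign. -/
theorem form_sup_span {Θ : Submodule ℂ (G × G)} {g : G × G} (hg : g ∈ formOrth Θ)
    {p : G × G} (hp : p ∈ Θ ⊔ Submodule.span ℂ {g}) :
    ∃ q ∈ Θ, ∃ c : ℂ, (⟪p.2, p.1⟫_ℂ).re = (⟪q.2, q.1⟫_ℂ).re + ‖c‖ ^ 2 * (⟪g.2, g.1⟫_ℂ).re := by
  obtain ⟨q, hq, s, hs, rfl⟩ := Submodule.mem_sup.1 hp
  obtain ⟨c, rfl⟩ := Submodule.mem_span_singleton.1 hs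
  refine ⟨q, hq, c, ?_⟩
  have h1 : boundaryForm q g = 0 := hg q hq
  have h2 : boundaryForm g q = 0 := by rw [← boundaryForm_conj, h1, map_zero]
  have h3 : boundaryForm (q + c • g) (q + c • g) =
      boundaryForm q q + ((‖c‖ ^ 2 : ℝ) : ℂ) * boundaryForm g g := by
    rw [boundaryForm_add_left, boundaryForm_add_right, boundaryForm_add_right,
      boundaryForm_smul_left, boundaryForm_smul_right, boundaryForm_smul_left,
      boundaryForm_smul_right, h1, h2]
    have : (starRingEnd ℂ) c * c = ((‖c‖ ^ 2 : ℝ) : ℂ) := by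
      rw [Complex.conj_mul']; push_cast; rfl
    rw [← this]; ring
  have h4 := congrArg Complex.re h3
  rw [Complex.add_re, Complex.re_ofReal_mul, boundaryForm_self_re, boundaryForm_self_re,
    boundaryForm_self_re] at h4
  linarith

/-- A subspace that is its own double companion is nonpositive if its companion is nonnegative of
maximal dimension. -/
theorem FormNonneg.formOrth_nonpos [FiniteDimensional ℂ G] {Θ : Submodule ℂ (G × G)}
    (h : FormNonneg Θ) (hd : Module.finrank ℂ Θ = Module.finrank ℂ G) :
    FormNonpos (formOrth Θ) := by
  intro g hg
  by_contra hlt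
  push Not at hlt
  -- A companion vector with positive value can be adjoined without losing nonnegativity. The
  -- dimension bound forces it into Θ, where a companion vector has value zero.
  have hnn : FormNonneg (Θ ⊔ Submodule.span ℂ {g}) := by
    intro p hp
    obtain ⟨q, hq, c, hc⟩ := form_sup_span hg hp
    rw [hc]
    have := h q hq
    positivity
  have hle : Θ ≤ Θ ⊔ Submodule.span ℂ {g} := le_sup_left
  have heq := Submodule.eq_of_le_of_finrank_le hle (hnn.finrank_le.trans hd.ge)
  have hgΘ : g ∈ Θ := by
    rw [heq]; exact Submodule.mem_sup_right (Submodule.mem_span_singleton_self g)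
  have h0 := congrArg Complex.re (hg g hgΘ)
  rw [boundaryForm_self_re, Complex.zero_re] at h0
  linarith

end BoundaryForm

/-! ## Pairs of matrices -/

section Pairs

variable {r : ℕ} (F E : Matrix (Fin r) (Fin r) ℂ)

theorem inner_matAct_left {ι κ : Type*} [Fintype ι] [Fintype κ] [DecidableEq ι] [DecidableEq κ]
    (A : Matrix ι κ ℂ) (u : EuclideanSpace ℂ κ) (w : EuclideanSpace ℂ ι) :
    ⟪matAct A u, w⟫_ℂ = ⟪u, matAct Aᴴ w⟫_ℂ := by
  rw [matAct, matAct, Matrix.toEuclideanLin_conjTranspose_eq_adjoint, LinearMap.adjoint_inner_right]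

theorem matAct_mul {ι κ μ : Type*} [Fintype ι] [Fintype κ] [Fintype μ] [DecidableEq κ]
    [DecidableEq μ] (A : Matrix ι κ ℂ) (B : Matrix κ μ ℂ) (u : EuclideanSpace ℂ μ) :
    matAct (A * B) u = matAct A (matAct B u) := by
  ext i
  simp [matAct]

theorem matAct_add {ι κ : Type*} [Fintype ι] [Fintype κ] [DecidableEq κ]
    (A B : Matrix ι κ ℂ) (u : EuclideanSpace ℂ κ) :
    matAct (A + B) u = matAct A u + matAct B u := by
  simp [matAct]

theorem matAct_one {ι : Type*} [Fintype ι] [DecidableEq ι] (u : EuclideanSpace ℂ ι) :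
    matAct (1 : Matrix ι ι ℂ) u = u := by
  ext i
  simp [matAct]

variable {F E}

theorem mem_kerPair {g : BdPair r} : g ∈ kerPair F E ↔ matAct F g.1 + matAct E g.2 = 0 := by
  simp [kerPair]

theorem mem_ranPair {g : BdPair r} :
    g ∈ ranPair F E ↔ ∃ w, matAct F w = g.1 ∧ matAct E w = g.2 := by
  simp [ranPair, Prod.ext_iff]

theorem mk_mem_ranPair (w : EuclideanSpace ℂ (Fin r)) :
    (matAct F w, matAct E w) ∈ ranPair F E := mem_ranPair.2 ⟨w, rfl, rfl⟩

variable (F E)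

/-- The form pairs the components crosswise, which is why Eᴴ comes before Fᴴ: pairing (Eᴴw, Fᴴw)
with h gives ⟨w, F h₀ + E h₁⟩. -/
theorem formOrth_ranPair : formOrth (ranPair Eᴴ Fᴴ) = kerPair F E := by
  ext h
  rw [mem_formOrth, mem_kerPair]
  have key : ∀ w, boundaryForm (matAct Eᴴ w, matAct Fᴴ w) h =
      ⟪w, matAct F h.1 + matAct E h.2⟫_ℂ := by
    intro w
    simp [boundaryForm, inner_matAct_left]
  constructor
  · intro hh
    have := hh _ (mk_mem_ranPair (matAct F h.1 + matAct E h.2))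
    rw [key, inner_self_eq_zero] at this
    exact this
  · rintro h0 ⟨g1, g2⟩ hg
    obtain ⟨w, h1, h2⟩ := mem_ranPair.1 hg
    simp only at h1 h2
    rw [← h1, ← h2, key, h0, inner_zero_right]

/-- Swapping the two components turns the form into the inner product of the Hilbert sum. The
companion of ker A is thus the swap of (ker A)ᗮ = ran A*, with A = [F E]. `WithLp 2` supplies the
Hilbert structure. -/
theorem formOrth_kerPair : formOrth (kerPair F E) = ranPair Eᴴ Fᴴ := by
  apply le_antisymm
  · intro h hh
    let e := (WithLp.linearEquiv 2 ℂ (BdPair r)).toLinearMap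
    let A : WithLp 2 (BdPair r) →ₗ[ℂ] EuclideanSpace ℂ (Fin r) :=
      ((matAct F).coprod (matAct E)) ∘ₗ e
    have h1 : WithLp.toLp 2 (h.2, h.1) ∈ (LinearMap.ker A)ᗮ := by
      intro k hk
      have hk' : WithLp.ofLp k ∈ kerPair F E := hk
      have := hh _ hk'
      simp only [boundaryForm] at this
      rw [WithLp.prod_inner_apply]
      simpa [add_comm] using this
    rw [LinearMap.orthogonal_ker] at h1
    obtain ⟨w, hw⟩ := h1
    refine mem_ranPair.2 ⟨w, ?_, ?_⟩
    · apply ext_inner_right ℂ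
      intro v
      have := LinearMap.adjoint_inner_left A (WithLp.toLp 2 (0, v)) w
      rw [hw] at this
      simp only [WithLp.prod_inner_apply, inner_zero_right, zero_add] at this
      simp only [A, e, LinearMap.comp_apply] at this
      simp [inner_matAct_left] at this ⊢
      exact this.symm
    · apply ext_inner_right ℂ
      intro v
      have := LinearMap.adjoint_inner_left A (WithLp.toLp 2 (v, 0)) w
      rw [hw] at this
      simp only [WithLp.prod_inner_apply, inner_zero_right, add_zero] at this
      simp only [A, e, LinearMap.comp_apply] at this
      simp [inner_matAct_left] at this ⊢
      exact this.symm
  · rw [← formOrth_ranPair F E]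
    intro h hh g hg
    rw [← boundaryForm_conj, hg h hh, map_zero]

theorem finrank_kerPair :
    Module.finrank ℂ (kerPair F E) + (Matrix.fromCols F E).rank = 2 * r := by
  have h1 : Module.finrank ℂ (LinearMap.range ((matAct F).coprod (matAct E))) +
      Module.finrank ℂ (kerPair F E) = 2 * r := by
    have := LinearMap.finrank_range_add_finrank_ker ((matAct F).coprod (matAct E))
    rw [kerPair, this]
    simp [two_mul]
  have h3 : (Matrix.fromCols F E).rank =
      Module.finrank ℂ (LinearMap.range ((matAct F).coprod (matAct E))) := by
    rw [Matrix.rank]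
    let e := (WithLp.linearEquiv 2 ℂ (Fin r → ℂ)).symm
    have h4 : (LinearMap.range (Matrix.fromCols F E).mulVecLin).map e.toLinearMap =
        LinearMap.range ((matAct F).coprod (matAct E)) := by
      ext y
      constructor
      · rintro ⟨_, ⟨u, rfl⟩, rfl⟩
        refine ⟨(WithLp.toLp 2 (u ∘ Sum.inl), WithLp.toLp 2 (u ∘ Sum.inr)), ?_⟩
        ext i
        simp [matAct, Matrix.toLpLin_apply, Matrix.fromCols_mulVec, e]
      · rintro ⟨⟨u, v⟩, rfl⟩
        refine ⟨_, ⟨Sum.elim u v, rfl⟩, ?_⟩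
        ext i
        simp [matAct, Matrix.toLpLin_apply, e]
    rw [← h4, LinearEquiv.finrank_map_eq]
  rw [h3, ← h1, add_comm]

/-- [F E]ᴴ has the rank of [F E], and interchanging its block rows does not change the kernel;
rank-nullity on ℂʳ then compares the ranges. -/
theorem finrank_ranPair :
    Module.finrank ℂ (ranPair Eᴴ Fᴴ) = (Matrix.fromCols F E).rank := by
  rw [← Matrix.rank_conjTranspose, Matrix.conjTranspose_fromCols_eq_fromRows_conjTranspose,
    Matrix.rank]
  have h1 := LinearMap.finrank_range_add_finrank_ker (Matrix.fromRows Fᴴ Eᴴ).mulVecLin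
  have h2 : Module.finrank ℂ (ranPair Eᴴ Fᴴ) +
      Module.finrank ℂ (LinearMap.ker ((matAct Eᴴ).prod (matAct Fᴴ))) = r := by
    have := LinearMap.finrank_range_add_finrank_ker ((matAct Eᴴ).prod (matAct Fᴴ))
    rw [ranPair, this]
    simp
  let e := (WithLp.linearEquiv 2 ℂ (Fin r → ℂ)).symm
  have h4 : (LinearMap.ker (Matrix.fromRows Fᴴ Eᴴ).mulVecLin).map e.toLinearMap =
      LinearMap.ker ((matAct Eᴴ).prod (matAct Fᴴ)) := by
    ext y
    have hy : y = e (WithLp.ofLp y) := rfl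
    rw [hy, Submodule.mem_map_equiv]
    simp only [LinearEquiv.symm_apply_apply, LinearMap.mem_ker, Matrix.mulVecLin_apply,
      Matrix.fromRows_mulVec, LinearMap.prod_apply, Function.prod, Prod.mk_eq_zero]
    have hs : ∀ p q : Fin r → ℂ, Sum.elim p q = 0 ↔ p = 0 ∧ q = 0 := by
      intro p q
      constructor
      · intro h
        exact ⟨funext fun i => congrFun h (Sum.inl i), funext fun i => congrFun h (Sum.inr i)⟩
      · rintro ⟨rfl, rfl⟩
        funext i
        cases i <;> rfl
    rw [hs, and_comm]
    simp [matAct, Matrix.toLpLin_apply, e]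
  have h5 : Module.finrank ℂ (LinearMap.ker ((matAct Eᴴ).prod (matAct Fᴴ))) =
      Module.finrank ℂ (LinearMap.ker (Matrix.fromRows Fᴴ Eᴴ).mulVecLin) := by
    rw [← h4]
    exact LinearEquiv.finrank_map_eq e _
  simp only [Module.finrank_fintype_fun_eq_card, Fintype.card_fin] at h1
  omega

theorem ranPair_form (w : EuclideanSpace ℂ (Fin r)) :
    boundaryForm (matAct Eᴴ w, matAct Fᴴ w) (matAct Eᴴ w, matAct Fᴴ w) =
      ⟪w, matAct (F * Eᴴ + E * Fᴴ) w⟫_ℂ := by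
  simp only [boundaryForm, inner_matAct_left, matAct_add, matAct_mul, inner_add_right,
    Matrix.conjTranspose_conjTranspose]

theorem isHermitian_pair : (F * Eᴴ + E * Fᴴ).IsHermitian := by
  simp [Matrix.IsHermitian, Matrix.conjTranspose_add, Matrix.conjTranspose_mul, add_comm]

theorem ranPair_le_kerPair_iff : ranPair Eᴴ Fᴴ ≤ kerPair F E ↔ F * Eᴴ + E * Fᴴ = 0 := by
  have key : ∀ w, matAct F (matAct Eᴴ w) + matAct E (matAct Fᴴ w) =
      matAct (F * Eᴴ + E * Fᴴ) w := fun w => by rw [matAct_add, matAct_mul, matAct_mul]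
  constructor
  · intro h
    have h0 : matAct (F * Eᴴ + E * Fᴴ) = 0 := by
      ext1 w
      rw [← key, LinearMap.zero_apply]
      have h1 : (matAct Eᴴ w, matAct Fᴴ w) ∈ kerPair F E :=
        h (mk_mem_ranPair (F := Eᴴ) (E := Fᴴ) w)
      rw [mem_kerPair] at h1
      exact h1
    exact (LinearEquiv.map_eq_zero_iff _).1 h0
  · rintro h ⟨g1, g2⟩ hg
    obtain ⟨w, rfl, rfl⟩ := mem_ranPair.1 hg
    rw [mem_kerPair]
    change matAct F (matAct Eᴴ w) + matAct E (matAct Fᴴ w) = 0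
    rw [key, h, matAct, map_zero, LinearMap.zero_apply]

theorem ranPair_eq_kerPair_iff : ranPair Eᴴ Fᴴ = kerPair F E ↔
    F * Eᴴ + E * Fᴴ = 0 ∧ (Matrix.fromCols F E).rank = r := by
  have h1 := finrank_kerPair F E
  have h2 := finrank_ranPair F E
  rw [← ranPair_le_kerPair_iff]
  constructor
  · intro h
    refine ⟨h.le, ?_⟩
    rw [h] at h2
    omega
  · rintro ⟨h, hr⟩
    exact Submodule.eq_of_le_of_finrank_eq h (by omega)

/-- By `ranPair_form` the sign on ran [Eᴴ; Fᴴ] is the sign of w ↦ ⟨w, (FEᴴ + EFᴴ)w⟩; the Hermitian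
part of positive semidefiniteness is automatic. -/
theorem ranPair_nonneg_iff : FormNonneg (ranPair Eᴴ Fᴴ) ↔ (F * Eᴴ + E * Fᴴ).PosSemidef := by
  have hre : ∀ w, (⟪matAct Fᴴ w, matAct Eᴴ w⟫_ℂ).re =
      (⟪w, matAct (F * Eᴴ + E * Fᴴ) w⟫_ℂ).re / 2 := by
    intro w
    rw [← ranPair_form, boundaryForm_self_re]
    ring
  rw [← Matrix.isPositive_toEuclideanLin_iff, LinearMap.isPositive_iff]
  constructor
  · intro h
    refine ⟨?_, fun w => ?_⟩
    · exact Matrix.isSymmetric_toEuclideanLin_iff.2 (isHermitian_pair F E)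
    · have h1 := h _ (mk_mem_ranPair w)
      simp only [hre] at h1
      have h2 : (⟪matAct (F * Eᴴ + E * Fᴴ) w, w⟫_ℂ).re =
          (⟪w, matAct (F * Eᴴ + E * Fᴴ) w⟫_ℂ).re := inner_re_symm (𝕜 := ℂ) _ _
      have h3 : (⟪matAct (F * Eᴴ + E * Fᴴ) w, w⟫_ℂ).im = 0 := by
        rw [← Complex.conj_eq_iff_im, inner_conj_symm, inner_matAct_left,
          (isHermitian_pair F E).eq]
      rw [Complex.nonneg_iff]
      refine ⟨?_, h3.symm⟩
      have : (0 : ℝ) ≤ (⟪matAct (F * Eᴴ + E * Fᴴ) w, w⟫_ℂ).re := by rw [h2]; linarith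
      exact this
  · rintro ⟨-, h⟩ ⟨g1, g2⟩ hg
    obtain ⟨w, rfl, rfl⟩ := mem_ranPair.1 hg
    simp only [hre]
    have h1 := (Complex.nonneg_iff.1 (h w)).1
    have h2 : (⟪matAct (F * Eᴴ + E * Fᴴ) w, w⟫_ℂ).re =
        (⟪w, matAct (F * Eᴴ + E * Fᴴ) w⟫_ℂ).re := inner_re_symm (𝕜 := ℂ) _ _
    have h3 : (0 : ℝ) ≤ (⟪matAct (F * Eᴴ + E * Fᴴ) w, w⟫_ℂ).re := h1
    linarith

end Pairs

/-! ## Restrictions of the adjoint in a boundary triplet -/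

section Triplet

variable {X G : Type*} [NormedAddCommGroup X] [InnerProductSpace ℂ X]
  [NormedAddCommGroup G] [InnerProductSpace ℂ G]

theorem mem_domain_boundaryRestrict {T : X →ₗ.[ℂ] X} {Γ : T.domain →ₗ[ℂ] G × G}
    {Θ : Submodule ℂ (G × G)} {x : X} :
    x ∈ (boundaryRestrict T Γ Θ).domain ↔ ∃ hx : x ∈ T.domain, Γ ⟨x, hx⟩ ∈ Θ := by
  rw [boundaryRestrict, LinearPMap.domRestrict_domain, Submodule.mem_inf]
  constructor
  · rintro ⟨h, hx⟩
    obtain ⟨y, hy, rfl⟩ := h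
    exact ⟨hx, hy⟩
  · rintro ⟨hx, h⟩
    exact ⟨⟨⟨x, hx⟩, h, rfl⟩, hx⟩

theorem mem_graph_boundaryRestrict {T : X →ₗ.[ℂ] X} {Γ : T.domain →ₗ[ℂ] G × G}
    {Θ : Submodule ℂ (G × G)} {p : X × X} :
    p ∈ (boundaryRestrict T Γ Θ).graph ↔ ∃ x : T.domain, Γ x ∈ Θ ∧ (x : X) = p.1 ∧ T x = p.2 := by
  rw [LinearPMap.mem_graph_iff]
  constructor
  · rintro ⟨⟨y, hy⟩, h1, h2⟩
    obtain ⟨hx, hΘ⟩ := mem_domain_boundaryRestrict.1 hy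
    refine ⟨⟨y, hx⟩, hΘ, h1, ?_⟩
    rw [← h2]
    exact (LinearPMap.domRestrict_apply (x := ⟨y, hy⟩) (y := ⟨y, hx⟩) rfl).symm
  · rintro ⟨x, hΘ, h1, h2⟩
    have hy := mem_domain_boundaryRestrict.2 ⟨x.2, hΘ⟩
    refine ⟨⟨x, hy⟩, h1, ?_⟩
    rw [← h2]
    have h3 : ((⟨x, hy⟩ : (boundaryRestrict T Γ Θ).domain) : X) = x := rfl
    exact LinearPMap.domRestrict_apply h3

variable [CompleteSpace X] {T₀ : X →ₗ.[ℂ] X}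

theorem mem_graph_adjoint_iff (hd : Dense (T₀.domain : Set X)) {y w : X} :
    (∃ hy : y ∈ T₀.adjoint.domain, T₀.adjoint ⟨y, hy⟩ = w) ↔
      ∀ x : T₀.domain, ⟪w, (x : X)⟫_ℂ = ⟪y, T₀ x⟫_ℂ := by
  constructor
  · rintro ⟨hy, rfl⟩ x
    exact LinearPMap.adjoint_isFormalAdjoint hd ⟨y, hy⟩ x
  · intro h
    refine ⟨LinearPMap.mem_adjoint_domain_of_exists y ⟨w, h⟩, ?_⟩
    exact LinearPMap.adjoint_apply_eq hd _ h

theorem mem_adjoint_of_skew (hd : Dense (T₀.domain : Set X))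
    (hs : ∀ x y : T₀.domain, ⟪T₀ x, (y : X)⟫_ℂ + ⟪(x : X), T₀ y⟫_ℂ = 0) (φ : T₀.domain) :
    ∃ hφ : (φ : X) ∈ T₀.adjoint.domain, T₀.adjoint ⟨φ, hφ⟩ = -T₀ φ := by
  rw [mem_graph_adjoint_iff hd]
  intro x
  rw [inner_neg_left, ← eq_neg_of_add_eq_zero_right (hs φ x)]

variable {Γ : T₀.adjoint.domain →ₗ[ℂ] G × G}


theorem IsBoundaryTriplet.green' (hT : IsBoundaryTriplet T₀ Γ)
    (x y : T₀.adjoint.domain) :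
    ⟪T₀.adjoint x, (y : X)⟫_ℂ + ⟪(x : X), T₀.adjoint y⟫_ℂ = boundaryForm (Γ x) (Γ y) :=
  hT.green x y

/-- On minimal elements `T₀*` equals -T₀, so Green's identity pairs their boundary value to zero
with all of ran Γ, and the form is nondegenerate. Hence every restriction to a boundary space
extends -T₀. -/
theorem IsBoundaryTriplet.mem_minimal (hT : IsBoundaryTriplet T₀ Γ)
    (φ : T₀.domain) :
    ∃ hφ : (φ : X) ∈ T₀.adjoint.domain, T₀.adjoint ⟨φ, hφ⟩ = -T₀ φ ∧ Γ ⟨φ, hφ⟩ = 0 := by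
  obtain ⟨hφ, h1⟩ := mem_adjoint_of_skew hT.dense_domain hT.skew_symmetric φ
  refine ⟨hφ, h1, ?_⟩
  apply eq_zero_of_boundaryForm
  intro g
  obtain ⟨x, rfl⟩ := hT.surjective g
  rw [← hT.green', h1, inner_neg_right, LinearPMap.adjoint_isFormalAdjoint hT.dense_domain x φ,
    add_neg_cancel]

theorem IsBoundaryTriplet.dense_restrict (hT : IsBoundaryTriplet T₀ Γ)
    (Θ : Submodule ℂ (G × G)) :
    Dense ((boundaryRestrict T₀.adjoint Γ Θ).domain : Set X) := by
  refine hT.dense_domain.mono fun φ hφ => ?_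
  obtain ⟨h1, -, h2⟩ := hT.mem_minimal ⟨φ, hφ⟩
  exact mem_domain_boundaryRestrict.2 ⟨h1, by rw [h2]; exact Θ.zero_mem⟩

/-- The graph of the restriction to the companion of `Θ`. -/
theorem IsBoundaryTriplet.mem_graph_formOrth (hT : IsBoundaryTriplet T₀ Γ)
    {Θ : Submodule ℂ (G × G)} {p : X × X} :
    p ∈ (boundaryRestrict T₀.adjoint Γ (formOrth Θ)).graph ↔
      ∀ q ∈ (boundaryRestrict T₀.adjoint Γ Θ).graph, ⟪q.2, p.1⟫_ℂ + ⟪q.1, p.2⟫_ℂ = 0 := by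
  constructor
  · intro hp q hq
    obtain ⟨x, hx, h1, h2⟩ := mem_graph_boundaryRestrict.1 hp
    obtain ⟨y, hy, k1, k2⟩ := mem_graph_boundaryRestrict.1 hq
    rw [← h1, ← h2, ← k1, ← k2, hT.green', hx _ hy]
  · intro h
    -- Minimal elements lie in every restriction, and orthogonality to them alone already puts p in
    -- the graph of `T₀*`.
    have h1 : ∃ hy : p.1 ∈ T₀.adjoint.domain, T₀.adjoint ⟨p.1, hy⟩ = p.2 := by
      rw [mem_graph_adjoint_iff hT.dense_domain]
      intro φ
      obtain ⟨k1, k2, k3⟩ := hT.mem_minimal φ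
      have := h ((φ : X), -T₀ φ) (mem_graph_boundaryRestrict.2
        ⟨⟨φ, k1⟩, by rw [k3]; exact Θ.zero_mem, rfl, k2⟩)
      simp only [inner_neg_left] at this
      rw [← inner_conj_symm, ← inner_conj_symm p.1 (T₀ φ)]
      exact congrArg _ (neg_add_eq_zero.1 this).symm
    obtain ⟨hy, h2⟩ := h1
    refine mem_graph_boundaryRestrict.2 ⟨⟨p.1, hy⟩, fun g hg => ?_, rfl, h2⟩
    obtain ⟨x, rfl⟩ := hT.surjective g
    rw [← hT.green', h2]
    exact h ((x : X), T₀.adjoint x) (mem_graph_boundaryRestrict.2 ⟨x, hg, rfl, rfl⟩)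

theorem IsBoundaryTriplet.neg_adjoint_restrict (hT : IsBoundaryTriplet T₀ Γ)
    (Θ : Submodule ℂ (G × G)) :
    -(boundaryRestrict T₀.adjoint Γ Θ).adjoint = boundaryRestrict T₀.adjoint Γ (formOrth Θ) := by
  apply LinearPMap.eq_of_eq_graph
  ext p
  rw [hT.mem_graph_formOrth]
  have h1 : p ∈ (-(boundaryRestrict T₀.adjoint Γ Θ).adjoint).graph ↔
      ∃ hy : p.1 ∈ (boundaryRestrict T₀.adjoint Γ Θ).adjoint.domain,
        (boundaryRestrict T₀.adjoint Γ Θ).adjoint ⟨p.1, hy⟩ = -p.2 := by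
    rw [LinearPMap.mem_graph_iff]
    constructor
    · rintro ⟨⟨y, hy⟩, rfl, h2⟩
      refine ⟨hy, ?_⟩
      rw [← h2, LinearPMap.neg_apply, neg_neg]
    · rintro ⟨hy, h2⟩
      refine ⟨⟨p.1, hy⟩, rfl, ?_⟩
      rw [LinearPMap.neg_apply, h2, neg_neg]
  rw [h1, mem_graph_adjoint_iff (hT.dense_restrict Θ)]
  have h3 : ∀ q : X × X, ⟪-p.2, q.1⟫_ℂ = ⟪p.1, q.2⟫_ℂ ↔
      ⟪q.2, p.1⟫_ℂ + ⟪q.1, p.2⟫_ℂ = 0 := by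
    intro q
    rw [inner_neg_left, neg_eq_iff_add_eq_zero, ← inner_conj_symm p.2, ← inner_conj_symm p.1,
      ← map_add, map_eq_zero, add_comm]
  constructor
  · intro h q hq
    obtain ⟨x, rfl⟩ := (LinearPMap.mem_graph_iff' _).1 hq
    exact (h3 _).1 (h x)
  · intro h x
    exact (h3 (_, _)).2 (h _ (LinearPMap.mem_graph _ x))

theorem IsBoundaryTriplet.isClosed_restrict (hT : IsBoundaryTriplet T₀ Γ)
    (Θ : Submodule ℂ (G × G)) :
    (boundaryRestrict T₀.adjoint Γ (formOrth Θ)).IsClosed := by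
  have : ((boundaryRestrict T₀.adjoint Γ (formOrth Θ)).graph : Set (X × X)) =
      ⋂ q ∈ (boundaryRestrict T₀.adjoint Γ Θ).graph,
        {p : X × X | ⟪q.2, p.1⟫_ℂ + ⟪q.1, p.2⟫_ℂ = 0} := by
    ext p
    simp only [SetLike.mem_coe, mem_iInter]
    exact hT.mem_graph_formOrth
  rw [LinearPMap.IsClosed, this]
  refine isClosed_biInter fun q _ => isClosed_eq ?_ continuous_const
  fun_prop

/-- Every g in Θ₁ is Γ x for some x, and the first component of the graph pair determines x. -/
theorem IsBoundaryTriplet.restrict_injective (hT : IsBoundaryTriplet T₀ Γ)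
    {Θ₁ Θ₂ : Submodule ℂ (G × G)}
    (h : (boundaryRestrict T₀.adjoint Γ Θ₁).graph ≤ (boundaryRestrict T₀.adjoint Γ Θ₂).graph) :
    Θ₁ ≤ Θ₂ := by
  intro g hg
  obtain ⟨x, rfl⟩ := hT.surjective g
  have := h (mem_graph_boundaryRestrict.2 ⟨x, hg, rfl, rfl⟩ : ((x : X), T₀.adjoint x) ∈ _)
  obtain ⟨y, hy, h1, -⟩ := mem_graph_boundaryRestrict.1 this
  rwa [Subtype.ext h1] at hy

theorem IsBoundaryTriplet.restrict_eq_iff (hT : IsBoundaryTriplet T₀ Γ)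
    {Θ₁ Θ₂ : Submodule ℂ (G × G)} :
    boundaryRestrict T₀.adjoint Γ Θ₁ = boundaryRestrict T₀.adjoint Γ Θ₂ ↔ Θ₁ = Θ₂ := by
  constructor
  · intro h
    exact le_antisymm (hT.restrict_injective (by rw [h])) (hT.restrict_injective (by rw [h]))
  · rintro rfl
    rfl

theorem IsBoundaryTriplet.dissipative_iff (hT : IsBoundaryTriplet T₀ Γ)
    {Θ : Submodule ℂ (G × G)} :
    IsDissipative (boundaryRestrict T₀.adjoint Γ Θ).graph ↔ FormNonpos Θ := by
  have key : ∀ x : T₀.adjoint.domain, (⟪T₀.adjoint x, (x : X)⟫_ℂ).re =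
      (⟪(Γ x).2, (Γ x).1⟫_ℂ).re := by
    intro x
    have h := congrArg Complex.re (hT.green' x x)
    rw [boundaryForm_self_re, Complex.add_re] at h
    have h1 : (⟪(x : X), T₀.adjoint x⟫_ℂ).re = (⟪T₀.adjoint x, (x : X)⟫_ℂ).re :=
      inner_re_symm (𝕜 := ℂ) _ _
    linarith
  constructor
  · intro h g hg
    obtain ⟨x, rfl⟩ := hT.surjective g
    rw [← key]
    exact h ((x : X), T₀.adjoint x) (mem_graph_boundaryRestrict.2 ⟨x, hg, rfl, rfl⟩)
  · intro h p hp
    obtain ⟨x, hx, h1, h2⟩ := mem_graph_boundaryRestrict.1 hp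
    rw [← h1, ← h2, key]
    exact h _ hx

/-- A dissipative relation that extends the restriction to `Θ` is the restriction to some `Θ'`. -/
theorem IsBoundaryTriplet.exists_of_dissipative (hT : IsBoundaryTriplet T₀ Γ)
    {Θ : Submodule ℂ (G × G)}
    {K : Submodule ℂ (X × X)} (hK : IsDissipative K)
    (hle : (boundaryRestrict T₀.adjoint Γ Θ).graph ≤ K) :
    ∃ Θ' : Submodule ℂ (G × G), Θ ≤ Θ' ∧ K = (boundaryRestrict T₀.adjoint Γ Θ').graph := by
  have hmem : ∀ p ∈ K, ∃ hy : p.1 ∈ T₀.adjoint.domain, T₀.adjoint ⟨p.1, hy⟩ = p.2 := by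
    intro p hp
    rw [mem_graph_adjoint_iff hT.dense_domain]
    intro φ
    obtain ⟨k1, k2, k3⟩ := hT.mem_minimal φ
    have hφ : ((φ : X), -T₀ φ) ∈ K := hle (mem_graph_boundaryRestrict.2
        ⟨⟨φ, k1⟩, by rw [k3]; exact Θ.zero_mem, rfl, k2⟩)
    have hφφ : (⟪T₀ φ, (φ : X)⟫_ℂ).re = 0 := by
      have h := congrArg Complex.re (hT.skew_symmetric φ φ)
      have h1 : (⟪(φ : X), T₀ φ⟫_ℂ).re = (⟪T₀ φ, (φ : X)⟫_ℂ).re := inner_re_symm (𝕜 := ℂ) _ _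
      rw [Complex.add_re, h1, Complex.zero_re] at h
      linarith
    set d : ℂ := ⟪p.2, (φ : X)⟫_ℂ - ⟪p.1, T₀ φ⟫_ℂ with hd
    -- Dissipativity is applied to p + c(φ, -T₀φ). The term quadratic in c vanishes by
    -- skew-symmetry, leaving a real-affine function of c bounded above, so its slope d must be
    -- zero.
    have hbound : ∀ c : ℂ, (⟪p.2, p.1⟫_ℂ).re + (c * d).re ≤ 0 := by
      intro c
      have h := hK _ (K.add_mem hp (K.smul_mem c hφ))
      have h2 : (⟪c • T₀ φ, p.1⟫_ℂ).re = (⟪p.1, c • T₀ φ⟫_ℂ).re := inner_re_symm (𝕜 := ℂ) _ _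
      have h3 : (⟪c • T₀ φ, c • (φ : X)⟫_ℂ).re = 0 := by
        rw [inner_smul_left, inner_smul_right, ← mul_assoc, Complex.conj_mul', ← Complex.ofReal_pow,
          Complex.re_ofReal_mul, hφφ, mul_zero]
      simp only [Prod.fst_add, Prod.snd_add, Prod.smul_mk, smul_neg, inner_add_left,
        inner_add_right, inner_neg_left, Complex.add_re, Complex.neg_re, h2, h3] at h
      rw [hd, mul_sub, Complex.sub_re, ← inner_smul_right, ← inner_smul_right]
      linarith
    have hd0 : d = 0 := by
      by_contra hne
      have hpos : 0 < ‖d‖ ^ 2 := by positivity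
      -- This c makes c·d equal to 1 - Re⟨p₂, p₁⟩, so the bound would read 1 ≤ 0.
      have h := hbound ((((-(⟪p.2, p.1⟫_ℂ).re + 1) / ‖d‖ ^ 2 : ℝ) : ℂ) * (starRingEnd ℂ) d)
      rw [mul_assoc, Complex.conj_mul', ← Complex.ofReal_pow, ← Complex.ofReal_mul,
        Complex.ofReal_re, div_mul_cancel₀ _ hpos.ne'] at h
      linarith
    exact sub_eq_zero.1 hd0
  let Θ' : Submodule ℂ (G × G) :=
    (K.comap (T₀.adjoint.domain.subtype.prod T₀.adjoint.toFun)).map Γ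
  have hK' : K = (boundaryRestrict T₀.adjoint Γ Θ').graph := by
    ext p
    rw [mem_graph_boundaryRestrict]
    constructor
    · intro hp
      obtain ⟨hy, h2⟩ := hmem p hp
      refine ⟨⟨p.1, hy⟩, ⟨⟨p.1, hy⟩, ?_, rfl⟩, rfl, h2⟩
      change (p.1, T₀.adjoint ⟨p.1, hy⟩) ∈ K
      rwa [h2]
    · rintro ⟨x, ⟨y, hy, hxy⟩, h1, h2⟩
      have hyK : ((y : X), T₀.adjoint y) ∈ K := hy
      -- Membership in K depends on the boundary value only: elements with zero boundary value lie
      -- in the restriction to Θ, hence in K.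
      have h0 : Γ (x - y) = 0 := by rw [map_sub, hxy, sub_self]
      have hz := hle (mem_graph_boundaryRestrict.2 ⟨x - y, by rw [h0]; exact Θ.zero_mem, rfl, rfl⟩ :
        (((x - y : T₀.adjoint.domain) : X), T₀.adjoint (x - y)) ∈ _)
      have := K.add_mem hz hyK
      rw [LinearPMap.map_sub] at this
      have e : p = ((((x - y : T₀.adjoint.domain) : X), T₀.adjoint x - T₀.adjoint y) : X × X) +
          ((y : X), T₀.adjoint y) := by
        refine Prod.ext ?_ ?_
        · simp [h1]
        · simp [h2]
      rwa [e]
  exact ⟨Θ', hT.restrict_injective (hK' ▸ hle), hK'⟩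

theorem IsBoundaryTriplet.maximallyDissipative_iff (hT : IsBoundaryTriplet T₀ Γ)
    {Θ : Submodule ℂ (G × G)} :
    IsMaximallyDissipative (boundaryRestrict T₀.adjoint Γ Θ).graph ↔
      FormNonpos Θ ∧ ∀ Θ', FormNonpos Θ' → Θ ≤ Θ' → Θ = Θ' := by
  have hmono : ∀ {Θ₁ Θ₂ : Submodule ℂ (G × G)}, Θ₁ ≤ Θ₂ →
      (boundaryRestrict T₀.adjoint Γ Θ₁).graph ≤ (boundaryRestrict T₀.adjoint Γ Θ₂).graph := by
    intro Θ₁ Θ₂ h p hp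
    obtain ⟨x, hx, h1⟩ := mem_graph_boundaryRestrict.1 hp
    exact mem_graph_boundaryRestrict.2 ⟨x, h hx, h1⟩
  rw [IsMaximallyDissipative, hT.dissipative_iff]
  refine and_congr_right fun hΘ => ⟨fun h Θ' h' hle => ?_, fun h K hK hle => ?_⟩
  · refine le_antisymm hle (hT.restrict_injective ?_)
    rw [h _ (hT.dissipative_iff.2 h') (hmono hle)]
  · obtain ⟨Θ', hle', rfl⟩ := hT.exists_of_dissipative hK hle
    rw [h Θ' (hT.dissipative_iff.1 hK) hle']

end Triplet

/-! ### Maximal nonpositive boundary spaces, and the theorem for an abstract triplet. -/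

theorem finrank_le_of_formNonpos {r : ℕ} {Θ : Submodule ℂ (BdPair r)} (h : FormNonpos Θ) :
    Module.finrank ℂ Θ ≤ r := h.finrank_le.trans_eq (by simp)

theorem finrank_le_of_formNonneg {r : ℕ} {Θ : Submodule ℂ (BdPair r)} (h : FormNonneg Θ) :
    Module.finrank ℂ Θ ≤ r := h.finrank_le.trans_eq (by simp)

/-- Maximal nonpositive subspaces of the form `ker [F E]`. -/
theorem kerPair_maximal_iff {r : ℕ} (F E : Matrix (Fin r) (Fin r) ℂ) :
    (FormNonpos (kerPair F E) ∧ ∀ Θ', FormNonpos Θ' → kerPair F E ≤ Θ' → kerPair F E = Θ') ↔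
      (F * Eᴴ + E * Fᴴ).PosSemidef ∧ (Matrix.fromCols F E).rank = r := by
  have d1 := finrank_kerPair F E
  have d2 := finrank_ranPair F E
  have d3 : Module.finrank ℂ (EuclideanSpace ℂ (Fin r)) = r := by simp
  rw [← ranPair_nonneg_iff]
  constructor
  · rintro ⟨h1, h2⟩
    -- A companion vector with negative value could be adjoined to ker [F E]; maximality puts it
    -- inside, where its value is zero.
    have hnn : FormNonneg (ranPair Eᴴ Fᴴ) := by
      intro g hg
      by_contra hlt
      push Not at hlt
      rw [← formOrth_kerPair] at hg
      have hnp : FormNonpos (kerPair F E ⊔ Submodule.span ℂ {g}) := by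
        intro p hp
        obtain ⟨q, hq, c, hc⟩ := form_sup_span hg hp
        rw [hc]
        have := h1 q hq
        nlinarith [sq_nonneg ‖c‖]
      have heq := h2 _ hnp le_sup_left
      have hgΘ : g ∈ kerPair F E := by
        rw [heq]; exact Submodule.mem_sup_right (Submodule.mem_span_singleton_self g)
      have h0 := congrArg Complex.re (hg g hgΘ)
      rw [boundaryForm_self_re, Complex.zero_re] at h0
      linarith
    -- The two dimension bounds read 2r - rk [F E] ≤ r and rk [F E] ≤ r.
    refine ⟨hnn, ?_⟩
    have := finrank_le_of_formNonpos h1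
    have := finrank_le_of_formNonneg hnn
    omega
  · rintro ⟨hnn, hr⟩
    have hnp : FormNonpos (kerPair F E) := by
      rw [← formOrth_ranPair]
      exact hnn.formOrth_nonpos ((d2.trans hr).trans d3.symm)
    refine ⟨hnp, fun Θ' h' hle => Submodule.eq_of_le_of_finrank_le hle ?_⟩
    have := finrank_le_of_formNonpos h'
    omega

/-- Closedness, adjoint, maximal dissipativity and skew-adjointness of the restrictions. -/
theorem IsBoundaryTriplet.restrict_kerPair {X : Type*} [NormedAddCommGroup X]
    [InnerProductSpace ℂ X] [CompleteSpace X] {T₀ : X →ₗ.[ℂ] X} {r : ℕ}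
    {Γ : T₀.adjoint.domain →ₗ[ℂ] BdPair r} (hT : IsBoundaryTriplet T₀ Γ)
    (F E : Matrix (Fin r) (Fin r) ℂ) :
    (boundaryRestrict T₀.adjoint Γ (kerPair F E)).IsClosed ∧
      -(boundaryRestrict T₀.adjoint Γ (kerPair F E)).adjoint =
        boundaryRestrict T₀.adjoint Γ (ranPair Eᴴ Fᴴ) ∧
      (IsMaximallyDissipative (boundaryRestrict T₀.adjoint Γ (kerPair F E)).graph ↔
        (F * Eᴴ + E * Fᴴ).PosSemidef ∧ (Matrix.fromCols F E).rank = r) ∧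
      (-(boundaryRestrict T₀.adjoint Γ (kerPair F E)).adjoint =
          boundaryRestrict T₀.adjoint Γ (kerPair F E) ↔
        F * Eᴴ + E * Fᴴ = 0 ∧ (Matrix.fromCols F E).rank = r) := by
  have hadj : -(boundaryRestrict T₀.adjoint Γ (kerPair F E)).adjoint =
      boundaryRestrict T₀.adjoint Γ (ranPair Eᴴ Fᴴ) := by
    rw [hT.neg_adjoint_restrict, formOrth_kerPair]
  refine ⟨?_, hadj, ?_, ?_⟩
  · rw [← formOrth_ranPair]
    exact hT.isClosed_restrict _
  · rw [hT.maximallyDissipative_iff, kerPair_maximal_iff]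
  · rw [hadj, hT.restrict_eq_iff, ranPair_eq_kerPair_iff]

/-! ## Boundary triplets from a Green identity on a core -/

section Construction

variable {X : Type*} [NormedAddCommGroup X] [InnerProductSpace ℂ X]

/-- The functional `x ↦ ⟨T v, x⟩ + ⟨v, T x⟩`. -/
def greenFunctional (T : X →ₗ.[ℂ] X) (v : T.domain) : T.domain →ₗ[ℂ] ℂ :=
  (innerₛₗ ℂ (T v)) ∘ₗ T.domain.subtype + (innerₛₗ ℂ (v : X)) ∘ₗ T.toFun

theorem greenFunctional_apply (T : X →ₗ.[ℂ] X) (v x : T.domain) :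
    greenFunctional T v x = ⟪T v, (x : X)⟫_ℂ + ⟪(v : X), T x⟫_ℂ := rfl

theorem norm_greenFunctional_le (T : X →ₗ.[ℂ] X) (v x : T.domain) :
    ‖greenFunctional T v x‖ ≤ (‖T v‖ + ‖(v : X)‖) * Real.sqrt (‖(x : X)‖ ^ 2 + ‖T x‖ ^ 2) := by
  have h1 : ‖(x : X)‖ ≤ Real.sqrt (‖(x : X)‖ ^ 2 + ‖T x‖ ^ 2) :=
    Real.le_sqrt_of_sq_le (by nlinarith [sq_nonneg ‖T x‖])
  have h2 : ‖T x‖ ≤ Real.sqrt (‖(x : X)‖ ^ 2 + ‖T x‖ ^ 2) :=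
    Real.le_sqrt_of_sq_le (by nlinarith [sq_nonneg ‖(x : X)‖])
  rw [greenFunctional_apply, add_mul]
  refine (norm_add_le _ _).trans (add_le_add ?_ ?_)
  · exact (norm_inner_le_norm _ _).trans (mul_le_mul_of_nonneg_left h1 (norm_nonneg _))
  · exact (norm_inner_le_norm _ _).trans (mul_le_mul_of_nonneg_left h2 (norm_nonneg _))

/-- The map with coordinates `x ↦ ⟨T vₗ, x⟩ + ⟨vₗ, T x⟩`. -/
def greenMap (T : X →ₗ.[ℂ] X) {r : ℕ} (v : Fin r → T.domain) :
    T.domain →ₗ[ℂ] EuclideanSpace ℂ (Fin r) :=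
  (WithLp.linearEquiv 2 ℂ (Fin r → ℂ)).symm.toLinearMap ∘ₗ
    LinearMap.pi fun l => greenFunctional T (v l)

theorem norm_greenMap_le (T : X →ₗ.[ℂ] X) {r : ℕ} (v : Fin r → T.domain) :
    ∃ C : ℝ, 0 ≤ C ∧ ∀ x : T.domain,
      ‖greenMap T v x‖ ≤ C * Real.sqrt (‖(x : X)‖ ^ 2 + ‖T x‖ ^ 2) := by
  refine ⟨∑ l, (‖T (v l)‖ + ‖(v l : X)‖), by positivity, fun x => ?_⟩
  have h : ‖greenMap T v x‖ ≤ ∑ l, ‖greenMap T v x l‖ := by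
    rw [EuclideanSpace.norm_eq]
    refine Real.sqrt_le_iff.2 ⟨by positivity, ?_⟩
    exact Finset.sum_sq_le_sq_sum_of_nonneg fun i _ => norm_nonneg _
  refine h.trans ?_
  rw [Finset.sum_mul]
  exact Finset.sum_le_sum fun l _ => norm_greenFunctional_le T (v l) x

variable [CompleteSpace X] {T₀ : X →ₗ.[ℂ] X}

/-- A graph-bounded linear map on `dom T₀*` that vanishes on a set with graph-dense span is zero;
the density is expressed by orthogonality. -/
theorem eq_zero_of_graph_bounded {V : Type*} [NormedAddCommGroup V] [NormedSpace ℂ V]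
    {T : X →ₗ.[ℂ] X} {D : Set T.domain}
    (hdense : ∀ u v : X, (∀ p ∈ D, ⟪(p : X), u⟫_ℂ + ⟪T p, v⟫_ℂ = 0) →
      ∀ x : T.domain, ⟪(x : X), u⟫_ℂ + ⟪T x, v⟫_ℂ = 0)
    (Δ : T.domain →ₗ[ℂ] V) {C : ℝ}
    (hΔ : ∀ x : T.domain, ‖Δ x‖ ≤ C * Real.sqrt (‖(x : X)‖ ^ 2 + ‖T x‖ ^ 2))
    (hD : ∀ p ∈ D, Δ p = 0) : Δ = 0 := by
  let ι : T.domain →ₗ[ℂ] WithLp 2 (X × X) :=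
    (WithLp.linearEquiv 2 ℂ (X × X)).symm.toLinearMap ∘ₗ T.domain.subtype.prod T.toFun
  have hι : ∀ x, ‖ι x‖ = Real.sqrt (‖(x : X)‖ ^ 2 + ‖T x‖ ^ 2) := fun x => by
    rw [WithLp.prod_norm_eq_of_L2]
    rfl
  let M : Submodule ℂ (WithLp 2 (X × X)) := (Submodule.span ℂ D).map ι
  have hinner : ∀ x : T.domain, ∀ w : WithLp 2 (X × X),
      ⟪ι x, w⟫_ℂ = ⟪(x : X), w.fst⟫_ℂ + ⟪T x, w.snd⟫_ℂ := fun x w => by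
    rw [WithLp.prod_inner_apply]
    rfl
  have hcl : ∀ x, ι x ∈ M.topologicalClosure := by
    intro x
    rw [← Submodule.orthogonal_orthogonal_eq_closure]
    intro w hw
    rw [← inner_conj_symm, hinner, hdense, map_zero]
    intro p hp
    rw [← hinner]
    exact hw _ ⟨p, Submodule.subset_span hp, rfl⟩
  have hspan : ∀ p ∈ Submodule.span ℂ D, Δ p = 0 := by
    intro p hp
    exact (Submodule.span_le.2 hD : Submodule.span ℂ D ≤ LinearMap.ker Δ) hp
  ext1 x
  rw [LinearMap.zero_apply, ← norm_le_zero_iff]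
  refine le_of_forall_pos_le_add fun ε hε => ?_
  rw [zero_add]
  have hx : ι x ∈ closure (M : Set (WithLp 2 (X × X))) := hcl x
  -- Since C may be zero or negative, |C| + 1 serves as a positive bound.
  obtain ⟨m, ⟨p, hp, rfl⟩, hm⟩ := Metric.mem_closure_iff.1 hx (ε / (|C| + 1)) (by positivity)
  have h1 : Δ x = Δ (x - p) := by rw [map_sub, hspan p hp, sub_zero]
  rw [h1]
  refine (hΔ _).trans ?_
  rw [← hι, map_sub, ← dist_eq_norm]
  calc C * dist (ι x) (ι p) ≤ (|C| + 1) * (ε / (|C| + 1)) := by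
        apply mul_le_mul _ hm.le dist_nonneg (by positivity)
        linarith [le_abs_self C]
    _ = ε := by field_simp

/-- `BV` is only a relation, because a boundary value is read off from some chain of primitives.
Green's identity and the surjectivity `hsurj` force it to be a linear, graph-bounded function. `D`
plays the role of H^N and `γ` that of the explicit boundary map. -/
theorem existsUnique_boundary_extension (hd : Dense (T₀.domain : Set X))
    (hs : ∀ x y : T₀.domain, ⟪T₀ x, (y : X)⟫_ℂ + ⟪(x : X), T₀ y⟫_ℂ = 0) {r : ℕ}
    {BV : T₀.adjoint.domain → BdPair r → Prop} {D : Set T₀.adjoint.domain}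
    {γ : T₀.adjoint.domain → BdPair r}
    (hgreen : ∀ x y g h, BV x g → BV y h →
      ⟪T₀.adjoint x, (y : X)⟫_ℂ + ⟪(x : X), T₀.adjoint y⟫_ℂ = boundaryForm g h)
    (hex : ∀ x, ∃ g, BV x g) (hsurj : ∀ g, ∃ p ∈ D, BV p g) (hγ : ∀ p ∈ D, BV p (γ p))
    (hmin : ∀ φ : T₀.domain, ∃ hφ : (φ : X) ∈ T₀.adjoint.domain, ⟨(φ : X), hφ⟩ ∈ D) :
    ∃ Γ : T₀.adjoint.domain →ₗ[ℂ] BdPair r, IsBoundaryTriplet T₀ Γ ∧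
      (∃ C : ℝ, ∀ x : T₀.adjoint.domain,
        ‖Γ x‖ ≤ C * Real.sqrt (‖(x : X)‖ ^ 2 + ‖T₀.adjoint x‖ ^ 2)) ∧
      (∀ p ∈ D, Γ p = γ p) ∧
      ∀ Γ' : T₀.adjoint.domain →ₗ[ℂ] BdPair r,
        (∃ C : ℝ, ∀ x : T₀.adjoint.domain,
          ‖Γ' x‖ ≤ C * Real.sqrt (‖(x : X)‖ ^ 2 + ‖T₀.adjoint x‖ ^ 2)) →
        (∀ p ∈ D, Γ' p = γ p) → Γ' = Γ := by
  -- Against (0, e_l) the form returns the l-th coordinate of g₀, against (e_l, 0) that of g₁; the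
  -- Green functionals of these elements are therefore the coordinates of Γ.
  choose p₁ hp₁D hp₁ using fun l : Fin r => hsurj (0, EuclideanSpace.single l 1)
  choose p₀ hp₀D hp₀ using fun l : Fin r => hsurj (EuclideanSpace.single l 1, 0)
  let Γ : T₀.adjoint.domain →ₗ[ℂ] BdPair r :=
    (greenMap T₀.adjoint p₁).prod (greenMap T₀.adjoint p₀)
  have hΓ : ∀ x g, BV x g → Γ x = g := by
    intro x g hg
    refine Prod.ext ?_ ?_
    · ext l
      change greenFunctional T₀.adjoint (p₁ l) x = g.1 l
      rw [greenFunctional_apply, hgreen _ _ _ _ (hp₁ l) hg]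
      simp [boundaryForm, EuclideanSpace.inner_single_left]
    · ext l
      change greenFunctional T₀.adjoint (p₀ l) x = g.2 l
      rw [greenFunctional_apply, hgreen _ _ _ _ (hp₀ l) hg]
      simp [boundaryForm, EuclideanSpace.inner_single_left]
  have hBV : ∀ x, BV x (Γ x) := fun x => by
    obtain ⟨g, hg⟩ := hex x
    rwa [hΓ x g hg]
  have hdense : ∀ u v : X,
      (∀ p ∈ D, ⟪((p : T₀.adjoint.domain) : X), u⟫_ℂ + ⟪T₀.adjoint p, v⟫_ℂ = 0) →
      ∀ x : T₀.adjoint.domain, ⟪(x : X), u⟫_ℂ + ⟪T₀.adjoint x, v⟫_ℂ = 0 := by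
    intro u v h
    -- Let (u, v) be orthogonal to the graph over D. Testing with minimal elements, on which `T₀*`
    -- is -T₀, shows T₀*v = u.
    have hv : ∃ hy : v ∈ T₀.adjoint.domain, T₀.adjoint ⟨v, hy⟩ = u := by
      rw [mem_graph_adjoint_iff hd]
      intro φ
      obtain ⟨hφ, hφD⟩ := hmin φ
      obtain ⟨hφ', h1⟩ := mem_adjoint_of_skew hd hs φ
      have h2 := h _ hφD
      rw [h1, inner_neg_left] at h2
      rw [← inner_conj_symm, ← inner_conj_symm v]
      exact congrArg _ (add_neg_eq_zero.1 h2)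
    obtain ⟨hy, rfl⟩ := hv
    -- The boundary values of D fill the whole space, so v has boundary value zero; Green's identity
    -- then makes (u, v) orthogonal to the entire graph.
    have h0 : Γ ⟨v, hy⟩ = 0 := by
      apply eq_zero_of_boundaryForm
      intro g
      obtain ⟨p, hpD, hp⟩ := hsurj g
      rw [← hgreen _ _ _ _ hp (hBV ⟨v, hy⟩), add_comm]
      exact h p hpD
    intro x
    rw [add_comm]
    have := hgreen _ _ _ _ (hBV x) (hBV ⟨v, hy⟩)
    rw [h0, boundaryForm_zero_right] at this
    exact this
  obtain ⟨C₁, hC₁, h₁⟩ := norm_greenMap_le T₀.adjoint p₁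
  obtain ⟨C₀, hC₀, h₀⟩ := norm_greenMap_le T₀.adjoint p₀
  have hbd : ∀ x : T₀.adjoint.domain,
      ‖Γ x‖ ≤ (C₁ + C₀) * Real.sqrt (‖(x : X)‖ ^ 2 + ‖T₀.adjoint x‖ ^ 2) := by
    intro x
    rw [Prod.norm_def, add_mul]
    have k₁ := h₁ x
    have k₀ := h₀ x
    have s : 0 ≤ Real.sqrt (‖(x : X)‖ ^ 2 + ‖T₀.adjoint x‖ ^ 2) := Real.sqrt_nonneg _
    refine max_le (k₁.trans ?_) (k₀.trans ?_)
    · exact le_add_of_nonneg_right (mul_nonneg hC₀ s)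
    · exact le_add_of_nonneg_left (mul_nonneg hC₁ s)
  have hext : ∀ p ∈ D, Γ p = γ p := fun p hp => hΓ _ _ (hγ p hp)
  refine ⟨Γ, ⟨hd, hs, inferInstance, ?_, ?_⟩, ⟨_, hbd⟩, hext, ?_⟩
  · intro g
    obtain ⟨p, -, hp⟩ := hsurj g
    exact ⟨p, hΓ _ _ hp⟩
  · intro x y
    exact hgreen _ _ _ _ (hBV x) (hBV y)
  · rintro Γ' ⟨C, hC⟩ hΓ'
    rw [← sub_eq_zero]
    refine eq_zero_of_graph_bounded hdense (Γ' - Γ) (C := C + (C₁ + C₀)) ?_ ?_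
    · intro x
      rw [add_mul]
      exact (norm_sub_le _ _).trans (add_le_add (hC x) (hbd x))
    · intro p hp
      rw [LinearMap.sub_apply, hΓ' p hp, hext p hp, sub_self]

end Construction

/-! ## Primitives of integrable functions -/

section Primitive

variable {V W U : Type*} [NormedAddCommGroup V] [NormedSpace ℝ V]
  [NormedAddCommGroup W] [NormedSpace ℝ W]
  [NormedAddCommGroup U] [NormedSpace ℝ U]

/-- An increment of B(f, g) is at most ‖B‖ (sup‖f‖ · increment of g + sup‖g‖ · increment of f). This
is the basis of the product rule for primitives. -/
theorem AbsolutelyContinuousOnInterval.bilin (B : V →L[ℝ] W →L[ℝ] U) {f : ℝ → V} {g : ℝ → W}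
    {a b : ℝ} (hf : AbsolutelyContinuousOnInterval f a b)
    (hg : AbsolutelyContinuousOnInterval g a b) :
    AbsolutelyContinuousOnInterval (fun t => B (f t) (g t)) a b := by
  obtain ⟨C, hC⟩ := hf.exists_bound
  obtain ⟨D, hD⟩ := hg.exists_bound
  unfold AbsolutelyContinuousOnInterval at hf hg
  apply squeeze_zero' ?_ ?_
    (by simpa using (hg.const_mul (‖B‖ * C)).add (hf.const_mul (‖B‖ * D)))
  · exact Filter.Eventually.of_forall fun _ => Finset.sum_nonneg (fun i hi => dist_nonneg)
  rw [Filter.eventually_inf_principal]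
  filter_upwards with E hE
  simp only [Finset.mul_sum, ← Finset.sum_add_distrib]
  refine Finset.sum_le_sum fun i hi => ?_
  simp only [AbsolutelyContinuousOnInterval.disjWithin, mem_ofPred_eq] at hE
  obtain ⟨h1, h2⟩ := hE.1 i hi
  refine (dist_triangle _ (B (f (E.2 i).1) (g (E.2 i).2)) _).trans (add_le_add ?_ ?_)
  · rw [dist_eq_norm, dist_eq_norm, ← map_sub]
    refine (B.le_opNorm₂ _ _).trans ?_
    gcongr
    exact hC _ h1
  · rw [dist_eq_norm, dist_eq_norm, ← sub_apply, ← map_sub]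
    refine (B.le_opNorm₂ _ _).trans ?_
    rw [mul_assoc, mul_assoc, mul_comm D]
    gcongr
    exact hD _ h2

/-- On `[a,b]`, `F` is a primitive of the integrable function `f`. -/
def IsPrimitive (a b : ℝ) (F f : ℝ → V) : Prop :=
  IntervalIntegrable f volume a b ∧ ∀ t ∈ Icc a b, F t = F a + ∫ s in a..t, f s

variable {a b : ℝ} {F f : ℝ → V} {G g : ℝ → W}

theorem IsPrimitive.intervalIntegrable_left (h : IsPrimitive a b F f) {t : ℝ} (ht : t ∈ Icc a b) :
    IntervalIntegrable f volume a t :=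
  h.1.mono_set (by
    rw [uIcc_of_le ht.1, uIcc_of_le (ht.1.trans ht.2)]; exact Icc_subset_Icc_right ht.2)

theorem IsPrimitive.congr_ae {f' : ℝ → V} (hF : IsPrimitive a b F f) (hab : a ≤ b)
    (h : f =ᵐ[volume.restrict (Ioo a b)] f') : IsPrimitive a b F f' := by
  have h' : f =ᵐ[volume.restrict (Ioc a b)] f' := by rwa [← restrict_Ioo_eq_restrict_Ioc]
  have hi : IntervalIntegrable f' volume a b := by
    rw [intervalIntegrable_iff_integrableOn_Ioc_of_le hab] at *
    exact ((intervalIntegrable_iff_integrableOn_Ioc_of_le hab).1 hF.1).congr h'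
  refine ⟨hi, fun t ht => ?_⟩
  rw [hF.2 t ht]
  congr 1
  apply intervalIntegral.integral_congr_ae_restrict
  rw [uIoc_of_le ht.1]
  exact ae_mono (Measure.restrict_mono (Ioc_subset_Ioc_right ht.2) le_rfl) h'

theorem isPrimitive_zero : IsPrimitive a b (fun _ => (0 : V)) (fun _ => 0) :=
  ⟨intervalIntegrable_const, fun t _ => by simp⟩

theorem IsPrimitive.add {F' f' : ℝ → V} (hF : IsPrimitive a b F f) (hF' : IsPrimitive a b F' f') :
    IsPrimitive a b (fun t => F t + F' t) (fun t => f t + f' t) := by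
  refine ⟨hF.1.add hF'.1, fun t ht => ?_⟩
  beta_reduce
  rw [intervalIntegral.integral_add (hF.intervalIntegrable_left ht)
    (hF'.intervalIntegrable_left ht), hF.2 t ht, hF'.2 t ht]
  abel

theorem IsPrimitive.sum {ι : Type*} (s : Finset ι) {F f : ι → ℝ → V}
    (h : ∀ i ∈ s, IsPrimitive a b (F i) (f i)) :
    IsPrimitive a b (fun t => ∑ i ∈ s, F i t) (fun t => ∑ i ∈ s, f i t) := by
  classical
  induction s using Finset.induction_on with
  | empty => simpa using isPrimitive_zero
  | insert i s hi ih =>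
    simp only [Finset.sum_insert hi]
    exact (h i (Finset.mem_insert_self i s)).add
      (ih fun j hj => h j (Finset.mem_insert_of_mem hj))

theorem IsPrimitive.integral_sub (h : IsPrimitive a b F f) {s t : ℝ} (hs : s ∈ Icc a b)
    (ht : t ∈ Icc a b) : ∫ u in s..t, f u = F t - F s := by
  rw [h.2 s hs, h.2 t ht, ← intervalIntegral.integral_interval_sub_left
    (h.intervalIntegrable_left ht) (h.intervalIntegrable_left hs)]
  abel

theorem IsPrimitive.integral_eq (h : IsPrimitive a b F f) (hab : a ≤ b) :
    ∫ u in a..b, f u = F b - F a :=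
  h.integral_sub (left_mem_Icc.2 hab) (right_mem_Icc.2 hab)

/-- Increments of F are dominated by those of the primitive of ‖f‖. -/
theorem IsPrimitive.absolutelyContinuous (h : IsPrimitive a b F f) (hab : a ≤ b) :
    AbsolutelyContinuousOnInterval F a b := by
  have hn : IntervalIntegrable (fun t => ‖f t‖) volume a b := h.1.norm
  have h1 := hn.absolutelyContinuousOnInterval_intervalIntegral (c := a) left_mem_uIcc
  have hnp : IsPrimitive a b (fun x => ∫ v in a..x, ‖f v‖) (fun t => ‖f t‖) :=
    ⟨hn, fun t _ => by simp⟩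
  unfold AbsolutelyContinuousOnInterval at h1 ⊢
  apply squeeze_zero' ?_ ?_ h1
  · exact Filter.Eventually.of_forall fun _ => Finset.sum_nonneg (fun i hi => dist_nonneg)
  rw [Filter.eventually_inf_principal]
  filter_upwards with E hE
  refine Finset.sum_le_sum fun i hi => ?_
  simp only [AbsolutelyContinuousOnInterval.disjWithin, mem_ofPred_eq] at hE
  obtain ⟨h1, h2⟩ := hE.1 i hi
  rw [uIcc_of_le hab] at h1 h2
  rw [dist_comm, dist_eq_norm, ← h.integral_sub h1 h2, dist_comm, dist_eq_norm,
    ← hnp.integral_sub h1 h2]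
  exact intervalIntegral.norm_integral_le_abs_integral_norm

theorem IsPrimitive.continuousOn (h : IsPrimitive a b F f) (hab : a ≤ b) :
    ContinuousOn F (Icc a b) := by
  have := (h.absolutelyContinuous hab).continuousOn
  rwa [uIcc_of_le hab] at this

variable [CompleteSpace V] [CompleteSpace W] [CompleteSpace U]

theorem IsPrimitive.ae_hasDerivAt (h : IsPrimitive a b F f) (hab : a ≤ b) :
    ∀ᵐ t, t ∈ Ioo a b → HasDerivAt F (f t) t := by
  filter_upwards [h.1.ae_hasDerivAt_integral] with t ht hm
  have h1 := ht (by rw [uIcc_of_le hab]; exact Ioo_subset_Icc_self hm) a left_mem_uIcc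
  refine (h1.const_add (F a)).congr_of_eventuallyEq ?_
  filter_upwards [Ioo_mem_nhds hm.1 hm.2] with s hs
  exact h.2 s (Ioo_subset_Icc_self hs)

/-- The difference of F and ∫ f is absolutely continuous with derivative zero almost everywhere,
hence constant. -/
theorem isPrimitive_of_absolutelyContinuous (hab : a ≤ b)
    (hF : AbsolutelyContinuousOnInterval F a b) (hf : IntervalIntegrable f volume a b)
    (hd : ∀ᵐ t, t ∈ Ioo a b → HasDerivAt F (f t) t) : IsPrimitive a b F f := by
  refine ⟨hf, fun t ht => ?_⟩
  have hP : IsPrimitive a b (fun x => ∫ v in a..x, f v) f := ⟨hf, fun t _ => by simp⟩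
  have h1 : ∀ᵐ x, x ≠ a := by simp [ae_iff, measure_singleton]
  have h2 : ∀ᵐ x, x ≠ b := by simp [ae_iff, measure_singleton]
  obtain ⟨C, hC⟩ := (hF.sub (hP.absolutelyContinuous hab)).const_of_ae_hasDerivAt_zero (by
    filter_upwards [hd, hP.ae_hasDerivAt hab, h1, h2] with t k1 k2 n1 n2 ht
    rw [uIcc_of_le hab] at ht
    have hm : t ∈ Ioo a b := ⟨lt_of_le_of_ne ht.1 n1.symm, lt_of_le_of_ne ht.2 n2⟩
    simpa using (k1 hm).sub (k2 hm))
  rw [uIcc_of_le hab] at hC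
  have e1 := hC t ht
  have e2 := hC a (left_mem_Icc.2 hab)
  simp only [Pi.sub_apply, intervalIntegral.integral_same, sub_zero] at e1 e2
  rw [e2, ← e1]
  abel

theorem IsPrimitive.bilin (B : V →L[ℝ] W →L[ℝ] U) (hF : IsPrimitive a b F f)
    (hG : IsPrimitive a b G g) (hab : a ≤ b) :
    IsPrimitive a b (fun t => B (F t) (G t)) (fun t => B (f t) (G t) + B (F t) (g t)) := by
  have hFc := hF.continuousOn hab
  have hGc := hG.continuousOn hab
  refine isPrimitive_of_absolutelyContinuous hab
    ((hF.absolutelyContinuous hab).bilin B (hG.absolutelyContinuous hab)) ?_ ?_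
  · obtain ⟨CF, hCF⟩ := isCompact_Icc.exists_bound_of_continuousOn hFc
    obtain ⟨CG, hCG⟩ := isCompact_Icc.exists_bound_of_continuousOn hGc
    have hFm : AEStronglyMeasurable F (volume.restrict (Ioc a b)) :=
      (hFc.mono Ioc_subset_Icc_self).aestronglyMeasurable measurableSet_Ioc
    have hGm : AEStronglyMeasurable G (volume.restrict (Ioc a b)) :=
      (hGc.mono Ioc_subset_Icc_self).aestronglyMeasurable measurableSet_Ioc
    have hf1 : Integrable f (volume.restrict (Ioc a b)) :=
      (intervalIntegrable_iff_integrableOn_Ioc_of_le hab).1 hF.1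
    have hg1 : Integrable g (volume.restrict (Ioc a b)) :=
      (intervalIntegrable_iff_integrableOn_Ioc_of_le hab).1 hG.1
    rw [intervalIntegrable_iff_integrableOn_Ioc_of_le hab]
    refine Integrable.add ?_ ?_
    · refine (hf1.norm.const_mul (‖B‖ * CG)).mono'
        (B.aestronglyMeasurable_comp₂ hf1.aestronglyMeasurable hGm) ?_
      filter_upwards [ae_restrict_mem measurableSet_Ioc] with t ht
      refine (B.le_opNorm₂ _ _).trans ?_
      rw [mul_right_comm]
      gcongr
      exact hCG t (Ioc_subset_Icc_self ht)
    · refine (hg1.norm.const_mul (‖B‖ * CF)).mono'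
        (B.aestronglyMeasurable_comp₂ hFm hg1.aestronglyMeasurable) ?_
      filter_upwards [ae_restrict_mem measurableSet_Ioc] with t ht
      refine (B.le_opNorm₂ _ _).trans ?_
      gcongr
      exact hCF t (Ioc_subset_Icc_self ht)
  · filter_upwards [hF.ae_hasDerivAt hab, hG.ae_hasDerivAt hab] with t h1 h2 ht
    rw [add_comm]
    exact B.hasDerivAt_of_bilinear (fun _ => h1 ht) (fun _ => h2 ht)

theorem IsPrimitive.clm (L : V →L[ℝ] W) (hF : IsPrimitive a b F f) :
    IsPrimitive a b (fun t => L (F t)) (fun t => L (f t)) := by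
  refine ⟨⟨L.integrable_comp hF.1.1, L.integrable_comp hF.1.2⟩, fun t ht => ?_⟩
  beta_reduce
  rw [hF.2 t ht, map_add, L.intervalIntegral_comp_comm (hF.intervalIntegrable_left ht)]

theorem isPrimitive_of_hasDerivAt (hd : ∀ t, HasDerivAt F (f t) t)
    (hf : Continuous f) : IsPrimitive a b F f := by
  refine ⟨hf.intervalIntegrable _ _, fun t ht => ?_⟩
  rw [intervalIntegral.integral_eq_sub_of_hasDerivAt (fun x _ => hd x)
    (hf.intervalIntegrable _ _)]
  abel

end Primitive

/-! ## Test functions and chains of primitives -/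

section Tests

variable {V W U : Type*} [NormedAddCommGroup V] [NormedSpace ℝ V]
  [NormedAddCommGroup W] [NormedSpace ℝ W] [NormedAddCommGroup U] [NormedSpace ℝ U]
  {a b : ℝ}

theorem deriv_mem_testFunctions {φ : ℝ → V} (h : φ ∈ testFunctions a b V ℝ) :
    deriv φ ∈ testFunctions a b V ℝ := by
  refine ⟨(contDiff_infty_iff_deriv.1 h.1).2, h.2.1.deriv, ?_⟩
  exact (closure_minimal support_deriv_subset (isClosed_tsupport _)).trans h.2.2

theorem testFunctions_eq_zero {φ : ℝ → V} (h : φ ∈ testFunctions a b V ℝ) {t : ℝ}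
    (ht : t ∉ Ioo a b) : φ t = 0 :=
  image_eq_zero_of_notMem_tsupport fun hm => ht (h.2.2 hm)

theorem hasDerivAt_testFunctions {φ : ℝ → V} (h : φ ∈ testFunctions a b V ℝ) (t : ℝ) :
    HasDerivAt φ (deriv φ t) t :=
  (h.1.differentiable (by simp) t).hasDerivAt

theorem continuous_testFunctions {φ : ℝ → V} (h : φ ∈ testFunctions a b V ℝ) : Continuous φ :=
  h.1.continuous

theorem iteratedDeriv_mem_testFunctions {φ : ℝ → V} (h : φ ∈ testFunctions a b V ℝ) (k : ℕ) :
    iteratedDeriv k φ ∈ testFunctions a b V ℝ := by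
  induction k with
  | zero => simpa using h
  | succ k ih => rw [iteratedDeriv_succ]; exact deriv_mem_testFunctions ih

theorem intervalIntegrable_iff_Ioo {V : Type*} [NormedAddCommGroup V] (hab : a ≤ b) {f : ℝ → V} :
    IntervalIntegrable f volume a b ↔ IntegrableOn f (Ioo a b) := by
  rw [intervalIntegrable_iff_integrableOn_Ioc_of_le hab, integrableOn_Ioc_iff_integrableOn_Ioo]

theorem integral_Ioo_eq (hab : a ≤ b) (f : ℝ → V) :
    ∫ x in Ioo a b, f x = ∫ x in a..b, f x := by
  rw [intervalIntegral.integral_of_le hab, integral_Ioc_eq_integral_Ioo]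

theorem integrableOn_bilin (B : U →L[ℝ] V →L[ℝ] W) {φ : ℝ → U} {f : ℝ → V}
    (hφ : ContinuousOn φ (Icc a b)) (hf : IntegrableOn f (Ioo a b)) :
    IntegrableOn (fun t => B (φ t) (f t)) (Ioo a b) := by
  obtain ⟨C, hC⟩ := isCompact_Icc.exists_bound_of_continuousOn hφ
  have hm : AEStronglyMeasurable φ (volume.restrict (Ioo a b)) :=
    (hφ.mono Ioo_subset_Icc_self).aestronglyMeasurable measurableSet_Ioo
  refine (hf.norm.const_mul (‖B‖ * C)).mono'
    (B.aestronglyMeasurable_comp₂ hm hf.aestronglyMeasurable) ?_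
  filter_upwards [ae_restrict_mem measurableSet_Ioo] with t ht
  refine (B.le_opNorm₂ _ _).trans ?_
  gcongr
  exact hC t (Ioo_subset_Icc_self ht)

theorem integrableOn_smul {φ : ℝ → ℝ} {f : ℝ → V}
    (hφ : Continuous φ) (hf : IntegrableOn f (Ioo a b)) :
    IntegrableOn (fun t => φ t • f t) (Ioo a b) :=
  integrableOn_bilin (ContinuousLinearMap.lsmul ℝ ℝ) hφ.continuousOn hf

/-- The primitive starting at a vanishes to the left of the support of ψ and, because the total
integral is zero, also to its right. -/
theorem exists_testFunction_primitive {ψ : ℝ → ℝ} (hψ : ψ ∈ testFunctions a b ℝ ℝ)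
    (h0 : ∫ x in Ioo a b, ψ x = 0) : ∃ φ ∈ testFunctions a b ℝ ℝ, deriv φ = ψ := by
  rcases (tsupport ψ).eq_empty_or_nonempty with he | hne
  · refine ⟨0, Submodule.zero_mem _, ?_⟩
    rw [tsupport_eq_empty_iff.1 he]
    simp
  have hK : IsCompact (tsupport ψ) := hψ.2.1
  have hc := hψ.2.2 (hK.sInf_mem hne)
  have hd := hψ.2.2 (hK.sSup_mem hne)
  set c := sInf (tsupport ψ)
  set d := sSup (tsupport ψ)
  have hsub : tsupport ψ ⊆ Icc c d := fun x hx =>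
    ⟨csInf_le hK.bddBelow hx, le_csSup hK.bddAbove hx⟩
  have hz : ∀ t, t ∉ Icc c d → ψ t = 0 := fun t ht =>
    image_eq_zero_of_notMem_tsupport fun h => ht (hsub h)
  have hcont := continuous_testFunctions hψ
  have hderiv : ∀ t, HasDerivAt (fun t => ∫ s in a..t, ψ s) (ψ t) t := fun t =>
    intervalIntegral.integral_hasDerivAt_right (hcont.intervalIntegrable _ _)
      hcont.stronglyMeasurable.stronglyMeasurableAtFilter hcont.continuousAt
  have hde : deriv (fun t => ∫ s in a..t, ψ s) = ψ := funext fun t => (hderiv t).deriv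
  have hab : a ≤ b := hc.1.le.trans hc.2.le
  have hsupp : tsupport (fun t => ∫ s in a..t, ψ s) ⊆ Icc c d := by
    refine closure_minimal (fun t ht => ?_) isClosed_Icc
    by_contra hcd
    apply ht
    rcases lt_or_ge t c with h | h
    · change ∫ s in a..t, ψ s = 0
      rw [intervalIntegral.integral_congr (g := fun _ => 0)]
      · simp
      · intro s hs
        refine hz s fun hm => ?_
        have : s ≤ max a t := hs.2
        have := max_lt hc.1 h
        linarith [hm.1]
    · have h' : d < t := not_le.1 fun h2 => hcd ⟨h, h2⟩
      change ∫ s in a..t, ψ s = 0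
      rw [← intervalIntegral.integral_add_adjacent_intervals (hcont.intervalIntegrable a b)
        (hcont.intervalIntegrable b t), ← integral_Ioo_eq hab, h0, zero_add,
        intervalIntegral.integral_congr (g := fun _ => 0)]
      · simp
      · intro s hs
        refine hz s fun hm => ?_
        have : min b t ≤ s := hs.1
        have := lt_min hd.2 h'
        linarith [hm.2]
  refine ⟨_, ⟨?_, ?_, ?_⟩, hde⟩
  · exact contDiff_infty_iff_deriv.2 ⟨fun t => (hderiv t).differentiableAt, by rw [hde]; exact hψ.1⟩
  · exact isCompact_Icc.of_isClosed_subset (isClosed_tsupport _) hsupp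
  · exact hsupp.trans fun x hx => ⟨hc.1.trans_le hx.1, hx.2.trans_lt hd.2⟩

theorem exists_testFunction_integral_one (hab : a < b) :
    ∃ ψ ∈ testFunctions a b ℝ ℝ, ∫ x in Ioo a b, ψ x = 1 := by
  let β : ContDiffBump ((a + b) / 2 : ℝ) :=
    ⟨(b - a) / 8, (b - a) / 4, by linarith, by linarith⟩
  have hsupp : tsupport (β.normed volume) ⊆ Ioo a b := by
    rw [β.tsupport_normed_eq, Real.closedBall_eq_Icc]
    intro x hx
    constructor
    · have := hx.1; simp only [β] at this; linarith
    · have := hx.2; simp only [β] at this; linarith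
  refine ⟨β.normed volume, ⟨β.contDiff_normed, β.hasCompactSupport_normed, hsupp⟩, ?_⟩
  rw [setIntegral_eq_integral_of_forall_compl_eq_zero, β.integral_normed]
  intro x hx
  exact image_eq_zero_of_notMem_tsupport fun h => hx (hsupp h)

/-- `W_{i+1}' = W_i - f_i` on `[a,b]` for `i < N`, and `W_N = f_N`. -/
structure IsPrimitiveChain (a b : ℝ) (N : ℕ) (f W : ℕ → ℝ → V) : Prop where
  prim : ∀ i < N, IsPrimitive a b (W (i + 1)) (fun t => W i t - f i t)
  top : W N =ᵐ[volume.restrict (Ioo a b)] f N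

theorem IsPrimitiveChain.shift {N : ℕ} {f W : ℕ → ℝ → V} {i : ℕ}
    (h : IsPrimitiveChain a b (N + i) f W) :
    IsPrimitiveChain a b N (fun k => f (k + i)) (fun k => W (k + i)) := by
  refine ⟨fun k hk => ?_, h.top⟩
  have := h.prim (k + i) (by omega)
  rwa [add_right_comm] at this

variable [CompleteSpace V] [CompleteSpace W] [CompleteSpace U]

theorem isPrimitive_testFunction {φ : ℝ → V} (h : φ ∈ testFunctions a b V ℝ) :
    IsPrimitive a b φ (deriv φ) :=
  isPrimitive_of_hasDerivAt (hasDerivAt_testFunctions h)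
    (continuous_testFunctions (deriv_mem_testFunctions h))

/-- Integration by parts against a test function. -/
theorem IsPrimitive.integral_deriv_test (hab : a ≤ b) (B : U →L[ℝ] V →L[ℝ] W) {φ : ℝ → U}
    (hφ : φ ∈ testFunctions a b U ℝ) {F f : ℝ → V} (hF : IsPrimitive a b F f) :
    ∫ t in Ioo a b, B (φ t) (f t) = -∫ t in Ioo a b, B (deriv φ t) (F t) := by
  have h := ((isPrimitive_testFunction hφ).bilin B hF hab).integral_eq hab
  rw [testFunctions_eq_zero hφ (t := b) (by simp), testFunctions_eq_zero hφ (t := a) (by simp),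
    ← integral_Ioo_eq hab, integral_add] at h
  · simp only [map_zero, zero_apply, sub_zero] at h
    exact eq_neg_of_add_eq_zero_right h
  · refine integrableOn_bilin B (continuous_testFunctions (deriv_mem_testFunctions hφ)).continuousOn
      (((hF.continuousOn hab).integrableOn_Icc).mono_set Ioo_subset_Icc_self)
  · exact integrableOn_bilin B (continuous_testFunctions hφ).continuousOn
      ((intervalIntegrable_iff_Ioo hab).1 hF.1)

theorem ae_eq_of_integral_test_eq {f g : ℝ → V} (hf : IntegrableOn f (Ioo a b))
    (hg : IntegrableOn g (Ioo a b))
    (h : ∀ φ ∈ testFunctions a b ℝ ℝ, ∫ t in Ioo a b, φ t • f t = ∫ t in Ioo a b, φ t • g t) :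
    f =ᵐ[volume.restrict (Ioo a b)] g := by
  have h1 := isOpen_Ioo.ae_eq_zero_of_integral_contDiff_smul_eq_zero (μ := volume)
    (f := fun t => f t - g t) (hf.sub hg).locallyIntegrableOn (fun φ h1 h2 h3 => by
      have hφ : φ ∈ testFunctions a b ℝ ℝ := ⟨h1, h2, h3⟩
      rw [← setIntegral_eq_integral_of_forall_compl_eq_zero (s := Ioo a b)]
      · simp only [smul_sub]
        rw [integral_sub (integrableOn_smul h1.continuous hf) (integrableOn_smul h1.continuous hg),
          h φ hφ, sub_self]
      · intro x hx
        rw [testFunctions_eq_zero hφ hx, zero_smul])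
  rw [Filter.EventuallyEq, ae_restrict_iff' measurableSet_Ioo]
  filter_upwards [h1] with t ht hm
  exact sub_eq_zero.1 (ht hm)

/-- The weak form of a chain. -/
theorem IsPrimitiveChain.integral_test (hab : a ≤ b) (B : U →L[ℝ] V →L[ℝ] W)
    {N : ℕ} {f w : ℕ → ℝ → V}
    (h : IsPrimitiveChain a b N f w) (hf : ∀ k ≤ N, IntegrableOn (f k) (Ioo a b)) {φ : ℝ → U}
    (hφ : φ ∈ testFunctions a b U ℝ) :
    ∫ t in Ioo a b, B (φ t) (w 0 t) =
      ∑ k ∈ Finset.range (N + 1), (-1 : ℝ) ^ k •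
        ∫ t in Ioo a b, B (iteratedDeriv k φ t) (f k t) := by
  induction N generalizing f w φ with
  | zero =>
    simp only [zero_add, Finset.range_one, Finset.sum_singleton, pow_zero, one_smul,
      iteratedDeriv_zero]
    refine integral_congr_ae ?_
    filter_upwards [h.top] with t ht
    rw [ht]
  | succ N ih =>
    have h1 := ih h.shift (fun k hk => hf (k + 1) (by omega)) (deriv_mem_testFunctions hφ)
    have h2 := (h.prim 0 (by omega)).integral_deriv_test hab B hφ
    have hi : IntegrableOn (fun t => w 0 t - f 0 t) (Ioo a b) :=
      (intervalIntegrable_iff_Ioo hab).1 (h.prim 0 (by omega)).1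
    have hc := (continuous_testFunctions hφ).continuousOn (s := Icc a b)
    have h3 : ∫ t in Ioo a b, B (φ t) (w 0 t) =
        (∫ t in Ioo a b, B (φ t) (w 0 t - f 0 t)) + ∫ t in Ioo a b, B (φ t) (f 0 t) := by
      rw [← integral_add (integrableOn_bilin B hc hi)
        (integrableOn_bilin B hc (hf 0 (by omega)))]
      refine integral_congr_ae (Filter.Eventually.of_forall fun t => ?_)
      simp only [map_sub, sub_add_cancel]
    rw [h3, h2, Finset.sum_range_succ', h1]
    simp only [← iteratedDeriv_succ', pow_succ, mul_neg, mul_one, neg_smul,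
      Finset.sum_neg_distrib, pow_zero, one_smul, iteratedDeriv_zero]

/-- A weak equation of order `N` is a chain of primitives. -/
theorem exists_isPrimitiveChain (hab : a < b) {N : ℕ} {f : ℕ → ℝ → V} {z : ℝ → V}
    (hf : ∀ k ≤ N, IntegrableOn (f k) (Ioo a b)) (hz : IntegrableOn z (Ioo a b))
    (h : ∀ φ ∈ testFunctions a b ℝ ℝ,
      ∑ k ∈ Finset.range (N + 1), (-1 : ℝ) ^ k • ∫ t in Ioo a b, iteratedDeriv k φ t • f k t =
        ∫ t in Ioo a b, φ t • z t) :
    ∃ w : ℕ → ℝ → V, w 0 = z ∧ IsPrimitiveChain a b N f w := by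
  induction N generalizing f z with
  | zero =>
    refine ⟨fun _ => z, rfl, ⟨fun i hi => absurd hi (Nat.not_lt_zero i), ?_⟩⟩
    refine ae_eq_of_integral_test_eq hz (hf 0 le_rfl) fun φ hφ => ?_
    rw [← h φ hφ]
    simp
  | succ N ih =>
    set G : ℝ → V := fun t => ∫ s in a..t, (z s - f 0 s) with hGdef
    have hint : IntegrableOn (fun s => z s - f 0 s) (Ioo a b) := hz.sub (hf 0 (by omega))
    have hG : IsPrimitive a b G (fun s => z s - f 0 s) :=
      ⟨(intervalIntegrable_iff_Ioo hab.le).2 hint, fun t _ => by simp [hGdef]⟩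
    have hGi : IntegrableOn G (Ioo a b) :=
      ((hG.continuousOn hab.le).integrableOn_Icc).mono_set Ioo_subset_Icc_self
    -- M is the defect of the equation of order one less, with G in place of z. Integrating the
    -- original equation by parts shows that M annihilates derivatives of test functions.
    let M : (ℝ → ℝ) → V := fun ψ =>
      (∑ k ∈ Finset.range (N + 1), (-1 : ℝ) ^ k •
        ∫ t in Ioo a b, iteratedDeriv k ψ t • f (k + 1) t) - ∫ t in Ioo a b, ψ t • G t
    have hM0 : ∀ φ ∈ testFunctions a b ℝ ℝ, M (deriv φ) = 0 := by
      intro φ hφ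
      have h1 := h φ hφ
      have h2 := hG.integral_deriv_test hab.le (ContinuousLinearMap.lsmul ℝ ℝ) hφ
      simp only [ContinuousLinearMap.lsmul_apply] at h2
      have hc := continuous_testFunctions hφ
      simp only [smul_sub] at h2
      rw [integral_sub (integrableOn_smul hc hz) (integrableOn_smul hc (hf 0 (by omega)))] at h2
      rw [Finset.sum_range_succ'] at h1
      simp only [pow_zero, one_smul, iteratedDeriv_zero, pow_succ, mul_neg, mul_one, neg_smul,
        Finset.sum_neg_distrib] at h1
      simp only [M, ← iteratedDeriv_succ']
      rw [← h1] at h2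
      rw [sub_eq_zero]
      simpa using h2
    have hMsub : ∀ ψ ∈ testFunctions a b ℝ ℝ, ∀ χ ∈ testFunctions a b ℝ ℝ, ∀ s : ℝ,
        M (ψ - s • χ) = M ψ - s • M χ := by
      intro ψ hψ χ hχ s
      have key : ∀ k, ∀ g : ℝ → V, IntegrableOn g (Ioo a b) →
          ∫ t in Ioo a b, iteratedDeriv k (ψ - s • χ) t • g t =
          (∫ t in Ioo a b, iteratedDeriv k ψ t • g t) -
            s • ∫ t in Ioo a b, iteratedDeriv k χ t • g t := by
        intro k g hg
        rw [← integral_smul, ← integral_sub]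
        · refine integral_congr_ae (Filter.Eventually.of_forall fun t => ?_)
          beta_reduce
          have h1 : ContDiffAt ℝ k ψ t := hψ.1.contDiffAt.of_le (by exact_mod_cast le_top)
          have h2 : ContDiffAt ℝ k (s • χ) t :=
            (hχ.1.const_smul s).contDiffAt.of_le (by exact_mod_cast le_top)
          rw [iteratedDeriv_sub h1 h2, iteratedDeriv_const_smul_field, sub_smul, smul_assoc]
        · exact integrableOn_smul
            (continuous_testFunctions (iteratedDeriv_mem_testFunctions hψ k)) hg
        · exact (integrableOn_smul
            (continuous_testFunctions (iteratedDeriv_mem_testFunctions hχ k)) hg).smul s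
      have key0 := key 0 G hGi
      simp only [iteratedDeriv_zero] at key0
      simp only [M]
      rw [key0, Finset.sum_congr rfl fun k hk => by
        rw [key k (f (k + 1)) (hf (k + 1) (by have := Finset.mem_range.1 hk; omega))]]
      simp only [smul_sub, Finset.sum_sub_distrib, Finset.smul_sum]
      simp only [smul_comm s]
      abel
    obtain ⟨ψ₀, hψ₀, hone⟩ := exists_testFunction_integral_one hab
    -- Subtracting (∫ψ)ψ₀ from ψ leaves a function of integral zero, which is the derivative of a
    -- test function. So M is a constant times the integral.
    have hM : ∀ ψ ∈ testFunctions a b ℝ ℝ, M ψ = (∫ t in Ioo a b, ψ t) • M ψ₀ := by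
      intro ψ hψ
      have hmem : ψ - (∫ t in Ioo a b, ψ t) • ψ₀ ∈ testFunctions a b ℝ ℝ :=
        Submodule.sub_mem _ hψ (Submodule.smul_mem _ _ hψ₀)
      have hi : ∀ χ ∈ testFunctions a b ℝ ℝ, IntegrableOn χ (Ioo a b) := fun χ hχ =>
        ((continuous_testFunctions hχ).integrableOn_Icc).mono_set Ioo_subset_Icc_self
      obtain ⟨φ, hφ, hd⟩ := exists_testFunction_primitive hmem (by
        simp only [Pi.sub_apply, Pi.smul_apply]
        have h1 : IntegrableOn (fun x => (∫ t in Ioo a b, ψ t) • ψ₀ x) (Ioo a b) :=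
          (hi ψ₀ hψ₀).const_mul _
        rw [integral_sub (hi _ hψ) h1, integral_smul, hone]
        simp)
      have := hM0 φ hφ
      rw [hd, hMsub ψ hψ ψ₀ hψ₀] at this
      exact sub_eq_zero.1 this
    -- That constant is the constant of integration: with G + M ψ₀ on the right, the reduced
    -- equation holds exactly.
    have hc : IsPrimitive a b (fun t => G t + M ψ₀) (fun s => z s - f 0 s) :=
      ⟨hG.1, fun t ht => by
        beta_reduce
        rw [hG.2 t ht]
        abel⟩
    obtain ⟨w, hw0, hw⟩ := ih (f := fun k => f (k + 1)) (z := fun t => G t + M ψ₀)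
      (fun k hk => hf (k + 1) (by omega))
      (((hc.continuousOn hab.le).integrableOn_Icc).mono_set Ioo_subset_Icc_self) (by
        intro ψ hψ
        have h1 := hM ψ hψ
        simp only [M] at h1
        rw [sub_eq_iff_eq_add] at h1
        rw [h1]
        simp only [smul_add]
        rw [integral_add (integrableOn_smul (continuous_testFunctions hψ) hGi)
          (integrableOn_smul (continuous_testFunctions hψ)
            (integrableOn_const (by simp))), integral_smul_const, add_comm])
    refine ⟨fun i => Nat.casesOn i z w, rfl, ⟨fun i hi => ?_, hw.top⟩⟩
    cases i with
    | zero =>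
      change IsPrimitive a b (w 0) (fun t => z t - f 0 t)
      rw [hw0]
      exact hc
    | succ i => exact hw.prim i (by omega)

end Tests

/-! ## The bilinear concomitant -/

section Concomitant

variable {E : Type*} [NormedAddCommGroup E] [InnerProductSpace ℂ E]

/-- The form `∑_{i,j<N} (-1)ⁱ ⟨αᵢ, A_{i+j+1} βⱼ⟩`. -/
def concomitant (N : ℕ) (A : ℕ → E →ₗ[ℂ] E) (α β : ℕ → E) : ℂ :=
  ∑ i ∈ Finset.range N, ∑ j ∈ Finset.range N, (-1 : ℂ) ^ i * ⟪α i, A (i + j + 1) (β j)⟫_ℂ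

/-- The value `∑_{i≤N} Aᵢ αᵢ` of the differential expression on a jet. -/
def jetOp (N : ℕ) (A : ℕ → E →ₗ[ℂ] E) (α : ℕ → E) : E :=
  ∑ i ∈ Finset.range (N + 1), A i (α i)

variable {N : ℕ} {A : ℕ → E →ₗ[ℂ] E}

theorem concomitant_sub_left (α α' β : ℕ → E) :
    concomitant N A (fun i => α i - α' i) β = concomitant N A α β - concomitant N A α' β := by
  simp [concomitant, mul_sub, Finset.sum_sub_distrib]

theorem concomitant_sub_right (α β β' : ℕ → E) :
    concomitant N A α (fun i => β i - β' i) = concomitant N A α β - concomitant N A α β' := by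
  simp [concomitant, mul_sub, Finset.sum_sub_distrib]

/-- With T i j = (-1)ⁱ⟨αᵢ, A_{i+j}βⱼ⟩, shifting α gives minus the full sum without row 0 and
shifting β gives the full sum without column 0. What remains is row 0 minus column 0. The terms that
complete both sums vanish because A_k = 0 for k > N. -/
theorem concomitant_shift (hA0 : ∀ k, N < k → A k = 0)
    (hA : ∀ k u v, ⟪A k u, v⟫_ℂ = (-1 : ℂ) ^ (k + 1) * ⟪u, A k v⟫_ℂ) (α β : ℕ → E) :
    concomitant N A (fun i => α (i + 1)) β + concomitant N A α (fun i => β (i + 1)) =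
      ⟪α 0, jetOp N A β⟫_ℂ + ⟪jetOp N A α, β 0⟫_ℂ := by
  set T : ℕ → ℕ → ℂ := fun i j => (-1 : ℂ) ^ i * ⟪α i, A (i + j) (β j)⟫_ℂ with hT
  have hT0 : ∀ i j, N < i + j → T i j = 0 := fun i j h => by simp [hT, hA0 _ h]
  have e1 : concomitant N A (fun i => α (i + 1)) β =
      -∑ i ∈ Finset.range N, ∑ j ∈ Finset.range (N + 1), T (i + 1) j := by
    simp only [concomitant, ← Finset.sum_neg_distrib]
    refine Finset.sum_congr rfl fun i _ => ?_
    rw [Finset.sum_range_succ, hT0 (i + 1) N (by omega), neg_zero, add_zero]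
    refine Finset.sum_congr rfl fun j _ => ?_
    simp only [hT, pow_succ, show i + j + 1 = i + 1 + j by ring]
    ring
  have e2 : concomitant N A α (fun i => β (i + 1)) =
      ∑ i ∈ Finset.range (N + 1), ∑ j ∈ Finset.range N, T i (j + 1) := by
    rw [Finset.sum_range_succ, Finset.sum_eq_zero (s := Finset.range N)
      (f := fun j => T N (j + 1)) (fun j _ => hT0 _ _ (by omega)), add_zero]
    rfl
  have e3 : ∑ i ∈ Finset.range (N + 1), ∑ j ∈ Finset.range (N + 1), T i j =
      ∑ i ∈ Finset.range N, ∑ j ∈ Finset.range (N + 1), T (i + 1) j +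
        ∑ j ∈ Finset.range (N + 1), T 0 j := Finset.sum_range_succ' _ _
  have e4 : ∑ i ∈ Finset.range (N + 1), ∑ j ∈ Finset.range (N + 1), T i j =
      ∑ i ∈ Finset.range (N + 1), ∑ j ∈ Finset.range N, T i (j + 1) +
        ∑ i ∈ Finset.range (N + 1), T i 0 := by
    rw [← Finset.sum_add_distrib]
    exact Finset.sum_congr rfl fun i _ => Finset.sum_range_succ' _ _
  have e5 : ⟪α 0, jetOp N A β⟫_ℂ = ∑ j ∈ Finset.range (N + 1), T 0 j := by
    simp [jetOp, hT]
  have e6 : ⟪jetOp N A α, β 0⟫_ℂ = -∑ i ∈ Finset.range (N + 1), T i 0 := by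
    rw [jetOp, sum_inner, ← Finset.sum_neg_distrib]
    refine Finset.sum_congr rfl fun i _ => ?_
    rw [hA, hT]
    simp [pow_succ]
  rw [e1, e2, e5, e6]
  linear_combination e3 - e4

/-- For fixed i the inner sum over j is the (i+1)-st kernel equation of e. The symmetry of the A_k
gives the same in the left slot. -/
theorem concomitant_eq_zero_right (hA0 : ∀ k, N < k → A k = 0) {e : ℕ → E}
    (he : ∀ i, 1 ≤ i → ∑ j ∈ Finset.range (N + 1), A (i + j) (e j) = 0) (α : ℕ → E) :
    concomitant N A α e = 0 := by
  refine Finset.sum_eq_zero fun i _ => ?_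
  rw [← Finset.mul_sum, ← inner_sum]
  have := he (i + 1) (by omega)
  rw [Finset.sum_range_succ, hA0 _ (by omega), LinearMap.zero_apply, add_zero] at this
  simp only [show ∀ j, i + j + 1 = i + 1 + j by intro j; ring]
  rw [this, inner_zero_right, mul_zero]

theorem concomitant_eq_zero_left (hA0 : ∀ k, N < k → A k = 0)
    (hA : ∀ k u v, ⟪A k u, v⟫_ℂ = (-1 : ℂ) ^ (k + 1) * ⟪u, A k v⟫_ℂ) {e : ℕ → E}
    (he : ∀ i, 1 ≤ i → ∑ j ∈ Finset.range (N + 1), A (i + j) (e j) = 0) (β : ℕ → E) :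
    concomitant N A e β = 0 := by
  rw [concomitant, Finset.sum_comm]
  refine Finset.sum_eq_zero fun j _ => ?_
  have h1 : ∀ i, (-1 : ℂ) ^ i * ⟪e i, A (i + j + 1) (β j)⟫_ℂ =
      (-1 : ℂ) ^ j * ⟪A (j + 1 + i) (e i), β j⟫_ℂ := by
    intro i
    rw [hA, show j + 1 + i = i + j + 1 by ring, ← mul_assoc, ← pow_add,
      show j + (i + j + 1 + 1) = i + 2 * (j + 1) by ring, pow_add, pow_mul]
    simp
  simp only [h1]
  rw [← Finset.mul_sum, ← sum_inner]
  have := he (j + 1) (by omega)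
  rw [Finset.sum_range_succ, hA0 _ (by omega), LinearMap.zero_apply, add_zero] at this
  rw [this, inner_zero_left, mul_zero]

/-- Product rule for the concomitant of two weak jets `η`, `ν` of `x`, `v`, whose formal
derivatives are `η'`, `ν'`. -/
theorem concomitant_product_rule (hA0 : ∀ k, N < k → A k = 0)
    (hA : ∀ k u v, ⟪A k u, v⟫_ℂ = (-1 : ℂ) ^ (k + 1) * ⟪u, A k v⟫_ℂ)
    {η η' ν ν' : ℕ → E} {x v z y : E}
    (hη : ∀ i, 1 ≤ i → i ≤ N → ∑ j ∈ Finset.range N, A (i + 1 + j) (η' j) =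
      ∑ j ∈ Finset.range (N + 1), A (i + j) (η j) - A i x)
    (hz : z = A 0 x + ∑ j ∈ Finset.range N, A (j + 1) (η' j))
    (hν : ∀ i, 1 ≤ i → i ≤ N → ∑ j ∈ Finset.range N, A (i + 1 + j) (ν' j) =
      ∑ j ∈ Finset.range (N + 1), A (i + j) (ν j) - A i v)
    (hy : y = A 0 v + ∑ j ∈ Finset.range N, A (j + 1) (ν' j)) :
    concomitant N A η' ν + concomitant N A η ν' = ⟪z, v⟫_ℂ + ⟪x, y⟫_ℂ := by
  -- For a true jet one has x = η₀ and η'ⱼ = η_{j+1}. The errors e₀ = η₀ - x and e_{j+1} = η_{j+1} -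
  -- η'ⱼ satisfy the homogeneous equations for i ≥ 1, so the concomitant does not see e; the
  -- equation for z involves `jetOp` of e, which `concomitant_shift` accounts for.
  have main : ∀ {η η' : ℕ → E} {x z : E},
      (∀ i, 1 ≤ i → i ≤ N → ∑ j ∈ Finset.range N, A (i + 1 + j) (η' j) =
        ∑ j ∈ Finset.range (N + 1), A (i + j) (η j) - A i x) →
      z = A 0 x + ∑ j ∈ Finset.range N, A (j + 1) (η' j) →
      ∃ e : ℕ → E, (∀ i, 1 ≤ i → ∑ j ∈ Finset.range (N + 1), A (i + j) (e j) = 0) ∧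
        (∀ j, η' j = η (j + 1) - e (j + 1)) ∧ x = η 0 - e 0 ∧ z = jetOp N A η - jetOp N A e := by
    intro η η' x z hη hz
    let e : ℕ → E := fun j => Nat.casesOn j (η 0 - x) fun j => η (j + 1) - η' j
    have e0 : e 0 = η 0 - x := rfl
    have eS : ∀ j, e (j + 1) = η (j + 1) - η' j := fun _ => rfl
    have split : ∀ (i : ℕ) (g : ℕ → E), ∑ j ∈ Finset.range (N + 1), A (i + j) (g j) =
        ∑ j ∈ Finset.range N, A (i + 1 + j) (g (j + 1)) + A i (g 0) := by
      intro i g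
      rw [Finset.sum_range_succ', add_zero]
      congr 1
      exact Finset.sum_congr rfl fun j _ => by rw [add_right_comm, add_assoc]
    refine ⟨e, fun i hi => ?_, fun j => ?_, ?_, ?_⟩
    · rcases le_or_gt i N with hN | hN
      · have h1 := hη i hi hN
        rw [split i η] at h1
        rw [split i e, e0]
        simp only [eS, map_sub, Finset.sum_sub_distrib]
        rw [h1]
        abel
      · exact Finset.sum_eq_zero fun j _ => by rw [hA0 _ (by omega), LinearMap.zero_apply]
    · rw [eS]; abel
    · rw [e0]; abel
    · simp only [jetOp]
      rw [Finset.sum_range_succ', Finset.sum_range_succ', hz, e0]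
      simp only [eS, map_sub, Finset.sum_sub_distrib]
      abel
  obtain ⟨e, he, h1, rfl, rfl⟩ := main hη hz
  obtain ⟨f, hf, k1, rfl, rfl⟩ := main hν hy
  obtain rfl : η' = fun j => η (j + 1) - e (j + 1) := funext h1
  obtain rfl : ν' = fun j => ν (j + 1) - f (j + 1) := funext k1
  rw [concomitant_sub_left (fun j => η (j + 1)) (fun j => e (j + 1)),
    concomitant_sub_right η (fun j => ν (j + 1)) (fun j => f (j + 1))]
  have i1 := concomitant_shift hA0 hA η ν
  have i2 := concomitant_shift hA0 hA e ν
  have i3 := concomitant_shift hA0 hA η f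
  have i4 := concomitant_shift hA0 hA e f
  rw [concomitant_eq_zero_left hA0 hA he] at i2 i4
  rw [concomitant_eq_zero_right hA0 hf] at i3 i4
  simp only [inner_sub_left, inner_sub_right]
  linear_combination i1 - i2 - i3 + i4

end Concomitant

/-! ## Stacked vectors -/

section Stack

variable {n N : ℕ}

/-- The vector `(w₀, …, w_{N-1})`. -/
def stack (N : ℕ) (w : ℕ → EuclideanSpace ℂ (Fin n)) : EuclideanSpace ℂ (Fin N × Fin n) :=
  WithLp.toLp 2 fun p => w p.1 p.2

/-- The `j`-th block of a stacked vector, and zero for `j ≥ N`. -/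
def block (u : EuclideanSpace ℂ (Fin N × Fin n)) (j : ℕ) : EuclideanSpace ℂ (Fin n) :=
  WithLp.toLp 2 fun l => if h : j < N then u (⟨j, h⟩, l) else 0

theorem stack_apply (w : ℕ → EuclideanSpace ℂ (Fin n)) (p : Fin N × Fin n) :
    stack N w p = w p.1 p.2 := rfl

theorem stack_block (u : EuclideanSpace ℂ (Fin N × Fin n)) : stack N (block u) = u := by
  ext p
  simp [stack, block]

theorem block_stack (w : ℕ → EuclideanSpace ℂ (Fin n)) {j : ℕ} (hj : j < N) :
    block (stack N w) j = w j := by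
  ext l
  simp [stack, block, hj]

theorem inner_stack (α β : ℕ → EuclideanSpace ℂ (Fin n)) :
    ⟪stack N α, stack N β⟫_ℂ = ∑ i ∈ Finset.range N, ⟪α i, β i⟫_ℂ := by
  rw [PiLp.inner_apply, Fintype.sum_prod_type, Finset.sum_range]
  refine Finset.sum_congr rfl fun i _ => ?_
  rw [PiLp.inner_apply]
  rfl

/-- The coefficient `J_k` as an operator, and zero for `k > N`. -/
def coeffOp (N : ℕ) (J : ℕ → Matrix (Fin n) (Fin n) ℂ) (k : ℕ) :
    EuclideanSpace ℂ (Fin n) →ₗ[ℂ] EuclideanSpace ℂ (Fin n) :=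
  if k ≤ N then matAct (J k) else 0

variable {J : ℕ → Matrix (Fin n) (Fin n) ℂ}

theorem coeffOp_of_le {k : ℕ} (hk : k ≤ N) : coeffOp N J k = matAct (J k) := if_pos hk

theorem coeffOp_of_lt {k : ℕ} (hk : N < k) : coeffOp N J k = 0 := if_neg hk.not_ge

theorem inner_coeffOp (hJ : ∀ k ≤ N, J k = (-1 : ℂ) ^ (k + 1) • (J k)ᴴ) (k : ℕ)
    (u v : EuclideanSpace ℂ (Fin n)) :
    ⟪coeffOp N J k u, v⟫_ℂ = (-1 : ℂ) ^ (k + 1) * ⟪u, coeffOp N J k v⟫_ℂ := by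
  rcases le_or_gt k N with h | h
  · rw [coeffOp_of_le h, inner_matAct_left]
    have h1 : (J k)ᴴ = (-1 : ℂ) ^ (k + 1) • J k := by
      conv_rhs => rw [hJ k h]
      rw [smul_smul, ← mul_pow]
      simp
    have h2 : matAct (J k)ᴴ v = (-1 : ℂ) ^ (k + 1) • matAct (J k) v := by
      rw [h1, matAct, map_smul, LinearMap.smul_apply]
    rw [h2, inner_smul_right]
  · simp [coeffOp_of_lt h]

theorem matAct_boundaryMatrix_stack (β : ℕ → EuclideanSpace ℂ (Fin n)) :
    matAct (boundaryMatrix N J) (stack N β) =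
      stack N fun i => (-1 : ℂ) ^ i • ∑ j ∈ Finset.range N, coeffOp N J (i + j + 1) (β j) := by
  ext ⟨i, l⟩
  have h1 : ∀ j : ℕ, coeffOp N J (i + j + 1) (β j) l =
      ∑ m, (if (i : ℕ) + j + 1 ≤ N then J (i + j + 1) l m else 0) * β j m := by
    intro j
    rw [coeffOp]
    split_ifs with h
    · simp [matAct, Matrix.toLpLin_apply, Matrix.mulVec, dotProduct]
    · simp
  rw [stack_apply, matAct, Matrix.toLpLin_apply]
  simp only [Matrix.mulVec, dotProduct, PiLp.smul_apply, WithLp.ofLp_sum, Finset.sum_apply,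
    smul_eq_mul, h1]
  rw [Fintype.sum_prod_type, Finset.sum_range, Finset.mul_sum]
  refine Finset.sum_congr rfl fun j _ => ?_
  rw [Finset.mul_sum]
  refine Finset.sum_congr rfl fun m _ => ?_
  rw [stack_apply, boundaryMatrix, Matrix.of_apply]
  split_ifs <;> simp [mul_assoc]

theorem inner_boundaryMatrix (α β : EuclideanSpace ℂ (Fin N × Fin n)) :
    ⟪α, matAct (boundaryMatrix N J) β⟫_ℂ = concomitant N (coeffOp N J) (block α) (block β) := by
  conv_lhs => rw [← stack_block α, ← stack_block β]
  rw [matAct_boundaryMatrix_stack, inner_stack, concomitant]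
  refine Finset.sum_congr rfl fun i _ => ?_
  rw [inner_smul_right, inner_sum, Finset.mul_sum]

end Stack

/-! ## The maximal operator in terms of chains -/

section Maximal

variable {a b : ℝ} {n N : ℕ} {J : ℕ → Matrix (Fin n) (Fin n) ℂ}

/-- The complex inner product as a real bilinear map. -/
def innerReal (E : Type*) [NormedAddCommGroup E] [InnerProductSpace ℂ E] : E →L[ℝ] E →L[ℝ] ℂ :=
  (isBoundedBilinearMap_inner (𝕜 := ℂ) (E := E)).toContinuousLinearMap

theorem innerReal_apply {E : Type*} [NormedAddCommGroup E] [InnerProductSpace ℂ E] (u v : E) :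
    innerReal E u v = ⟪u, v⟫_ℂ := rfl

/-- A matrix as a continuous real linear map. -/
def realCLM {V W : Type*} [NormedAddCommGroup V] [InnerProductSpace ℂ V] [FiniteDimensional ℂ V]
    [NormedAddCommGroup W] [InnerProductSpace ℂ W] (L : V →ₗ[ℂ] W) : V →L[ℝ] W :=
  (LinearMap.toContinuousLinearMap L).restrictScalars ℝ

theorem realCLM_apply {V W : Type*} [NormedAddCommGroup V] [InnerProductSpace ℂ V]
    [FiniteDimensional ℂ V] [NormedAddCommGroup W] [InnerProductSpace ℂ W] (L : V →ₗ[ℂ] W) (v : V) :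
    realCLM L v = L v := rfl

theorem integrableOn_L2Space (x : L2Space a b n) : IntegrableOn x (Ioo a b) :=
  (Lp.memLp x).integrable one_le_two

theorem integrableOn_coeffOp {x : ℝ → EuclideanSpace ℂ (Fin n)} (hx : IntegrableOn x (Ioo a b))
    (k : ℕ) : IntegrableOn (fun t => coeffOp N J k (x t)) (Ioo a b) :=
  (realCLM (coeffOp N J k)).integrable_comp hx

theorem inner_testToL2 (φ : TestFun a b n) (z : L2Space a b n) :
    ⟪testToL2 a b n φ, z⟫_ℂ =
      ∫ t in Ioo a b, ⟪(φ : ℝ → EuclideanSpace ℂ (Fin n)) t, z t⟫_ℂ := by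
  rw [L2.inner_def]
  refine integral_congr_ae ?_
  filter_upwards [(testFun_memLp φ).coeFn_toLp] with t ht
  rw [show testToL2 a b n φ = (testFun_memLp φ).toLp _ from rfl, ht]

/-- The element of the domain of the minimal operator given by a test function. -/
def minimalElem (N : ℕ) (J : ℕ → Matrix (Fin n) (Fin n) ℂ) (φ : TestFun a b n) :
    (minimalOp a b N J).domain :=
  ⟨testToL2 a b n φ, φ, rfl⟩

theorem minimalElem_surjective (x : (minimalOp a b N J).domain) : ∃ φ, minimalElem N J φ = x := by
  obtain ⟨x, φ, rfl⟩ := x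
  exact ⟨φ, rfl⟩

theorem minimalOp_apply (φ : TestFun a b n) :
    minimalOp a b N J (minimalElem N J φ) = testToL2 a b n
      (∑ k ∈ Finset.range (N + 1), (-1 : ℂ) ^ k • testDiff a b k (J k)ᴴ φ) := by
  change testToL2 a b n ((∑ k ∈ Finset.range (N + 1), (-1 : ℂ) ^ k • testDiff a b k (J k)ᴴ)
    ((LinearEquiv.ofInjective (testToL2 a b n) (testToL2_injective a b n)).symm
      (LinearEquiv.ofInjective (testToL2 a b n) (testToL2_injective a b n) φ))) = _
  rw [LinearEquiv.symm_apply_apply]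
  simp [LinearMap.sum_apply]

theorem mem_testFunctions_of_testFun (φ : TestFun a b n) :
    (φ : ℝ → EuclideanSpace ℂ (Fin n)) ∈ testFunctions a b (EuclideanSpace ℂ (Fin n)) ℝ := φ.2

theorem inner_minimalOp (φ : TestFun a b n) (x : L2Space a b n) :
    ⟪minimalOp a b N J (minimalElem N J φ), x⟫_ℂ =
      ∑ k ∈ Finset.range (N + 1), (-1 : ℝ) ^ k • ∫ t in Ioo a b,
        ⟪iteratedDeriv k (φ : ℝ → EuclideanSpace ℂ (Fin n)) t, coeffOp N J k (x t)⟫_ℂ := by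
  rw [minimalOp_apply, map_sum, sum_inner]
  refine Finset.sum_congr rfl fun k hk => ?_
  have hkN : k ≤ N := by have := Finset.mem_range.1 hk; omega
  rw [map_smul, inner_smul_left, inner_testToL2]
  have h1 : (starRingEnd ℂ) ((-1 : ℂ) ^ k) = (((-1 : ℝ) ^ k : ℝ) : ℂ) := by simp
  rw [h1, ← smul_eq_mul, Complex.coe_smul]
  congr 1
  refine integral_congr_ae (Filter.Eventually.of_forall fun t => ?_)
  change ⟪matAct (J k)ᴴ (iteratedDeriv k (φ : ℝ → EuclideanSpace ℂ (Fin n)) t), x t⟫_ℂ = _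
  rw [inner_matAct_left, Matrix.conjTranspose_conjTranspose, coeffOp_of_le hkN]

/-- The product of a scalar test function and a vector. -/
def scalarTest {φ : ℝ → ℝ} (hφ : φ ∈ testFunctions a b ℝ ℝ) (v : EuclideanSpace ℂ (Fin n)) :
    TestFun a b n :=
  ⟨fun t => φ t • v, hφ.1.smul contDiff_const, hφ.2.1.smul_right,
    (tsupport_smul_subset_left φ fun _ => v).trans hφ.2.2⟩

theorem iteratedDeriv_scalarTest {φ : ℝ → ℝ} (hφ : φ ∈ testFunctions a b ℝ ℝ)
    (v : EuclideanSpace ℂ (Fin n)) (k : ℕ) (t : ℝ) :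
    iteratedDeriv k (scalarTest hφ v : ℝ → EuclideanSpace ℂ (Fin n)) t =
      iteratedDeriv k φ t • v :=
  iteratedDeriv_smul_const (hφ.1.contDiffAt.of_le (by exact_mod_cast le_top)) v

theorem integral_inner_smul {φ : ℝ → ℝ} (hφ : Continuous φ) {f : ℝ → EuclideanSpace ℂ (Fin n)}
    (hf : IntegrableOn f (Ioo a b)) (v : EuclideanSpace ℂ (Fin n)) :
    ∫ t in Ioo a b, ⟪φ t • v, f t⟫_ℂ = ⟪v, ∫ t in Ioo a b, φ t • f t⟫_ℂ := by
  rw [← integral_inner (integrableOn_smul hφ hf)]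
  refine integral_congr_ae (Filter.Eventually.of_forall fun t => ?_)
  beta_reduce
  rw [← Complex.coe_smul (φ t) v, ← Complex.coe_smul (φ t) (f t), inner_smul_left,
    inner_smul_right, Complex.conj_ofReal]

theorem dense_minimalOp_domain : Dense ((minimalOp a b N J).domain : Set (L2Space a b n)) := by
  rw [Submodule.dense_iff_topologicalClosure_eq_top, Submodule.topologicalClosure_eq_top_iff,
    Submodule.eq_bot_iff]
  intro y hy
  have h1 : (y : ℝ → EuclideanSpace ℂ (Fin n)) =ᵐ[volume.restrict (Ioo a b)] fun _ => 0 := by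
    refine ae_eq_of_integral_test_eq (integrableOn_L2Space y) integrableOn_zero fun φ hφ => ?_
    simp only [smul_zero, integral_zero]
    refine ext_inner_left ℂ fun v => ?_
    rw [inner_zero_right, ← integral_inner_smul hφ.1.continuous (integrableOn_L2Space y)]
    have := hy _ (minimalElem N J (scalarTest hφ v)).2
    rw [minimalElem, inner_testToL2] at this
    exact this
  exact (Lp.eq_zero_iff_ae_eq_zero).2 h1

/-- `x` lies in the domain of the maximal operator, with value `z`. -/
def MaximalRel (N : ℕ) (J : ℕ → Matrix (Fin n) (Fin n) ℂ) (x z : L2Space a b n) : Prop :=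
  ∃ hx : x ∈ (maximalOp a b N J).domain, maximalOp a b N J ⟨x, hx⟩ = z

theorem maximalRel_iff {x z : L2Space a b n} : MaximalRel N J x z ↔
    ∀ φ : TestFun a b n, ⟪testToL2 a b n φ, z⟫_ℂ =
      ⟪minimalOp a b N J (minimalElem N J φ), x⟫_ℂ := by
  rw [MaximalRel, mem_graph_adjoint_iff dense_minimalOp_domain]
  constructor
  · intro h φ
    rw [← inner_conj_symm, ← inner_conj_symm _ x]
    exact congrArg _ (h (minimalElem N J φ))
  · intro h x'
    obtain ⟨φ, rfl⟩ := minimalElem_surjective x'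
    rw [← inner_conj_symm, ← inner_conj_symm x]
    exact congrArg _ (h φ)

/-- A chain for the weak equation `∑ Aₖ x⁽ᵏ⁾ = z`. -/
structure IsJetChain (a b : ℝ) (N : ℕ) (J : ℕ → Matrix (Fin n) (Fin n) ℂ)
    (x z : ℝ → EuclideanSpace ℂ (Fin n)) (w : ℕ → ℝ → EuclideanSpace ℂ (Fin n)) : Prop where
  chain : IsPrimitiveChain a b N (fun k t => coeffOp N J k (x t)) w
  bot : w 0 =ᵐ[volume.restrict (Ioo a b)] z

/-- Test functions φ(t)v with v arbitrary reduce the adjoint relation to a vector-valued weak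
equation against scalar φ; moving J_kᴴ across the inner product gives the coefficients J_k. -/
theorem MaximalRel.exists_chain (hab : a < b) {x z : L2Space a b n} (h : MaximalRel N J x z) :
    ∃ w, IsJetChain a b N J x z w := by
  have hx := integrableOn_L2Space x
  have hz := integrableOn_L2Space z
  obtain ⟨w, h0, hw⟩ := exists_isPrimitiveChain hab (N := N)
    (f := fun k t => coeffOp N J k (x t)) (z := z)
    (fun k _ => integrableOn_coeffOp hx k) hz (by
      intro φ hφ
      refine ext_inner_left ℂ fun v => ?_
      have h1 := (maximalRel_iff.1 h) (scalarTest hφ v)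
      rw [inner_testToL2, inner_minimalOp] at h1
      have h2 : ∫ t in Ioo a b, ⟪(scalarTest hφ v : ℝ → EuclideanSpace ℂ (Fin n)) t, z t⟫_ℂ =
          ⟪v, ∫ t in Ioo a b, φ t • z t⟫_ℂ := integral_inner_smul hφ.1.continuous hz v
      rw [h2] at h1
      rw [h1, inner_sum]
      refine Finset.sum_congr rfl fun k _ => ?_
      simp only [iteratedDeriv_scalarTest]
      rw [integral_inner_smul (continuous_testFunctions (iteratedDeriv_mem_testFunctions hφ k))
        (integrableOn_coeffOp hx k), ← Complex.coe_smul, ← Complex.coe_smul, inner_smul_right,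
        smul_eq_mul])
  exact ⟨w, hw, by rw [h0]⟩

theorem IsJetChain.maximalRel (hab : a < b) {x z : L2Space a b n}
    {w : ℕ → ℝ → EuclideanSpace ℂ (Fin n)} (h : IsJetChain a b N J x z w) : MaximalRel N J x z := by
  rw [maximalRel_iff]
  intro φ
  have h1 := h.chain.integral_test hab.le (innerReal (EuclideanSpace ℂ (Fin n)))
    (fun k _ => integrableOn_coeffOp (integrableOn_L2Space x) k) (mem_testFunctions_of_testFun φ)
  simp only [innerReal_apply] at h1
  rw [inner_testToL2, inner_minimalOp, ← h1]
  refine integral_congr_ae ?_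
  filter_upwards [h.bot] with t ht
  rw [ht]

end Maximal

/-! ## Sobolev functions -/

section Sobolev

variable {a b : ℝ} {n N : ℕ} {J : ℕ → Matrix (Fin n) (Fin n) ℂ}

/-- `D_{j+1}` is the derivative of `D_j` for `j < N`. -/
def IsDerivChain {V : Type*} [NormedAddCommGroup V] [NormedSpace ℝ V] (a b : ℝ) (N : ℕ)
    (D : ℕ → ℝ → V) : Prop :=
  ∀ j < N, IsPrimitive a b (D j) (D (j + 1))

/-- Differentiating ∑ J_{i+1+j} x⁽ʲ⁾ gives ∑ J_{i+j} x⁽ʲ⁾ without its term j = 0, and at i = N only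
j = 0 survives. -/
theorem IsDerivChain.isPrimitiveChain {D : ℕ → ℝ → EuclideanSpace ℂ (Fin n)}
    (hD : IsDerivChain a b N D) :
    IsPrimitiveChain a b N (fun k t => coeffOp N J k (D 0 t))
      (fun i t => ∑ j ∈ Finset.range (N + 1), coeffOp N J (i + j) (D j t)) := by
  refine ⟨fun i hi => ?_, Filter.Eventually.of_forall fun t => ?_⟩
  · have h1 : (fun t => ∑ j ∈ Finset.range (N + 1), coeffOp N J (i + 1 + j) (D j t)) =
        fun t => ∑ j ∈ Finset.range N, coeffOp N J (i + 1 + j) (D j t) := by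
      funext t
      rw [Finset.sum_range_succ, coeffOp_of_lt (by omega), LinearMap.zero_apply, add_zero]
    have h2 : (fun t => ∑ j ∈ Finset.range (N + 1), coeffOp N J (i + j) (D j t) -
        coeffOp N J i (D 0 t)) =
        fun t => ∑ j ∈ Finset.range N, coeffOp N J (i + 1 + j) (D (j + 1) t) := by
      funext t
      rw [Finset.sum_range_succ', add_zero, add_sub_cancel_right]
      exact Finset.sum_congr rfl fun j _ => by rw [add_right_comm, add_assoc]
    rw [h1, h2]
    refine IsPrimitive.sum _ fun j hj => ?_
    exact (hD j (Finset.mem_range.1 hj)).clm (realCLM (coeffOp N J (i + 1 + j)))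
  · change ∑ j ∈ Finset.range (N + 1), coeffOp N J (N + j) (D j t) = coeffOp N J N (D 0 t)
    rw [Finset.sum_eq_single 0]
    · simp
    · intro j _ hj
      rw [coeffOp_of_lt (by omega), LinearMap.zero_apply]
    · simp

theorem IsDerivChain.isJetChain (hab : a ≤ b) {D : ℕ → ℝ → EuclideanSpace ℂ (Fin n)}
    (hD : IsDerivChain a b N D) {x z : ℝ → EuclideanSpace ℂ (Fin n)}
    (hx : D 0 =ᵐ[volume.restrict (Ioo a b)] x)
    (hz : (fun t => ∑ j ∈ Finset.range (N + 1), coeffOp N J j (D j t))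
      =ᵐ[volume.restrict (Ioo a b)] z) :
    IsJetChain a b N J x z
      (fun i t => ∑ j ∈ Finset.range (N + 1), coeffOp N J (i + j) (D j t)) := by
  have h := hD.isPrimitiveChain (J := J)
  refine ⟨⟨fun i hi => (h.prim i hi).congr_ae hab ?_, h.top.trans ?_⟩, ?_⟩
  · filter_upwards [hx] with t ht
    rw [ht]
  · filter_upwards [hx] with t ht
    rw [ht]
  · simpa using hz

theorem IsDerivChain.integral_test {V : Type*} [NormedAddCommGroup V] [NormedSpace ℝ V]
    [CompleteSpace V] (hab : a ≤ b) {D : ℕ → ℝ → V} (hD : IsDerivChain a b N D) {k : ℕ}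
    (hk : k ≤ N) {φ : ℝ → ℝ} (hφ : φ ∈ testFunctions a b ℝ ℝ) :
    ∫ t in Ioo a b, iteratedDeriv k φ t • D 0 t =
      (-1 : ℝ) ^ k • ∫ t in Ioo a b, φ t • D k t := by
  induction k generalizing φ with
  | zero => simp
  | succ k ih =>
    have h1 := (hD k (by omega)).integral_deriv_test hab (ContinuousLinearMap.lsmul ℝ ℝ) hφ
    simp only [ContinuousLinearMap.lsmul_apply] at h1
    rw [iteratedDeriv_succ', ih (by omega) (deriv_mem_testFunctions hφ), h1, pow_succ]
    simp

theorem IsDerivChain.hasWeakDeriv (hab : a ≤ b) {D : ℕ → ℝ → EuclideanSpace ℂ (Fin n)}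
    (hD : IsDerivChain a b N D) {f g : L2Space a b n} {k : ℕ} (hk : k ≤ N)
    (hf : D 0 =ᵐ[volume.restrict (Ioo a b)] f) (hg : D k =ᵐ[volume.restrict (Ioo a b)] g) :
    HasWeakDeriv a b k f g := by
  intro φ hφ
  have h1 : ∫ x in Ioo a b, iteratedDeriv k φ x • f x =
      ∫ x in Ioo a b, iteratedDeriv k φ x • D 0 x := by
    refine integral_congr_ae ?_
    filter_upwards [hf] with t ht
    rw [ht]
  have h2 : ∫ x in Ioo a b, φ x • g x = ∫ x in Ioo a b, φ x • D k x := by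
    refine integral_congr_ae ?_
    filter_upwards [hg] with t ht
    rw [ht]
  rw [h1, h2, hD.integral_test hab hk hφ]

theorem HasWeakDeriv.unique {k : ℕ} {f g g' : L2Space a b n} (h : HasWeakDeriv a b k f g)
    (h' : HasWeakDeriv a b k f g') : g = g' := by
  refine Lp.ext (ae_eq_of_integral_test_eq (integrableOn_L2Space g) (integrableOn_L2Space g')
    fun φ hφ => ?_)
  have h1 := (h φ hφ).symm.trans (h' φ hφ)
  exact smul_right_injective _ (pow_ne_zero k (by norm_num : (-1 : ℝ) ≠ 0)) h1

theorem weakDeriv_eq {k : ℕ} {f g : L2Space a b n} (h : HasWeakDeriv a b k f g) :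
    weakDeriv a b k f = g := by
  have hex : ∃ g, HasWeakDeriv a b k f g := ⟨g, h⟩
  rw [weakDeriv, dif_pos hex]
  exact hex.choose_spec.unique h

theorem eqOn_Icc_of_ae_eq_Ioo {V : Type*} [NormedAddCommGroup V] (hab : a < b) {u v : ℝ → V}
    (hu : ContinuousOn u (Icc a b)) (hv : ContinuousOn v (Icc a b))
    (h : u =ᵐ[volume.restrict (Ioo a b)] v) : EqOn u v (Icc a b) := by
  refine Measure.eqOn_Icc_of_ae_eq volume hab.ne ?_ hu hv
  rwa [← Measure.restrict_congr_set Ioo_ae_eq_Icc]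

theorem contRep_eqOn (hab : a < b) {f : L2Space a b n} {u : ℝ → EuclideanSpace ℂ (Fin n)}
    (hu : ContinuousOn u (Icc a b)) (h : u =ᵐ[volume.restrict (Ioo a b)] f) :
    EqOn (contRep a b f) u (Icc a b) := by
  have hex : ∃ u : ℝ → EuclideanSpace ℂ (Fin n),
      ContinuousOn u (Icc a b) ∧ u =ᵐ[volume.restrict (Ioo a b)] f := ⟨u, hu, h⟩
  rw [contRep, dif_pos hex]
  exact eqOn_Icc_of_ae_eq_Ioo hab hex.choose_spec.1 hu (hex.choose_spec.2.trans h.symm)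

/-- The weak derivative of order N is itself a weak equation, whose only coefficient function is f,
at k = N. Its chain, read backwards, consists of the derivatives of f. -/
theorem MemSobolev.exists_derivChain (hab : a < b) {f : L2Space a b n} (hf : MemSobolev a b N f) :
    ∃ D, IsDerivChain a b N D ∧ D 0 =ᵐ[volume.restrict (Ioo a b)] f := by
  obtain ⟨g, hg⟩ := hf N le_rfl
  let F : ℕ → ℝ → EuclideanSpace ℂ (Fin n) := fun k => if k = N then f else fun _ => 0
  have hFi : ∀ k ≤ N, IntegrableOn (F k) (Ioo a b) := by
    intro k _
    simp only [F]
    split_ifs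
    · exact integrableOn_L2Space f
    · exact integrableOn_zero
  obtain ⟨w, -, hw⟩ := exists_isPrimitiveChain hab hFi (integrableOn_L2Space g) (by
    intro φ hφ
    rw [Finset.sum_eq_single N]
    · simp only [F, if_true]
      rw [hg φ hφ, smul_smul, ← mul_pow]
      simp
    · intro k _ hk
      simp [F, hk]
    · simp)
  refine ⟨fun j => w (N - j), fun j hj => ?_, ?_⟩
  · have h1 := hw.prim (N - (j + 1)) (by omega)
    simp only [F, if_neg (show N - (j + 1) ≠ N by omega), sub_zero] at h1
    rwa [show N - (j + 1) + 1 = N - j by omega] at h1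
  · have := hw.top
    simpa [F] using this

/-- Weak derivatives and continuous representatives are unique, so the choices made in `weakDeriv`
and `contRep` do not matter. -/
theorem pointTrace_eq (hab : a < b) {f : L2Space a b n} (hf : MemSobolev a b N f)
    {D : ℕ → ℝ → EuclideanSpace ℂ (Fin n)} (hD : IsDerivChain a b N D)
    (h0 : D 0 =ᵐ[volume.restrict (Ioo a b)] f) {ξ : ℝ} (hξ : ξ ∈ Icc a b) :
    pointTrace a b N ξ f = stack N fun j => D j ξ := by
  ext ⟨j, l⟩
  change contRep a b (weakDeriv a b j f) ξ l = D j ξ l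
  obtain ⟨g, hg⟩ := hf j j.2.le
  rw [weakDeriv_eq hg]
  have hc : ContinuousOn (D j) (Icc a b) := (hD j j.2).continuousOn hab.le
  have hDg : D j =ᵐ[volume.restrict (Ioo a b)] g := by
    have hi : IntegrableOn (D j) (Ioo a b) :=
      hc.integrableOn_Icc.mono_set Ioo_subset_Icc_self
    refine ae_eq_of_integral_test_eq hi (integrableOn_L2Space g) fun φ hφ => ?_
    have h1 := hg φ hφ
    have h2 : ∫ x in Ioo a b, iteratedDeriv j φ x • f x =
        ∫ x in Ioo a b, iteratedDeriv j φ x • D 0 x := by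
      refine integral_congr_ae ?_
      filter_upwards [h0] with t ht
      rw [ht]
    rw [h2, hD.integral_test hab.le j.2.le hφ] at h1
    exact smul_right_injective _ (pow_ne_zero (j : ℕ) (by norm_num : (-1 : ℝ) ≠ 0)) h1
  rw [contRep_eqOn hab hc hDg hξ]

end Sobolev

/-! ## Smooth functions with prescribed jets -/

section Smooth

variable {V : Type*} [NormedAddCommGroup V] [NormedSpace ℝ V]

/-- A Taylor polynomial at ξ times a bump function that equals 1 near ξ. -/
theorem exists_contDiff_jet (ξ : ℝ) (N : ℕ) (α : ℕ → V) {ε : ℝ} (hε : 0 < ε) :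
    ∃ p : ℝ → V, ContDiff ℝ ∞ p ∧ (∀ j < N, iteratedDeriv j p ξ = α j) ∧
      ∀ t, ε ≤ |t - ξ| → p t = 0 := by
  let β : ContDiffBump ξ := ⟨ε / 2, ε, by linarith, by linarith⟩
  let q : ℝ → V := fun t => ∑ i ∈ Finset.range N, ((t - ξ) ^ i / (i.factorial : ℝ)) • α i
  have hm : ∀ i, ContDiff ℝ ∞ fun t : ℝ => (t - ξ) ^ i / (i.factorial : ℝ) := fun i => by fun_prop
  have hq : ContDiff ℝ ∞ q := ContDiff.sum fun i _ => (hm i).smul contDiff_const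
  refine ⟨fun t => β t • q t, β.contDiff.smul hq, fun j hj => ?_, fun t ht => ?_⟩
  · have h1 : (fun t => β t • q t) =ᶠ[nhds ξ] q := by
      filter_upwards [β.eventuallyEq_one] with t ht
      rw [ht, Pi.one_apply, one_smul]
    rw [h1.iteratedDeriv_eq]
    have h2 : ∀ i, iteratedDeriv j (fun t : ℝ => (t - ξ) ^ i / (i.factorial : ℝ)) ξ =
        if i = j then 1 else 0 := by
      intro i
      have h3 : (fun t : ℝ => (t - ξ) ^ i / (i.factorial : ℝ)) =
          (i.factorial : ℝ)⁻¹ • fun t : ℝ => (fun s : ℝ => s ^ i) (t - ξ) := by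
        funext t
        simp [div_eq_inv_mul]
      have h4 : iteratedDeriv j (fun t : ℝ => (fun s : ℝ => s ^ i) (t - ξ)) ξ =
          iteratedDeriv j (fun s : ℝ => s ^ i) (ξ - ξ) :=
        congrFun (iteratedDeriv_comp_sub_const j (fun s : ℝ => s ^ i) ξ) ξ
      rw [h3, iteratedDeriv_const_smul_field, h4]
      rw [sub_self, iteratedDeriv_pow]
      rcases lt_trichotomy i j with h | h | h
      · rw [Nat.descFactorial_eq_zero_iff_lt.2 h, if_neg h.ne]
        simp
      · subst h
        rw [Nat.descFactorial_self]
        simp [Nat.factorial_ne_zero]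
      · rw [zero_pow (by omega), if_neg h.ne']
        simp
    have h5 : iteratedDeriv j q ξ = ∑ i ∈ Finset.range N,
        iteratedDeriv j (fun t => ((t - ξ) ^ i / (i.factorial : ℝ)) • α i) ξ :=
      iteratedDeriv_fun_sum fun i _ =>
        ((hm i).smul contDiff_const).contDiffAt.of_le (by exact_mod_cast le_top)
    rw [h5]
    rw [Finset.sum_congr rfl fun i _ => by
      rw [iteratedDeriv_smul_const ((hm i).contDiffAt.of_le (by exact_mod_cast le_top)), h2 i]]
    simp [hj]
  · have : β t = 0 := β.zero_of_le_dist (by rw [Real.dist_eq]; exact ht)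
    beta_reduce
    rw [this, zero_smul]

theorem exists_contDiff_jets {a b : ℝ} (hab : a < b) (N : ℕ) (α β : ℕ → V) :
    ∃ p : ℝ → V, ContDiff ℝ ∞ p ∧ (∀ j < N, iteratedDeriv j p a = α j) ∧
      ∀ j < N, iteratedDeriv j p b = β j := by
  -- With half the length as radius, each of the two functions vanishes near the opposite endpoint,
  -- so the jets do not interfere.
  have hε : 0 < (b - a) / 2 := by linarith
  obtain ⟨p, hp, hpa, hp0⟩ := exists_contDiff_jet a N α hε
  obtain ⟨q, hq, hqb, hq0⟩ := exists_contDiff_jet b N β hε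
  have hz : ∀ {f : ℝ → V} {c : ℝ} (j : ℕ), f =ᶠ[nhds c] (fun _ => 0) → iteratedDeriv j f c = 0 := by
    intro f c j h
    rw [h.iteratedDeriv_eq]
    simp
  have hpb : ∀ j, iteratedDeriv j p b = 0 := fun j => hz j (by
    filter_upwards [Ioi_mem_nhds (show (a + b) / 2 < b by linarith)] with t ht
    refine hp0 t ?_
    have h1 : (a + b) / 2 < t := ht
    rw [abs_of_nonneg (by linarith)]
    linarith)
  have hqa : ∀ j, iteratedDeriv j q a = 0 := fun j => hz j (by
    filter_upwards [Iio_mem_nhds (show a < (a + b) / 2 by linarith)] with t ht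
    refine hq0 t ?_
    have h1 : t < (a + b) / 2 := ht
    rw [abs_of_nonpos (by linarith)]
    linarith)
  have hadd : ∀ j c, iteratedDeriv j (p + q) c = iteratedDeriv j p c + iteratedDeriv j q c :=
    fun j c => iteratedDeriv_add (hp.contDiffAt.of_le (by exact_mod_cast le_top))
      (hq.contDiffAt.of_le (by exact_mod_cast le_top))
  refine ⟨p + q, hp.add hq, fun j hj => ?_, fun j hj => ?_⟩
  · rw [hadd, hpa j hj, hqa, add_zero]
  · rw [hadd, hpb, hqb j hj, zero_add]

theorem isDerivChain_iteratedDeriv {a b : ℝ} [CompleteSpace V] {p : ℝ → V} (hp : ContDiff ℝ ∞ p)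
    (N : ℕ) : IsDerivChain a b N (fun j => iteratedDeriv j p) := by
  intro j _
  refine isPrimitive_of_hasDerivAt (fun t => ?_) (hp.continuous_iteratedDeriv (j + 1)
    (by exact_mod_cast le_top))
  change HasDerivAt (iteratedDeriv j p) (iteratedDeriv (j + 1) p t) t
  rw [iteratedDeriv_succ]
  exact ((hp.differentiable_iteratedDeriv j (by exact_mod_cast WithTop.coe_lt_top _)) t).hasDerivAt

end Smooth

/-! ## The reduced factorization -/

section Factorization

variable {ι : Type*} [Fintype ι] [DecidableEq ι] {Q : Matrix ι ι ℂ}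

namespace ReducedFactorization

/-- The inverse of the diagonal matrix of nonzero eigenvalues. -/
def Kinv (R : ReducedFactorization Q) : Matrix (Fin Q.rank) (Fin Q.rank) ℂ :=
  Matrix.diagonal fun i => ((R.eig i)⁻¹ : ℂ)

variable (R : ReducedFactorization Q)

theorem K_mul_Kinv : R.K * R.Kinv = 1 := by
  rw [K, Kinv, Matrix.diagonal_mul_diagonal, ← Matrix.diagonal_one]
  congr 1
  funext i
  exact mul_inv_cancel₀ (by exact_mod_cast R.eig_ne_zero i)

theorem Kinv_mul_K : R.Kinv * R.K = 1 := mul_eq_one_comm.1 R.K_mul_Kinv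

theorem conjTranspose_Kinv : R.Kinvᴴ = R.Kinv := by
  rw [Kinv, Matrix.diagonal_conjTranspose]
  congr 1
  funext i
  simp

theorem conjTranspose_S_mul : R.Sᴴ * Q = R.K * R.Sᴴ := by
  refine (congrArg (fun A => R.Sᴴ * A) R.factorization).trans ?_
  rw [← Matrix.mul_assoc, ← Matrix.mul_assoc, R.orthonormal, Matrix.one_mul]
  rfl

theorem proj_mul : R.S * R.Sᴴ * Q = Q := by
  rw [Matrix.mul_assoc, conjTranspose_S_mul, ← Matrix.mul_assoc]
  exact R.factorization.symm

/-- The pseudoinverse of `Q`. -/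
def pinv : Matrix ι ι ℂ := R.S * R.Kinv * R.Sᴴ

/-- Q Q⁺ is the orthogonal projection onto ran Q, so η = Q⁺q solves Qη = q whenever q lies in ran Q.
-/
theorem mul_pinv : Q * R.pinv = R.S * R.Sᴴ := by
  have h : Q * R.S = R.S * R.K := by
    refine (congrArg (fun A => A * R.S) R.factorization).trans ?_
    rw [Matrix.mul_assoc, R.orthonormal, Matrix.mul_one]
    rfl
  rw [pinv, ← Matrix.mul_assoc, ← Matrix.mul_assoc, h, Matrix.mul_assoc R.S, K_mul_Kinv,
    Matrix.mul_one]

theorem inner_pinv (u v : EuclideanSpace ℂ ι) :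
    ⟪matAct R.pinv u, v⟫_ℂ = ⟪matAct R.Kinv (matAct R.Sᴴ u), matAct R.Sᴴ v⟫_ℂ := by
  rw [pinv, matAct_mul, matAct_mul, inner_matAct_left]

theorem inner_Kinv_left (u v : EuclideanSpace ℂ (Fin Q.rank)) :
    ⟪matAct R.Kinv u, v⟫_ℂ = ⟪u, matAct R.Kinv v⟫_ℂ := by
  rw [inner_matAct_left, conjTranspose_Kinv]

end ReducedFactorization

end Factorization

/-! ## Stacked chains -/

section StackedChain

variable {a b : ℝ} {n N : ℕ} {J : ℕ → Matrix (Fin n) (Fin n) ℂ}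

/-- The embedding of the `i`-th block. -/
def stackEmb (N i : ℕ) : EuclideanSpace ℂ (Fin n) →ₗ[ℂ] EuclideanSpace ℂ (Fin N × Fin n) where
  toFun v := WithLp.toLp 2 fun p => if (p.1 : ℕ) = i then v p.2 else 0
  map_add' u v := by
    ext p
    by_cases h : (p.1 : ℕ) = i <;> simp [h]
  map_smul' c v := by
    ext p
    by_cases h : (p.1 : ℕ) = i <;> simp [h]

theorem stack_eq_sum (w : ℕ → EuclideanSpace ℂ (Fin n)) :
    stack N w = ∑ i ∈ Finset.range N, realCLM (stackEmb N i) (w i) := by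
  ext p
  rw [stack_apply, WithLp.ofLp_sum, Finset.sum_apply, Finset.sum_eq_single (p.1 : ℕ)]
  · simp [realCLM_apply, stackEmb]
  · intro i _ hi
    simp [realCLM_apply, stackEmb, hi.symm]
  · intro h
    exact absurd (Finset.mem_range.2 p.1.2) h

theorem IsPrimitive.stack {F f : ℕ → ℝ → EuclideanSpace ℂ (Fin n)}
    (h : ∀ i < N, IsPrimitive a b (F i) (f i)) :
    IsPrimitive a b (fun t => stack N fun i => F i t) (fun t => stack N fun i => f i t) := by
  simp only [stack_eq_sum]
  exact IsPrimitive.sum _ fun i hi => (h i (Finset.mem_range.1 hi)).clm _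

theorem integral_stack {μ : Measure ℝ} {F : ℕ → ℝ → EuclideanSpace ℂ (Fin n)}
    (h : ∀ i < N, Integrable (F i) μ) :
    ∫ t, stack N (fun i => F i t) ∂μ = stack N fun i => ∫ t, F i t ∂μ := by
  simp only [stack_eq_sum]
  rw [integral_finsetSum _ fun i hi =>
    (realCLM (stackEmb N i)).integrable_comp (h i (Finset.mem_range.1 hi))]
  exact Finset.sum_congr rfl fun i hi =>
    (realCLM (stackEmb N i)).integral_comp_comm (h i (Finset.mem_range.1 hi))

theorem smul_stack (c : ℝ) (w : ℕ → EuclideanSpace ℂ (Fin n)) :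
    c • stack N w = stack N fun i => c • w i := rfl

/-- The vector `((-1)ⁱ w_{i+1})` with `0 ≤ i < N`, which is `Q` applied to the jet of `x`. -/
def quasiJet (N : ℕ) (w : ℕ → ℝ → EuclideanSpace ℂ (Fin n)) (t : ℝ) :
    EuclideanSpace ℂ (Fin N × Fin n) :=
  stack N fun i => (-1 : ℂ) ^ i • w (i + 1) t

/-- The derivative of `quasiJet`. -/
def quasiJetDeriv (N : ℕ) (J : ℕ → Matrix (Fin n) (Fin n) ℂ) (x : ℝ → EuclideanSpace ℂ (Fin n))
    (w : ℕ → ℝ → EuclideanSpace ℂ (Fin n)) (t : ℝ) : EuclideanSpace ℂ (Fin N × Fin n) :=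
  stack N fun i => (-1 : ℂ) ^ i • (w i t - coeffOp N J i (x t))

variable {x z : ℝ → EuclideanSpace ℂ (Fin n)} {w : ℕ → ℝ → EuclideanSpace ℂ (Fin n)}

theorem IsJetChain.isPrimitive_quasiJet (h : IsJetChain a b N J x z w) :
    IsPrimitive a b (quasiJet N w) (quasiJetDeriv N J x w) :=
  IsPrimitive.stack (F := fun i t => (-1 : ℂ) ^ i • w (i + 1) t)
    (f := fun i t => (-1 : ℂ) ^ i • (w i t - coeffOp N J i (x t))) fun i hi => by
    have h1 := (h.chain.prim i hi).clm (realCLM ((-1 : ℂ) ^ i • LinearMap.id))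
    simp only [realCLM_apply, LinearMap.smul_apply, LinearMap.id_apply] at h1
    exact h1

/-- This is the weak form of the chain started at w_{i+1}. Collected over i, it says that the
integral of φq is Q applied to the vector of integrals of (-1)ᵏφ⁽ᵏ⁾x. -/
theorem IsJetChain.integral_test_succ (hab : a ≤ b) (h : IsJetChain a b N J x z w)
    (hx : IntegrableOn x (Ioo a b)) {φ : ℝ → ℝ} (hφ : φ ∈ testFunctions a b ℝ ℝ) {i : ℕ}
    (hi : i < N) :
    ∫ t in Ioo a b, φ t • w (i + 1) t = ∑ k ∈ Finset.range N,
      coeffOp N J (i + k + 1) ((-1 : ℝ) ^ k • ∫ t in Ioo a b, iteratedDeriv k φ t • x t) := by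
  obtain ⟨M, rfl⟩ : ∃ M, N = M + (i + 1) := ⟨N - (i + 1), by omega⟩
  have h1 := h.chain.shift.integral_test hab (ContinuousLinearMap.lsmul ℝ ℝ)
    (fun k _ => integrableOn_coeffOp hx _) hφ
  simp only [ContinuousLinearMap.lsmul_apply, zero_add] at h1
  rw [h1]
  have h2 : ∀ k, (-1 : ℝ) ^ k • ∫ t in Ioo a b, iteratedDeriv k φ t •
      coeffOp (M + (i + 1)) J (k + (i + 1)) (x t) = coeffOp (M + (i + 1)) J (i + k + 1)
        ((-1 : ℝ) ^ k • ∫ t in Ioo a b, iteratedDeriv k φ t • x t) := by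
    intro k
    have h3 := (realCLM (coeffOp (M + (i + 1)) J (i + k + 1))).integral_comp_comm
      (integrableOn_smul (continuous_testFunctions (iteratedDeriv_mem_testFunctions hφ k)) hx)
    rw [← realCLM_apply (coeffOp (M + (i + 1)) J (i + k + 1)), map_smul, ← h3]
    simp only [map_smul]
    rw [show k + (i + 1) = i + k + 1 by ring]
    rfl
  simp only [h2]
  -- The shifted chain has only M + 1 terms; the further k up to N give coefficients of index above
  -- N.
  refine Finset.sum_subset (fun k hk => ?_) fun k _ hk => ?_
  · have := Finset.mem_range.1 hk
    exact Finset.mem_range.2 (by omega)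
  · rw [coeffOp_of_lt, LinearMap.zero_apply]
    have : ¬ k < M + 1 := fun h => hk (Finset.mem_range.2 h)
    omega

theorem IsJetChain.continuousOn_succ (hab : a ≤ b) (h : IsJetChain a b N J x z w) {i : ℕ}
    (hi : i < N) : ContinuousOn (w (i + 1)) (Icc a b) :=
  (h.chain.prim i hi).continuousOn hab

theorem IsJetChain.integral_quasiJet (hab : a ≤ b) (h : IsJetChain a b N J x z w)
    (hx : IntegrableOn x (Ioo a b)) {φ : ℝ → ℝ} (hφ : φ ∈ testFunctions a b ℝ ℝ) :
    ∫ t in Ioo a b, φ t • quasiJet N w t = matAct (boundaryMatrix N J)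
      (stack N fun k => (-1 : ℝ) ^ k • ∫ t in Ioo a b, iteratedDeriv k φ t • x t) := by
  have hc : ∀ i < N, IntegrableOn (fun t => φ t • (-1 : ℂ) ^ i • w (i + 1) t) (Ioo a b) :=
    fun i hi => integrableOn_smul hφ.1.continuous
      ((((h.continuousOn_succ hab hi).const_smul ((-1 : ℂ) ^ i)).integrableOn_Icc).mono_set
        Ioo_subset_Icc_self)
  rw [matAct_boundaryMatrix_stack]
  simp only [quasiJet, smul_stack]
  rw [integral_stack hc]
  ext p
  rw [stack_apply, stack_apply, ← h.integral_test_succ hab hx hφ p.1.2, ← integral_smul]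
  simp only [smul_comm (φ _)]

/-- All test integrals of q lie in ran Q and are fixed by SSᴴ. Hence SSᴴq = q almost everywhere, and
by continuity on all of [a, b], endpoints included. -/
theorem IsJetChain.proj_quasiJet (hab : a < b) (h : IsJetChain a b N J x z w)
    (hx : IntegrableOn x (Ioo a b)) (R : ReducedFactorization (boundaryMatrix N J)) {t : ℝ}
    (ht : t ∈ Icc a b) : matAct (R.S * R.Sᴴ) (quasiJet N w t) = quasiJet N w t := by
  have hc : ContinuousOn (quasiJet N w) (Icc a b) := h.isPrimitive_quasiJet.continuousOn hab.le
  have hcP : ContinuousOn (fun t => realCLM (matAct (R.S * R.Sᴴ)) (quasiJet N w t)) (Icc a b) :=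
    (realCLM _).continuous.comp_continuousOn hc
  have hi : IntegrableOn (quasiJet N w) (Ioo a b) :=
    hc.integrableOn_Icc.mono_set Ioo_subset_Icc_self
  refine eqOn_Icc_of_ae_eq_Ioo hab hcP hc ?_ ht
  refine ae_eq_of_integral_test_eq (hcP.integrableOn_Icc.mono_set Ioo_subset_Icc_self) hi
    fun φ hφ => ?_
  have h1 := (realCLM (matAct (R.S * R.Sᴴ))).integral_comp_comm
    (integrableOn_smul hφ.1.continuous hi)
  simp only [map_smul] at h1
  rw [h1, h.integral_quasiJet hab.le hx hφ, realCLM_apply, ← matAct_mul, R.proj_mul]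

theorem IsJetChain.ae_proj_quasiJetDeriv (hab : a < b) (h : IsJetChain a b N J x z w)
    (hx : IntegrableOn x (Ioo a b)) (R : ReducedFactorization (boundaryMatrix N J)) :
    ∀ᵐ t ∂volume.restrict (Ioo a b),
      matAct (R.S * R.Sᴴ) (quasiJetDeriv N J x w t) = quasiJetDeriv N J x w t := by
  rw [ae_restrict_iff' measurableSet_Ioo]
  have hp := h.isPrimitive_quasiJet
  filter_upwards [hp.ae_hasDerivAt hab.le,
    (hp.clm (realCLM (matAct (R.S * R.Sᴴ)))).ae_hasDerivAt hab.le] with t h1 h2 ht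
  refine (h2 ht).unique ((h1 ht).congr_of_eventuallyEq ?_)
  filter_upwards [Ioo_mem_nhds ht.1 ht.2] with s hs
  exact h.proj_quasiJet hab hx R (Ioo_subset_Icc_self hs)

/-- The algebraic form of the jet equations. -/
theorem jet_equations {η η' : EuclideanSpace ℂ (Fin N × Fin n)}
    {w : ℕ → EuclideanSpace ℂ (Fin n)} {x : EuclideanSpace ℂ (Fin n)}
    (h : matAct (boundaryMatrix N J) η = stack N fun i => (-1 : ℂ) ^ i • w (i + 1))
    (h' : matAct (boundaryMatrix N J) η' =
      stack N fun i => (-1 : ℂ) ^ i • (w i - coeffOp N J i x))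
    (hN : w N = coeffOp N J N x) :
    (∀ i, 1 ≤ i → i ≤ N → ∑ j ∈ Finset.range N, coeffOp N J (i + 1 + j) (block η' j) =
      ∑ j ∈ Finset.range (N + 1), coeffOp N J (i + j) (block η j) - coeffOp N J i x) ∧
    w 0 = coeffOp N J 0 x + ∑ j ∈ Finset.range N, coeffOp N J (j + 1) (block η' j) := by
  have cancel : ∀ {i : ℕ} {u v : EuclideanSpace ℂ (Fin n)}, (-1 : ℂ) ^ i • u = (-1 : ℂ) ^ i • v →
      u = v := fun {i u v} huv => smul_right_injective _ (pow_ne_zero i (by norm_num)) huv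
  have e : ∀ i < N, ∑ j ∈ Finset.range N, coeffOp N J (i + j + 1) (block η j) = w (i + 1) := by
    intro i hi
    rw [← stack_block η, matAct_boundaryMatrix_stack] at h
    have := congrArg (fun u => block u i) h
    simp only [block_stack _ hi] at this
    exact cancel this
  have e' : ∀ i < N, ∑ j ∈ Finset.range N, coeffOp N J (i + j + 1) (block η' j) =
      w i - coeffOp N J i x := by
    intro i hi
    rw [← stack_block η', matAct_boundaryMatrix_stack] at h'
    have := congrArg (fun u => block u i) h'
    simp only [block_stack _ hi] at this
    exact cancel this
  constructor
  · intro i h1 hi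
    obtain ⟨i, rfl⟩ : ∃ k, i = k + 1 := ⟨i - 1, by omega⟩
    have e1 : ∑ j ∈ Finset.range (N + 1), coeffOp N J (i + 1 + j) (block η j) = w (i + 1) := by
      rw [Finset.sum_range_succ, coeffOp_of_lt (by omega), LinearMap.zero_apply, add_zero,
        ← e i (by omega)]
      simp only [add_right_comm]
    rw [e1]
    rcases hi.lt_or_eq with hlt | heq
    · rw [← e' (i + 1) hlt]
      simp only [add_right_comm]
    · rw [heq, hN, sub_self]
      exact Finset.sum_eq_zero fun j _ => by rw [coeffOp_of_lt (by omega), LinearMap.zero_apply]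
  · rcases N.eq_zero_or_pos with rfl | hpos
    -- For N = 0 the top and the bottom of the chain coincide.
    · simpa using hN
    · have := e' 0 hpos
      simp only [zero_add] at this
      rw [this]
      abel

/-- Green's identity for chains. -/
theorem IsJetChain.green (hab : a < b) (hJ : ∀ k ≤ N, J k = (-1 : ℂ) ^ (k + 1) • (J k)ᴴ)
    (R : ReducedFactorization (boundaryMatrix N J)) {x z v y : L2Space a b n}
    {w u : ℕ → ℝ → EuclideanSpace ℂ (Fin n)} (h : IsJetChain a b N J x z w)
    (k : IsJetChain a b N J v y u) :
    ⟪z, v⟫_ℂ + ⟪x, y⟫_ℂ = ⟪matAct R.pinv (quasiJet N w b), quasiJet N u b⟫_ℂ -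
      ⟪matAct R.pinv (quasiJet N w a), quasiJet N u a⟫_ℂ := by
  have hx := integrableOn_L2Space x
  have hv := integrableOn_L2Space v
  -- The integrand of Green's identity is the derivative of ⟨Q⁺q_x, q_v⟩; it remains to identify it
  -- pointwise almost everywhere.
  have hprim := (h.isPrimitive_quasiJet.clm (realCLM (matAct R.pinv))).bilin
    (innerReal (EuclideanSpace ℂ (Fin N × Fin n))) k.isPrimitive_quasiJet hab.le
  have hint := hprim.integral_eq hab.le
  simp only [innerReal_apply, realCLM_apply] at hint
  rw [← hint, ← integral_Ioo_eq hab.le, L2.inner_def, L2.inner_def,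
    ← integral_add (L2.integrable_inner z v) (L2.integrable_inner x y)]
  refine integral_congr_ae ?_
  have htop := h.chain.top
  have ktop := k.chain.top
  filter_upwards [ae_restrict_mem measurableSet_Ioo, h.ae_proj_quasiJetDeriv hab hx R,
    k.ae_proj_quasiJetDeriv hab hv R, htop, ktop, h.bot, k.bot] with t ht h1 k1 h2 k2 h3 k3
  have h0 := h.proj_quasiJet hab hx R (Ioo_subset_Icc_self ht)
  have k0 := k.proj_quasiJet hab hv R (Ioo_subset_Icc_self ht)
  -- The projection identities become Qη = q and Qη' = q' with η = Q⁺q and η' = Q⁺q', for both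
  -- chains.
  rw [← R.mul_pinv, matAct_mul] at h0 h1 k0 k1
  obtain ⟨hη, hz⟩ := jet_equations (w := fun i => w i t) h0 h1 h2
  obtain ⟨hν, hy⟩ := jet_equations (w := fun i => u i t) k0 k1 k2
  rw [h3] at hz
  rw [k3] at hy
  rw [← concomitant_product_rule (fun k hk => coeffOp_of_lt hk) (inner_coeffOp hJ) hη hz hν hy,
    ← inner_boundaryMatrix, ← inner_boundaryMatrix, k0, k1]

end StackedChain

/-! ## Boundary values -/

section BoundaryValues

variable {a b : ℝ} {n N : ℕ} {J : ℕ → Matrix (Fin n) (Fin n) ℂ}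

/-- The boundary values of a chain in terms of its quasi-jets at the end points. -/
def quasiBoundary {ι : Type*} [Fintype ι] [DecidableEq ι] {Q : Matrix ι ι ℂ}
    (R : ReducedFactorization Q) (qa qb : EuclideanSpace ℂ ι) : BdPair Q.rank :=
  ((1 / (Real.sqrt 2 : ℂ)) • matAct R.Sᴴ (qb - qa),
   (1 / (Real.sqrt 2 : ℂ)) • matAct R.Kinv (matAct R.Sᴴ (qb + qa)))

theorem inner_inv_sqrt_two_smul {G : Type*} [NormedAddCommGroup G] [InnerProductSpace ℂ G]
    (u v : G) : ⟪(1 / (Real.sqrt 2 : ℂ)) • u, (1 / (Real.sqrt 2 : ℂ)) • v⟫_ℂ = ⟪u, v⟫_ℂ / 2 := by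
  have h : (Real.sqrt 2 : ℂ) * (Real.sqrt 2 : ℂ) = 2 := by
    rw [← Complex.ofReal_mul, Real.mul_self_sqrt (by norm_num)]
    norm_num
  rw [inner_smul_left, inner_smul_right, map_div₀, map_one, Complex.conj_ofReal, ← mul_assoc,
    div_mul_div_comm, h, one_mul, one_div, div_eq_inv_mul]

/-- The factors 1/√2 give 1/2. The terms mixing a and b cancel because K⁻¹ is Hermitian, and the
unmixed ones occur twice. -/
theorem boundaryForm_quasiBoundary {ι : Type*} [Fintype ι] [DecidableEq ι] {Q : Matrix ι ι ℂ}
    (R : ReducedFactorization Q) (qa qb ra rb : EuclideanSpace ℂ ι) :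
    boundaryForm (quasiBoundary R qa qb) (quasiBoundary R ra rb) =
      ⟪matAct R.pinv qb, rb⟫_ℂ - ⟪matAct R.pinv qa, ra⟫_ℂ := by
  rw [boundaryForm, quasiBoundary, quasiBoundary, inner_inv_sqrt_two_smul,
    inner_inv_sqrt_two_smul, ← R.inner_Kinv_left, R.inner_pinv, R.inner_pinv]
  simp only [map_add, map_sub, inner_add_left, inner_add_right, inner_sub_left, inner_sub_right]
  ring

/-- `g` is a boundary value of `x`, where `z` is the image of `x` under the maximal operator. -/
def IsBoundaryValue (R : ReducedFactorization (boundaryMatrix N J)) (x z : L2Space a b n)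
    (g : BdPair (boundaryMatrix N J).rank) : Prop :=
  ∃ w, IsJetChain a b N J x z w ∧ g = quasiBoundary R (quasiJet N w a) (quasiJet N w b)

theorem quasiJet_of_jets (D : ℕ → ℝ → EuclideanSpace ℂ (Fin n)) (t : ℝ) :
    quasiJet N (fun i t => ∑ j ∈ Finset.range (N + 1), coeffOp N J (i + j) (D j t)) t =
      matAct (boundaryMatrix N J) (stack N fun j => D j t) := by
  rw [matAct_boundaryMatrix_stack, quasiJet]
  congr 1
  funext i
  rw [Finset.sum_range_succ, coeffOp_of_lt (by omega), LinearMap.zero_apply, add_zero]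
  simp only [add_right_comm]

/-- SᴴQ = KSᴴ and K⁻¹SᴴQ = Sᴴ, so when traces exist the quasi-jet definition reproduces the explicit
boundary map. -/
theorem quasiBoundary_matAct {ι : Type*} [Fintype ι] [DecidableEq ι] {Q : Matrix ι ι ℂ}
    (R : ReducedFactorization Q) (u v : EuclideanSpace ℂ ι) :
    quasiBoundary R (matAct Q u) (matAct Q v) =
      ((1 / (Real.sqrt 2 : ℂ)) • matAct (R.K * R.Sᴴ) (v - u),
       (1 / (Real.sqrt 2 : ℂ)) • matAct R.Sᴴ (v + u)) := by
  rw [quasiBoundary, ← map_sub, ← map_add, ← matAct_mul, ← matAct_mul, ← matAct_mul,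
    Matrix.mul_assoc R.Kinv, R.conjTranspose_S_mul, ← Matrix.mul_assoc R.Kinv, R.Kinv_mul_K,
    Matrix.one_mul]

/-- The weak form expresses the test integrals of the bottom term through x alone. Thus the chain
built from the derivatives of an H^N function ends in the same z. -/
theorem IsJetChain.ae_eq_bot (hab : a ≤ b) {x z : L2Space a b n}
    {w w' : ℕ → ℝ → EuclideanSpace ℂ (Fin n)} (h : IsJetChain a b N J x z w)
    (h' : IsPrimitiveChain a b N (fun k t => coeffOp N J k (x t)) w') :
    w' 0 =ᵐ[volume.restrict (Ioo a b)] z := by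
  have hx : ∀ k ≤ N, IntegrableOn (fun t => coeffOp N J k (x t)) (Ioo a b) :=
    fun k _ => integrableOn_coeffOp (integrableOn_L2Space x) k
  have hi : IntegrableOn (w' 0) (Ioo a b) := by
    rcases N.eq_zero_or_pos with rfl | hpos
    · exact (hx 0 le_rfl).congr h'.top.symm
    · have := (intervalIntegrable_iff_Ioo hab).1 (h'.prim 0 hpos).1
      refine (this.add (hx 0 hpos.le)).congr (Filter.Eventually.of_forall fun t => ?_)
      exact sub_add_cancel _ _
  refine ae_eq_of_integral_test_eq hi (integrableOn_L2Space z) fun φ hφ => ?_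
  have h1 := h.chain.integral_test hab (ContinuousLinearMap.lsmul ℝ ℝ) hx hφ
  have h2 := h'.integral_test hab (ContinuousLinearMap.lsmul ℝ ℝ) hx hφ
  have h3 : ∫ t in Ioo a b, φ t • z t = ∫ t in Ioo a b, φ t • w 0 t := by
    refine integral_congr_ae ?_
    filter_upwards [h.bot] with t ht
    rw [ht]
  rw [h3]
  exact h2.trans h1.symm

theorem isBoundaryValue_sobolev (hab : a < b) (R : ReducedFactorization (boundaryMatrix N J))
    {x z : L2Space a b n} (h : MaximalRel N J x z) (hx : MemSobolev a b N x) :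
    IsBoundaryValue R x z (sobolevBoundaryMap a b N J R x) := by
  obtain ⟨w, hw⟩ := h.exists_chain hab
  obtain ⟨D, hD, hD0⟩ := hx.exists_derivChain hab
  have h1 := hD.isJetChain (J := J) hab.le hD0 (Filter.EventuallyEq.refl _ _)
  refine ⟨_, ⟨h1.chain, hw.ae_eq_bot hab.le h1.chain⟩, ?_⟩
  rw [quasiJet_of_jets, quasiJet_of_jets, quasiBoundary_matAct,
    ← pointTrace_eq hab hx hD hD0 (left_mem_Icc.2 hab.le),
    ← pointTrace_eq hab hx hD hD0 (right_mem_Icc.2 hab.le)]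
  rfl

theorem memLp_of_continuous {p : ℝ → EuclideanSpace ℂ (Fin n)} (hp : Continuous p) :
    MemLp p 2 (volume.restrict (Ioo a b)) := by
  obtain ⟨C, hC⟩ := isCompact_Icc.exists_bound_of_continuousOn (s := Icc a b) hp.continuousOn
  refine MemLp.of_bound hp.aestronglyMeasurable C ?_
  filter_upwards [ae_restrict_mem measurableSet_Ioo] with t ht
  exact hC t (Ioo_subset_Icc_self ht)

theorem continuous_jets {p : ℝ → EuclideanSpace ℂ (Fin n)} (hp : ContDiff ℝ ∞ p) :
    Continuous fun t => ∑ j ∈ Finset.range (N + 1), coeffOp N J j (iteratedDeriv j p t) :=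
  continuous_finsetSum _ fun j _ => (realCLM (coeffOp N J j)).continuous.comp
    (hp.continuous_iteratedDeriv j (by exact_mod_cast le_top))

theorem maximalRel_smooth (hab : a < b) {p : ℝ → EuclideanSpace ℂ (Fin n)}
    (hp : ContDiff ℝ ∞ p) (hm : MemLp p 2 (volume.restrict (Ioo a b))) :
    MaximalRel N J (hm.toLp p)
      ((memLp_of_continuous (a := a) (b := b) (continuous_jets (N := N) (J := J) hp)).toLp _) :=
  ((isDerivChain_iteratedDeriv hp N).isJetChain hab.le (by
    simpa using hm.coeFn_toLp.symm) (MemLp.coeFn_toLp _).symm).maximalRel hab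

theorem memSobolev_smooth (hab : a < b) {p : ℝ → EuclideanSpace ℂ (Fin n)}
    (hp : ContDiff ℝ ∞ p) (hm : MemLp p 2 (volume.restrict (Ioo a b))) :
    MemSobolev a b N (hm.toLp p) := fun k hk =>
  ⟨(memLp_of_continuous (a := a) (b := b)
      (hp.continuous_iteratedDeriv k (by exact_mod_cast le_top))).toLp _,
    (isDerivChain_iteratedDeriv hp N).hasWeakDeriv hab.le hk (by simpa using hm.coeFn_toLp.symm)
      (MemLp.coeFn_toLp _).symm⟩

theorem pointTrace_smooth (hab : a < b) {p : ℝ → EuclideanSpace ℂ (Fin n)}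
    (hp : ContDiff ℝ ∞ p) (hm : MemLp p 2 (volume.restrict (Ioo a b))) {ξ : ℝ}
    (hξ : ξ ∈ Icc a b) :
    pointTrace a b N ξ (hm.toLp p) = stack N fun j => iteratedDeriv j p ξ :=
  pointTrace_eq hab (memSobolev_smooth hab hp hm) (isDerivChain_iteratedDeriv hp N)
    (by simpa using hm.coeFn_toLp.symm) hξ

theorem exists_sobolevBoundaryMap_eq (hab : a < b) (R : ReducedFactorization (boundaryMatrix N J))
    (g : BdPair (boundaryMatrix N J).rank) :
    ∃ x z : L2Space a b n, MaximalRel N J x z ∧ MemSobolev a b N x ∧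
      sobolevBoundaryMap a b N J R x = g := by
  set c : ℂ := 1 / (Real.sqrt 2 : ℂ) with hc
  have hcc : c * (c * 2) = 1 := by
    have h : (Real.sqrt 2 : ℂ) * (Real.sqrt 2 : ℂ) = 2 := by
      rw [← Complex.ofReal_mul, Real.mul_self_sqrt (by norm_num)]
      norm_num
    rw [← mul_assoc, hc, div_mul_div_comm, h]
    norm_num
  -- The traces solve vb - va = 2cSθ and vb + va = 2cSg₁ with c = 1/√2; then 2c² = 1 and SᴴS = 1
  -- return g.
  let θ := matAct R.Kinv g.1
  let vb := matAct R.S (c • (g.2 + θ))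
  let va := matAct R.S (c • (g.2 - θ))
  obtain ⟨p, hp, hpa, hpb⟩ := exists_contDiff_jets hab N (block va) (block vb)
  have hm : MemLp p 2 (volume.restrict (Ioo a b)) := memLp_of_continuous hp.continuous
  have ha : pointTrace a b N a (hm.toLp p) = va := by
    rw [pointTrace_smooth hab hp hm (left_mem_Icc.2 hab.le), ← stack_block va]
    ext q
    rw [stack_apply, stack_apply, hpa q.1 q.1.2]
  have hb : pointTrace a b N b (hm.toLp p) = vb := by
    rw [pointTrace_smooth hab hp hm (right_mem_Icc.2 hab.le), ← stack_block vb]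
    ext q
    rw [stack_apply, stack_apply, hpb q.1 q.1.2]
  refine ⟨_, _, maximalRel_smooth hab hp hm, memSobolev_smooth hab hp hm, ?_⟩
  have hsub : vb - va = matAct R.S ((c * 2) • θ) := by
    rw [← map_sub]
    congr 1
    module
  have hadd : vb + va = matAct R.S ((c * 2) • g.2) := by
    rw [← map_add]
    congr 1
    module
  rw [sobolevBoundaryMap, ha, hb, hsub, hadd, ← hc]
  refine Prod.ext ?_ ?_
  · change c • matAct (R.K * R.Sᴴ) (matAct R.S ((c * 2) • θ)) = g.1
    rw [← matAct_mul, Matrix.mul_assoc, R.orthonormal, Matrix.mul_one, map_smul, smul_smul, hcc,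
      one_smul, ← matAct_mul, R.K_mul_Kinv, matAct_one]
  · change c • matAct R.Sᴴ (matAct R.S ((c * 2) • g.2)) = g.2
    rw [← matAct_mul, R.orthonormal, matAct_one, smul_smul, hcc, one_smul]

/-- The symmetry of the coefficients reads (-1)ᵏJ_kᴴ = -J_k, so -𝓙₀φ is the expression ∑ J_kφ⁽ᵏ⁾.
Skew-symmetry of the minimal operator follows from this. -/
theorem maximalRel_test (hab : a < b) (hJ : ∀ k ≤ N, J k = (-1 : ℂ) ^ (k + 1) • (J k)ᴴ)
    (φ : TestFun a b n) :
    MaximalRel N J (testToL2 a b n φ) (-minimalOp a b N J (minimalElem N J φ)) := by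
  suffices h : -minimalOp a b N J (minimalElem N J φ) =
      (memLp_of_continuous (a := a) (b := b) (continuous_jets (N := N) (J := J) φ.2.1)).toLp _ by
    rw [h]
    exact maximalRel_smooth hab φ.2.1 (testFun_memLp φ)
  rw [minimalOp_apply, ← map_neg]
  change (testFun_memLp _).toLp _ = _
  refine MemLp.toLp_congr _ _ (Filter.Eventually.of_forall fun t => ?_)
  rw [← Finset.sum_neg_distrib, AddSubmonoidClass.coe_finsetSum, Finset.sum_apply]
  refine Finset.sum_congr rfl fun k hk => ?_
  have hk' : k ≤ N := by have := Finset.mem_range.1 hk; omega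
  change -((-1 : ℂ) ^ k • matAct (J k)ᴴ (iteratedDeriv k (φ : ℝ → EuclideanSpace ℂ (Fin n)) t)) = _
  rw [coeffOp_of_le hk']
  conv_rhs => rw [hJ k hk', matAct, map_smul, LinearMap.smul_apply, pow_succ, mul_neg_one, neg_smul]

theorem minimalOp_skew (hab : a < b) (hJ : ∀ k ≤ N, J k = (-1 : ℂ) ^ (k + 1) • (J k)ᴴ)
    (x y : (minimalOp a b N J).domain) :
    ⟪minimalOp a b N J x, (y : L2Space a b n)⟫_ℂ +
      ⟪(x : L2Space a b n), minimalOp a b N J y⟫_ℂ = 0 := by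
  obtain ⟨φ, rfl⟩ := minimalElem_surjective x
  obtain ⟨ψ, rfl⟩ := minimalElem_surjective y
  have h := maximalRel_iff.1 (maximalRel_test hab hJ ψ) φ
  rw [inner_neg_right] at h
  change ⟪minimalOp a b N J (minimalElem N J φ), testToL2 a b n ψ⟫_ℂ +
    ⟪testToL2 a b n φ, minimalOp a b N J (minimalElem N J ψ)⟫_ℂ = 0
  rw [← h, neg_add_cancel]

end BoundaryValues

end

/-! ### Assembly of the theorem. -/

theorem corollary3p12 (a b : ℝ) (hab : a < b) (n N : ℕ)
    (J : ℕ → Matrix (Fin n) (Fin n) ℂ)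
    (hJ : ∀ k ≤ N, J k = (-1 : ℂ) ^ (k + 1) • (J k)ᴴ)
    (R : ReducedFactorization (boundaryMatrix N J)) :
    (∃! Γ : (maximalOp a b N J).domain →ₗ[ℂ] BdPair (boundaryMatrix N J).rank,
      IsBoundaryExtension a b N J R Γ) ∧
    ∀ Γ : (maximalOp a b N J).domain →ₗ[ℂ] BdPair (boundaryMatrix N J).rank,
      IsBoundaryExtension a b N J R Γ →
      IsBoundaryTriplet (minimalOp a b N J) Γ ∧
      ∀ F E : Matrix (Fin (boundaryMatrix N J).rank) (Fin (boundaryMatrix N J).rank) ℂ,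
        (boundaryRestrict (maximalOp a b N J) Γ (kerPair F E)).IsClosed ∧
        -(boundaryRestrict (maximalOp a b N J) Γ (kerPair F E)).adjoint =
          boundaryRestrict (maximalOp a b N J) Γ (ranPair Eᴴ Fᴴ) ∧
        (IsMaximallyDissipative (boundaryRestrict (maximalOp a b N J) Γ (kerPair F E)).graph ↔
          (F * Eᴴ + E * Fᴴ).PosSemidef ∧
          (Matrix.fromCols F E).rank = (boundaryMatrix N J).rank) ∧
        (-(boundaryRestrict (maximalOp a b N J) Γ (kerPair F E)).adjoint =
            boundaryRestrict (maximalOp a b N J) Γ (kerPair F E) ↔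
          F * Eᴴ + E * Fᴴ = 0 ∧
          (Matrix.fromCols F E).rank = (boundaryMatrix N J).rank) := by
  obtain ⟨Γ, hT, hbd, hext, huniq⟩ := existsUnique_boundary_extension
    (T₀ := minimalOp a b N J) dense_minimalOp_domain (minimalOp_skew hab hJ)
    (BV := fun x g => IsBoundaryValue R x (maximalOp a b N J x) g)
    (D := {x | MemSobolev a b N (x : L2Space a b n)})
    (γ := fun x => sobolevBoundaryMap a b N J R x)
    (by
      rintro x y _ _ ⟨w, hw, rfl⟩ ⟨u, hu, rfl⟩
      rw [boundaryForm_quasiBoundary]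
      exact hw.green hab hJ R hu)
    (by
      intro x
      have hx : MaximalRel N J (x : L2Space a b n) (maximalOp a b N J x) := ⟨x.2, rfl⟩
      obtain ⟨w, hw⟩ := hx.exists_chain hab
      exact ⟨_, w, hw, rfl⟩)
    (by
      intro g
      obtain ⟨x, z, ⟨hx, rfl⟩, hs, rfl⟩ := exists_sobolevBoundaryMap_eq (J := J) hab R g
      exact ⟨⟨x, hx⟩, hs, isBoundaryValue_sobolev hab R ⟨hx, rfl⟩ hs⟩)
    (fun p hp => by
      have hx : MaximalRel N J (p : L2Space a b n) (maximalOp a b N J p) := ⟨p.2, rfl⟩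
      exact isBoundaryValue_sobolev hab R hx hp)
    (by
      intro x
      obtain ⟨φ, rfl⟩ := minimalElem_surjective x
      obtain ⟨h, -⟩ := maximalRel_test hab hJ φ
      exact ⟨h, memSobolev_smooth hab φ.2.1 (testFun_memLp φ)⟩)
  -- By uniqueness, every bounded extension is the one constructed, so the abstract results for that
  -- triplet apply to it.
  have hΓ : ∀ Γ', IsBoundaryExtension a b N J R Γ' → Γ' = Γ :=
    fun Γ' h => huniq Γ' h.bounded h.extends_sobolev
  refine ⟨⟨Γ, ⟨hbd, hext⟩, hΓ⟩, fun Γ' h => ?_⟩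
  obtain rfl := hΓ Γ' h
  exact ⟨hT, hT.restrict_kerPair⟩
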